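/- Let $k$ be a commutative ring. An $\mathbb{S}$-module is a sequence $\mathfrak g=(\mathfrak g_m)_{m\ge 0}$ of $k$-modules with a $k$-linear action of the symmetric group $S_m$ on $\mathfrak g_m$; for $x\in\mathfrak g_m$ write $|x|=m$. $\mathbb{S}$-modules form a symmetric monoidal category under $$(\mathfrak g\otimes_{\mathbb S}\mathfrak h)_p=\bigoplus_{m+n=p}\operatorname{Ind}_{S_m\times S_n}^{S_p}(\mathfrak g_m\otimes_k\mathfrak h_n),\qquad \beta(x\otimes y)=(12)^{|y|,|x|}(y\otimes x),$$ where for $\sigma\in S_n$ the element $\sigma^{i_1,\dots,i_n}\in S_{i_1+\cdots+i_n}$ permutes the consecutive blocks of sizes $i_1,\dots,i_n$ according to $\sigma$, preserving the order inside each block. Twisted associative, commutative, Lie and co-algebras are the corresponding objects of this category. Let $\mathfrak g$ be a twisted pre-Lie algebra over $k$: an $\mathbb{S}$-module with a morphism $\circ:\mathfrak g\otimes_{\mathbb S}\mathfrak g\to\mathfrak g$ such that for all homogeneous $x,y,z$ $$(x\circ y)\circ z-x\circ(y\circ z)=(23)^{|x|,|z|,|y|}\bigl((x\circ z)\circ y-x\circ(z\circ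 y)\bigr).$$ Equip $\mathfrak g$ with the associated twisted Lie bracket $\{x,y\}=x\circ y-(12)^{|y|,|x|}(y\circ x)$. Let $T_{\mathbb S}\mathfrak g$ be the free twisted associative algebra on $\mathfrak g$, and let $$\operatorname{Sym}_{\mathbb S}\mathfrak g=T_{\mathbb S}\mathfrak g/\bigl(xy-(12)^{|y|,|x|}yx\bigr)_{x,y\in\mathfrak g},\qquad U_{\mathbb S}\mathfrak g=T_{\mathbb S}\mathfrak g/\bigl(xy-(12)^{|y|,|x|}yx-\{x,y\}\bigr)_{x,y\in\mathfrak g},$$ the quotients being by the generated twisted ideals (two-sided ideals that are $\mathbb S$-submodules). Both are twisted coalgebras: the coproduct $\Delta$ is the morphism of twisted algebras to the tensor square with $\Delta(x)=1\otimes x+x\otimes 1$ for $x\in\mathfrak g$, and the counit is the morphism of twisted algebras to $k$ that vanishes on $\mathfrak g$. Let $\operatorname{Sym}^n_{\mathbb S}\mathfrak g\subseteq\operatorname{Sym}_{\mathbb S}\mathfrak g$ and $F_nU_{\mathbb S}\mathfrak g\subseteq U_{\mathbb S}\mathfrak g$ be the $\mathbb S$-submodules generated by the products of exactly $n$, respectively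 at most $n$, elements of $\mathfrak g$; let $\operatorname{gr}U_{\mathbb S}\mathfrak g=\bigoplus_n F_nU_{\mathbb S}\mathfrak g/F_{n-1}U_{\mathbb S}\mathfrak g$ (with $F_{-1}=0$), and let $\pi:\operatorname{Sym}_{\mathbb S}\mathfrak g\to\operatorname{gr}U_{\mathbb S}\mathfrak g$ be the canonical morphism of twisted algebras, which sends $x\in\mathfrak g$ to its class in $\operatorname{gr}_1U_{\mathbb S}\mathfrak g$. Then: 1. $\pi$ is an isomorphism. 2. $\pi$ lifts to an isomorphism of twisted coalgebras $\Phi:\operatorname{Sym}_{\mathbb S}\mathfrak g\to U_{\mathbb S}\mathfrak g$; that is, $\Phi$ is an isomorphism of $\mathbb S$-modules compatible with coproducts and counits, and for all $n$ and all $s\in\operatorname{Sym}^n_{\mathbb S}\mathfrak g$ one has $\Phi(s)\in F_nU_{\mathbb S}\mathfrak g$ and the class of $\Phi(s)$ in $\operatorname{gr}_nU_{\mathbb S}\mathfrak g$ is $\pi(s)$. -/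

import Mathlib

open scoped TensorProduct DirectSum

universe u v w v' w'

set_option linter.unusedSimpArgs false

namespace TwPBW

/-! ### Block permutations -/

/-- The block sum `e × f` of two bijections. For `e ∈ S_m`, `f ∈ S_n` this is the standard
inclusion `S_m × S_n ⊆ S_{m+n}`. -/
def blockSum {m m' n n' : ℕ} (e : Fin m ≃ Fin m') (f : Fin n ≃ Fin n') :
    Fin (m + n) ≃ Fin (m' + n') :=
  finSumFinEquiv.symm.trans ((Equiv.sumCongr e f).trans finSumFinEquiv)

/-- The permutation `(12)^{m,n}` exchanging the block of the first `m` letters with the block of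
the last `n` letters, preserving the order inside the blocks. -/
def blockSwap (m n : ℕ) : Fin (m + n) ≃ Fin (n + m) :=
  finSumFinEquiv.symm.trans ((Equiv.sumComm _ _).trans finSumFinEquiv)

/-- The identification `l + m + n = l + (m + n)`: the identity permutation. -/
def blockAssoc (l m n : ℕ) : Fin (l + m + n) ≃ Fin (l + (m + n)) :=
  finCongr (Nat.add_assoc l m n)

/-- The identification `0 + n = n`: the identity permutation. -/
def blockZeroLeft (n : ℕ) : Fin (0 + n) ≃ Fin n := finCongr (Nat.zero_add n)

/-- The identification `n + 0 = n`: the identity permutation. -/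
def blockZeroRight (n : ℕ) : Fin (n + 0) ≃ Fin n := finCongr (Nat.add_zero n)

/-- The permutation `(23)^{a,b,c,d}`, exchanging the two middle blocks. -/
def blockMid (a b c d : ℕ) : Fin ((a + b) + (c + d)) ≃ Fin ((a + c) + (b + d)) :=
  finSumFinEquiv.symm.trans
    ((Equiv.sumCongr finSumFinEquiv.symm finSumFinEquiv.symm).trans
      ((Equiv.sumSumSumComm _ _ _ _).trans
        ((Equiv.sumCongr finSumFinEquiv finSumFinEquiv).trans finSumFinEquiv)))

section blocks
variable {m m' n n' l : ℕ}

theorem blockSum_left (e : Fin m ≃ Fin m') (f : Fin n ≃ Fin n') (i : Fin m) :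
    blockSum e f (Fin.castAdd n i) = Fin.castAdd n' (e i) := by
  simp [blockSum]

theorem blockSum_right (e : Fin m ≃ Fin m') (f : Fin n ≃ Fin n') (i : Fin n) :
    blockSum e f (Fin.natAdd m i) = Fin.natAdd m' (f i) := by
  simp [blockSum]

theorem blockSwap_left (i : Fin m) :
    blockSwap m n (Fin.castAdd n i) = Fin.natAdd n i := by
  simp [blockSwap]

theorem blockSwap_right (i : Fin n) :
    blockSwap m n (Fin.natAdd m i) = Fin.castAdd m i := by
  simp [blockSwap]

theorem blockAssoc_left (i : Fin l) :
    blockAssoc l m n (Fin.castAdd n (Fin.castAdd m i)) = Fin.castAdd (m + n) i := by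
  ext; simp [blockAssoc]

theorem blockAssoc_mid (i : Fin m) :
    blockAssoc l m n (Fin.castAdd n (Fin.natAdd l i)) = Fin.natAdd l (Fin.castAdd n i) := by
  ext; simp [blockAssoc]

theorem blockAssoc_right (i : Fin n) :
    blockAssoc l m n (Fin.natAdd (l + m) i) = Fin.natAdd l (Fin.natAdd m i) := by
  ext; simp [blockAssoc, Nat.add_assoc]

theorem blockAssoc_symm_left (i : Fin l) :
    (blockAssoc l m n).symm (Fin.castAdd (m + n) i) = Fin.castAdd n (Fin.castAdd m i) := by
  rw [Equiv.symm_apply_eq, blockAssoc_left]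

theorem blockAssoc_symm_mid (i : Fin m) :
    (blockAssoc l m n).symm (Fin.natAdd l (Fin.castAdd n i)) =
      Fin.castAdd n (Fin.natAdd l i) := by
  rw [Equiv.symm_apply_eq, blockAssoc_mid]

theorem blockAssoc_symm_right (i : Fin n) :
    (blockAssoc l m n).symm (Fin.natAdd l (Fin.natAdd m i)) = Fin.natAdd (l + m) i := by
  rw [Equiv.symm_apply_eq, blockAssoc_right]

theorem blockZeroLeft_right (i : Fin n) : blockZeroLeft n (Fin.natAdd 0 i) = i := by
  ext; simp [blockZeroLeft]

theorem blockZeroLeft_symm (i : Fin n) : (blockZeroLeft n).symm i = Fin.natAdd 0 i := by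
  rw [Equiv.symm_apply_eq, blockZeroLeft_right]

theorem blockZeroRight_left (i : Fin n) : blockZeroRight n (Fin.castAdd 0 i) = i := by
  ext; simp [blockZeroRight]

theorem blockZeroRight_symm (i : Fin n) : (blockZeroRight n).symm i = Fin.castAdd 0 i := by
  rw [Equiv.symm_apply_eq, blockZeroRight_left]

theorem blockMid_ll {a b c d : ℕ} (i : Fin a) :
    blockMid a b c d (Fin.castAdd _ (Fin.castAdd _ i)) = Fin.castAdd _ (Fin.castAdd _ i) := by
  simp [blockMid]

theorem blockMid_lr {a b c d : ℕ} (i : Fin b) :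
    blockMid a b c d (Fin.castAdd _ (Fin.natAdd _ i)) = Fin.natAdd _ (Fin.castAdd _ i) := by
  simp [blockMid]

theorem blockMid_rl {a b c d : ℕ} (i : Fin c) :
    blockMid a b c d (Fin.natAdd _ (Fin.castAdd _ i)) = Fin.castAdd _ (Fin.natAdd _ i) := by
  simp [blockMid]

theorem blockMid_rr {a b c d : ℕ} (i : Fin d) :
    blockMid a b c d (Fin.natAdd _ (Fin.natAdd _ i)) = Fin.natAdd _ (Fin.natAdd _ i) := by
  simp [blockMid]

theorem equiv_ext_add {X : Type*} {e f : Fin (m + n) ≃ X}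
    (h₁ : ∀ i, e (Fin.castAdd n i) = f (Fin.castAdd n i))
    (h₂ : ∀ i, e (Fin.natAdd m i) = f (Fin.natAdd m i)) : e = f :=
  Equiv.ext fun i => Fin.addCases h₁ h₂ i

theorem forall_fin_add {P : Fin (m + n) → Prop} :
    (∀ i, P i) ↔ (∀ i, P (Fin.castAdd n i)) ∧ ∀ i, P (Fin.natAdd m i) :=
  ⟨fun h => ⟨fun _ => h _, fun _ => h _⟩, fun h i => Fin.addCases h.1 h.2 i⟩

theorem forall_fin_zero {P : Fin 0 → Prop} : (∀ i, P i) ↔ True :=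
  ⟨fun _ => trivial, fun _ i => i.elim0⟩

end blocks

/-! ### `𝕊`-modules -/

/-- An `𝕊`-module over `k`: a sequence of `k`-modules `M_m`, `m ≥ 0`, with a `k`-linear (left)
action of the symmetric group `S_m` on `M_m`. The action is recorded as a functor on the groupoid
of the sets `Fin m` and their bijections. A bijection `Fin m ≃ Fin n` exists only for `m = n`, so
this is the same as an action of each `Equiv.Perm (Fin m)` on `obj m` (see `SMod.rep`,
`SMod.ofRep`); the larger family just absorbs identifications such as `l + m + n = l + (m + n)`. -/
structure SMod (k : Type u) [CommRing k] where
  obj : ℕ → Type v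
  [acg : ∀ m, AddCommGroup (obj m)]
  [mod : ∀ m, Module k (obj m)]
  map : ∀ {m n : ℕ}, (Fin m ≃ Fin n) → obj m →ₗ[k] obj n
  map_refl : ∀ {m : ℕ} (x : obj m), map (Equiv.refl _) x = x
  map_trans : ∀ {l m n : ℕ} (e : Fin l ≃ Fin m) (f : Fin m ≃ Fin n) (x : obj l),
    map (e.trans f) x = map f (map e x)

attribute [instance] SMod.acg SMod.mod

variable {k : Type u} [CommRing k]

/-- The representation of `S_m` on the degree `m` part of an `𝕊`-module. -/
def SMod.rep (M : SMod.{u, v} k) (m : ℕ) : Representation k (Equiv.Perm (Fin m)) (M.obj m) where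
  toFun σ := M.map σ
  map_one' := LinearMap.ext fun x => M.map_refl x
  map_mul' σ τ := LinearMap.ext fun x => M.map_trans τ σ x

/-- The `𝕊`-module given by a sequence of representations of the symmetric groups `S_m`. -/
def SMod.ofRep (V : ℕ → Type v) [∀ m, AddCommGroup (V m)] [∀ m, Module k (V m)]
    (ρ : ∀ m, Representation k (Equiv.Perm (Fin m)) (V m)) : SMod.{u, v} k where
  obj := V
  map {m n} e :=
    have h : m = n := by simpa using Fintype.card_congr e
    h.recOn (motive := fun n _ => (Fin m ≃ Fin n) → V m →ₗ[k] V n) (fun σ => ρ m σ) e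
  map_refl x := by
    change ρ _ 1 x = x
    simp
  map_trans {l m n} e f x := by
    obtain rfl : l = m := by simpa using Fintype.card_congr e
    obtain rfl : l = n := by simpa using Fintype.card_congr f
    change ρ _ (f * e) x = ρ _ f (ρ _ e x)
    simp

/-- Morphisms of `𝕊`-modules. -/
structure SMod.Hom (M : SMod.{u, v} k) (N : SMod.{u, w} k) where
  app : ∀ n, M.obj n →ₗ[k] N.obj n
  app_map : ∀ {m n : ℕ} (e : Fin m ≃ Fin n) (x : M.obj m),
    app n (M.map e x) = N.map e (app m x)

/-- Composition of morphisms of `𝕊`-modules. -/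
def SMod.Hom.comp {L : SMod.{u, v} k} {M : SMod.{u, w} k} {N : SMod.{u, w'} k}
    (g : SMod.Hom M N) (f : SMod.Hom L M) : SMod.Hom L N where
  app n := g.app n ∘ₗ f.app n
  app_map e x := by rw [LinearMap.comp_apply, LinearMap.comp_apply, f.app_map, g.app_map]

/-! ### Twisted pre-Lie and Lie algebras -/

/-- A (right) twisted pre-Lie algebra: an `𝕊`-module with an operation `x ∘ y`
(a morphism `g ⊗ g → g` of `𝕊`-modules) such that
`(x ∘ y) ∘ z - x ∘ (y ∘ z) = (23)^{|x|,|z|,|y|} ((x ∘ z) ∘ y - x ∘ (z ∘ y))`. -/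
structure TwPreLie (k : Type u) [CommRing k] extends SMod.{u, v} k where
  op : ∀ {m n : ℕ}, obj m →ₗ[k] obj n →ₗ[k] obj (m + n)
  op_map : ∀ {m m' n n' : ℕ} (e : Fin m ≃ Fin m') (f : Fin n ≃ Fin n') (x : obj m) (y : obj n),
    op (map e x) (map f y) = map (blockSum e f) (op x y)
  preLie : ∀ {l m n : ℕ} (x : obj l) (y : obj m) (z : obj n),
    map (blockAssoc l m n) (op (op x y) z) - op x (op y z) =
      map (blockSum (Equiv.refl (Fin l)) (blockSwap n m))
        (map (blockAssoc l n m) (op (op x z) y) - op x (op z y))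

/-- A twisted Lie algebra. The permutations in the Jacobi identity are `(123)^{|y|,|z|,|x|}` and
`(132)^{|z|,|x|,|y|}`, which put the three blocks in the order `x`, `y`, `z`. -/
structure TwLie (k : Type u) [CommRing k] extends SMod.{u, v} k where
  br : ∀ {m n : ℕ}, obj m →ₗ[k] obj n →ₗ[k] obj (m + n)
  br_map : ∀ {m m' n n' : ℕ} (e : Fin m ≃ Fin m') (f : Fin n ≃ Fin n') (x : obj m) (y : obj n),
    br (map e x) (map f y) = map (blockSum e f) (br x y)
  skew : ∀ {m n : ℕ} (x : obj m) (y : obj n), br x y = -map (blockSwap n m) (br y x)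
  jacobi : ∀ {l m n : ℕ} (x : obj l) (y : obj m) (z : obj n),
    br x (br y z) +
      map ((blockAssoc m n l).symm.trans (blockSwap (m + n) l)) (br y (br z x)) +
      map ((blockSwap n (l + m)).trans (blockAssoc l m n)) (br z (br x y)) = 0

theorem blockSum_trans {a b c a' b' c' : ℕ} (e : Fin a ≃ Fin b) (f : Fin b ≃ Fin c)
    (e' : Fin a' ≃ Fin b') (f' : Fin b' ≃ Fin c') :
    (blockSum e e').trans (blockSum f f') = blockSum (e.trans f) (e'.trans f') := by
  simp only [Equiv.ext_iff, forall_fin_add, Equiv.trans_apply, blockSum_left, blockSum_right,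
    implies_true, and_self]

theorem blockSum_swap {m m' n n' : ℕ} (e : Fin m ≃ Fin m') (f : Fin n ≃ Fin n') :
    (blockSum e f).trans (blockSwap m' n') = (blockSwap m n).trans (blockSum f e) := by
  simp only [Equiv.ext_iff, forall_fin_add, Equiv.trans_apply, blockSum_left, blockSum_right,
    blockSwap_left, blockSwap_right, implies_true, and_self]

/-- The twisted Lie algebra associated with a twisted pre-Lie algebra:
`{x, y} = x ∘ y - (12)^{|y|,|x|} (y ∘ x)`. -/
def TwPreLie.toTwLie (g : TwPreLie.{u, v} k) : TwLie.{u, v} k where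
  toSMod := g.toSMod
  br {m n} := g.op - (g.op.flip).compr₂ (g.map (blockSwap n m))
  br_map e f x y := by
    simp only [LinearMap.sub_apply, LinearMap.compr₂_apply, LinearMap.flip_apply, g.op_map,
      map_sub, ← g.map_trans, blockSum_swap]
  skew {m n} x y := by
    simp only [LinearMap.sub_apply, LinearMap.compr₂_apply, LinearMap.flip_apply,
      map_sub, ← g.map_trans]
    rw [show (blockSwap m n).trans (blockSwap n m) = Equiv.refl _ by
      simp only [Equiv.ext_iff, forall_fin_add, Equiv.trans_apply, Equiv.refl_apply,
        blockSwap_left, blockSwap_right, implies_true, and_self], g.map_refl]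
    abel
  jacobi {l m n} x y z := by
    have opl : ∀ {a b b' : ℕ} (f : Fin b ≃ Fin b') (x : g.obj a) (y : g.obj b),
        g.op x (g.map f y) = g.map (blockSum (Equiv.refl _) f) (g.op x y) := by
      intro a b b' f x y
      conv_lhs => rw [← g.map_refl x, g.op_map]
    have opr : ∀ {a a' b : ℕ} (f : Fin a ≃ Fin a') (x : g.obj a) (y : g.obj b),
        g.op (g.map f x) y = g.map (blockSum f (Equiv.refl _)) (g.op x y) := by
      intro a a' b f x y
      conv_lhs => rw [← g.map_refl y, g.op_map]
    have h₁ := g.preLie x y z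
    have h₂ := congrArg (g.map ((blockAssoc m n l).symm.trans (blockSwap (m + n) l)))
      (g.preLie y z x)
    have h₃ := congrArg (g.map ((blockSwap n (l + m)).trans (blockAssoc l m n)))
      (g.preLie z x y)
    simp only [LinearMap.sub_apply, LinearMap.compr₂_apply, LinearMap.flip_apply,
      map_sub, opl, opr, ← g.map_trans] at h₁ h₂ h₃ ⊢
    have e₁ : blockSwap (m + n) l = (blockAssoc m n l).trans
        ((blockAssoc m n l).symm.trans (blockSwap (m + n) l)) := by
      rw [← Equiv.trans_assoc, Equiv.self_trans_symm, Equiv.refl_trans]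
    have e₂ : (blockSwap (l + m) n).trans ((blockSwap n (l + m)).trans (blockAssoc l m n)) =
        blockAssoc l m n := by
      simp only [Equiv.ext_iff, forall_fin_add, Equiv.trans_apply, blockSwap_left,
        blockSwap_right, implies_true, and_self]
    have e₃ : (blockSum (blockSwap n m) (Equiv.refl (Fin l))).trans (blockSwap (m + n) l) =
        ((blockAssoc n m l).trans (blockSum (Equiv.refl (Fin n)) (blockSwap m l))).trans
            ((blockSwap n (l + m)).trans (blockAssoc l m n)) := by
      simp only [Equiv.ext_iff, forall_fin_add, Equiv.trans_apply, Equiv.refl_apply,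
        blockSum_left, blockSum_right, blockSwap_left, blockSwap_right, blockAssoc_left,
        blockAssoc_mid, blockAssoc_right, implies_true, and_self]
    have e₄ : (blockSwap (n + l) m).trans
          ((blockAssoc m n l).symm.trans (blockSwap (m + n) l)) =
        (blockAssoc n l m).trans ((blockSwap n (l + m)).trans (blockAssoc l m n)) := by
      simp only [Equiv.ext_iff, forall_fin_add, Equiv.trans_apply,
        blockSwap_left, blockSwap_right, blockAssoc_left,
        blockAssoc_mid, blockAssoc_right, blockAssoc_symm_left, blockAssoc_symm_mid,
        blockAssoc_symm_right, implies_true, and_self]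
    have e₅ : ((blockSum (blockSwap l n) (Equiv.refl (Fin m))).trans (blockSwap (n + l) m)).trans
          ((blockAssoc m n l).symm.trans (blockSwap (m + n) l)) =
        (blockAssoc l n m).trans (blockSum (Equiv.refl (Fin l)) (blockSwap n m)) := by
      simp only [Equiv.ext_iff, forall_fin_add, Equiv.trans_apply, Equiv.refl_apply,
        blockSum_left, blockSum_right, blockSwap_left, blockSwap_right, blockAssoc_left,
        blockAssoc_mid, blockAssoc_right, blockAssoc_symm_left, blockAssoc_symm_mid,
        blockAssoc_symm_right, implies_true, and_self]
    have e₆ : ((blockSum (blockSwap m l) (Equiv.refl (Fin n))).trans (blockSwap (l + m) n)).trans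
          ((blockSwap n (l + m)).trans (blockAssoc l m n)) =
        ((blockAssoc m l n).trans (blockSum (Equiv.refl (Fin m)) (blockSwap l n))).trans
            ((blockAssoc m n l).symm.trans (blockSwap (m + n) l)) := by
      simp only [Equiv.ext_iff, forall_fin_add, Equiv.trans_apply, Equiv.refl_apply,
        blockSum_left, blockSum_right, blockSwap_left, blockSwap_right, blockAssoc_left,
        blockAssoc_mid, blockAssoc_right, blockAssoc_symm_left, blockAssoc_symm_mid,
        blockAssoc_symm_right, implies_true, and_self]
    rw [← e₁] at h₂
    rw [e₂, e₃, e₄, e₅, e₆]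
    linear_combination (norm := module) -h₁ - h₂ - h₃

/-! ### Twisted associative algebras -/

/-- A (unital) twisted associative algebra: an `𝕊`-module with an associative product
`A_m ⊗ A_n → A_{m+n}` that is `S_m × S_n`-equivariant, and a unit in degree zero. -/
structure TwAlg (k : Type u) [CommRing k] extends SMod.{u, v} k where
  one : obj 0
  mul : ∀ {m n : ℕ}, obj m →ₗ[k] obj n →ₗ[k] obj (m + n)
  mul_map : ∀ {m m' n n' : ℕ} (e : Fin m ≃ Fin m') (f : Fin n ≃ Fin n') (x : obj m) (y : obj n),
    mul (map e x) (map f y) = map (blockSum e f) (mul x y)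
  mul_assoc : ∀ {l m n : ℕ} (x : obj l) (y : obj m) (z : obj n),
    map (blockAssoc l m n) (mul (mul x y) z) = mul x (mul y z)
  one_mul : ∀ {n : ℕ} (x : obj n), map (blockZeroLeft n) (mul one x) = x
  mul_one : ∀ {n : ℕ} (x : obj n), map (blockZeroRight n) (mul x one) = x

/-- Morphisms of twisted associative algebras. -/
structure TwAlg.Hom (A : TwAlg.{u, v} k) (B : TwAlg.{u, w} k) extends
    SMod.Hom A.toSMod B.toSMod where
  app_one : app 0 A.one = B.one
  app_mul : ∀ {m n : ℕ} (x : A.obj m) (y : A.obj n),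
    app (m + n) (A.mul x y) = B.mul (app m x) (app n y)

/-! ### The free twisted associative algebra -/

section free

variable (M : SMod.{u, v} k)

/-- Formal expressions in elements of `M`, graded by degree. -/
inductive FreePre : ℕ → Type (max u v)
  | of {n : ℕ} (x : M.obj n) : FreePre n
  | one : FreePre 0
  | zero {n : ℕ} : FreePre n
  | add {n : ℕ} (a b : FreePre n) : FreePre n
  | smul {n : ℕ} (c : k) (a : FreePre n) : FreePre n
  | map {m n : ℕ} (e : Fin m ≃ Fin n) (a : FreePre m) : FreePre n
  | mul {m n : ℕ} (a : FreePre m) (b : FreePre n) : FreePre (m + n)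

/-- The relations between formal expressions imposed by the axioms of a twisted associative
algebra and by the requirement that `of` be a morphism of `𝕊`-modules. -/
inductive FreeRel : ∀ {n : ℕ}, FreePre M n → FreePre M n → Prop
  -- compatibility with the operations
  | add_left {n : ℕ} {a a' b : FreePre M n} : FreeRel a a' → FreeRel (.add a b) (.add a' b)
  | add_right {n : ℕ} {a b b' : FreePre M n} : FreeRel b b' → FreeRel (.add a b) (.add a b')
  | smul {n : ℕ} {c : k} {a a' : FreePre M n} : FreeRel a a' → FreeRel (.smul c a) (.smul c a')
  | map {m n : ℕ} {e : Fin m ≃ Fin n} {a a' : FreePre M m} :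
      FreeRel a a' → FreeRel (.map e a) (.map e a')
  | mul_left {m n : ℕ} {a a' : FreePre M m} {b : FreePre M n} :
      FreeRel a a' → FreeRel (.mul a b) (.mul a' b)
  | mul_right {m n : ℕ} {a : FreePre M m} {b b' : FreePre M n} :
      FreeRel b b' → FreeRel (.mul a b) (.mul a b')
  -- each degree is a `k`-module
  | add_comm {n : ℕ} (a b : FreePre M n) : FreeRel (.add a b) (.add b a)
  | add_assoc {n : ℕ} (a b c : FreePre M n) :
      FreeRel (.add (.add a b) c) (.add a (.add b c))
  | zero_add {n : ℕ} (a : FreePre M n) : FreeRel (.add .zero a) a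
  | neg_add {n : ℕ} (a : FreePre M n) : FreeRel (.add (.smul (-1) a) a) .zero
  | smul_add {n : ℕ} (c : k) (a b : FreePre M n) :
      FreeRel (.smul c (.add a b)) (.add (.smul c a) (.smul c b))
  | add_smul {n : ℕ} (c d : k) (a : FreePre M n) :
      FreeRel (.smul (c + d) a) (.add (.smul c a) (.smul d a))
  | mul_smul {n : ℕ} (c d : k) (a : FreePre M n) :
      FreeRel (.smul (c * d) a) (.smul c (.smul d a))
  | one_smul {n : ℕ} (a : FreePre M n) : FreeRel (.smul 1 a) a
  -- the symmetric groups act linearly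
  | map_add {m n : ℕ} (e : Fin m ≃ Fin n) (a b : FreePre M m) :
      FreeRel (.map e (.add a b)) (.add (.map e a) (.map e b))
  | map_smul {m n : ℕ} (e : Fin m ≃ Fin n) (c : k) (a : FreePre M m) :
      FreeRel (.map e (.smul c a)) (.smul c (.map e a))
  | map_refl {n : ℕ} (a : FreePre M n) : FreeRel (.map (Equiv.refl _) a) a
  | map_trans {l m n : ℕ} (e : Fin l ≃ Fin m) (f : Fin m ≃ Fin n) (a : FreePre M l) :
      FreeRel (.map (e.trans f) a) (.map f (.map e a))
  -- the product is bilinear, equivariant, associative and unital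
  | add_mul {m n : ℕ} (a a' : FreePre M m) (b : FreePre M n) :
      FreeRel (.mul (.add a a') b) (.add (.mul a b) (.mul a' b))
  | smul_mul {m n : ℕ} (c : k) (a : FreePre M m) (b : FreePre M n) :
      FreeRel (.mul (.smul c a) b) (.smul c (.mul a b))
  | mul_add {m n : ℕ} (a : FreePre M m) (b b' : FreePre M n) :
      FreeRel (.mul a (.add b b')) (.add (.mul a b) (.mul a b'))
  | mul_smul' {m n : ℕ} (c : k) (a : FreePre M m) (b : FreePre M n) :
      FreeRel (.mul a (.smul c b)) (.smul c (.mul a b))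
  | mul_map {m m' n n' : ℕ} (e : Fin m ≃ Fin m') (f : Fin n ≃ Fin n') (a : FreePre M m)
      (b : FreePre M n) : FreeRel (.mul (.map e a) (.map f b)) (.map (blockSum e f) (.mul a b))
  | mul_assoc {l m n : ℕ} (a : FreePre M l) (b : FreePre M m) (c : FreePre M n) :
      FreeRel (.map (blockAssoc l m n) (.mul (.mul a b) c)) (.mul a (.mul b c))
  | one_mul {n : ℕ} (a : FreePre M n) : FreeRel (.map (blockZeroLeft n) (.mul .one a)) a
  | mul_one {n : ℕ} (a : FreePre M n) : FreeRel (.map (blockZeroRight n) (.mul a .one)) a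
  -- `of` is a morphism of `𝕊`-modules
  | of_add {n : ℕ} (x y : M.obj n) : FreeRel (.of (x + y)) (.add (.of x) (.of y))
  | of_smul {n : ℕ} (c : k) (x : M.obj n) : FreeRel (.of (c • x)) (.smul c (.of x))
  | of_map {m n : ℕ} (e : Fin m ≃ Fin n) (x : M.obj m) :
      FreeRel (.of (M.map e x)) (.map e (.of x))

/-- The degree `n` part of the free twisted associative algebra. -/
def FreeObj (n : ℕ) : Type (max u v) := Quot (FreeRel M (n := n))

namespace FreeObj

variable {M}

instance (n : ℕ) : Zero (FreeObj M n) := ⟨Quot.mk _ .zero⟩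
instance (n : ℕ) : Add (FreeObj M n) :=
  ⟨Quot.map₂ .add (fun _ _ _ h => .add_right h) (fun _ _ _ h => .add_left h)⟩
instance (n : ℕ) : SMul k (FreeObj M n) := ⟨fun c => Quot.map (.smul c) fun _ _ h => .smul h⟩
instance (n : ℕ) : Neg (FreeObj M n) := ⟨fun a => (-1 : k) • a⟩

protected theorem add_comm' {n : ℕ} (a b : FreeObj M n) : a + b = b + a := by
  induction a using Quot.ind
  induction b using Quot.ind
  exact Quot.sound (.add_comm _ _)

protected theorem zero_add' {n : ℕ} (a : FreeObj M n) : 0 + a = a := by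
  induction a using Quot.ind
  exact Quot.sound (.zero_add _)

instance (n : ℕ) : AddCommGroup (FreeObj M n) where
  add_assoc a b c := by
    induction a using Quot.ind
    induction b using Quot.ind
    induction c using Quot.ind
    exact Quot.sound (.add_assoc _ _ _)
  zero_add := FreeObj.zero_add'
  add_zero a := by rw [FreeObj.add_comm', FreeObj.zero_add']
  add_comm := FreeObj.add_comm'
  neg_add_cancel a := by
    induction a using Quot.ind
    exact Quot.sound (.neg_add _)
  nsmul := nsmulRec
  zsmul := zsmulRec

instance (n : ℕ) : Module k (FreeObj M n) :=
  Module.ofMinimalAxioms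
    (fun c a b => by
      induction a using Quot.ind
      induction b using Quot.ind
      exact Quot.sound (.smul_add _ _ _))
    (fun c d a => by
      induction a using Quot.ind
      exact Quot.sound (.add_smul _ _ _))
    (fun c d a => by
      induction a using Quot.ind
      exact Quot.sound (.mul_smul _ _ _))
    (fun a => by
      induction a using Quot.ind
      exact Quot.sound (.one_smul _))

end FreeObj

/-- The free twisted associative algebra `T_𝕊 M` generated by an `𝕊`-module `M`. -/
def FreeTw : TwAlg.{u, max u v} k where
  obj := FreeObj M
  map e :=
    { toFun := Quot.map (.map e) fun _ _ h => .map h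
      map_add' := by
        rintro ⟨a⟩ ⟨b⟩
        exact Quot.sound (.map_add _ _ _)
      map_smul' := by
        rintro c ⟨a⟩
        exact Quot.sound (.map_smul _ _ _) }
  map_refl := by
    rintro m ⟨a⟩
    exact Quot.sound (.map_refl _)
  map_trans := by
    rintro l m n e f ⟨a⟩
    exact Quot.sound (.map_trans _ _ _)
  one := Quot.mk _ .one
  mul := LinearMap.mk₂ k
    (Quot.map₂ .mul (fun _ _ _ h => .mul_right h) (fun _ _ _ h => .mul_left h))
    (by
      rintro ⟨a⟩ ⟨b⟩ ⟨c⟩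
      exact Quot.sound (.add_mul _ _ _))
    (by
      rintro c ⟨a⟩ ⟨b⟩
      exact Quot.sound (.smul_mul _ _ _))
    (by
      rintro ⟨a⟩ ⟨b⟩ ⟨c⟩
      exact Quot.sound (.mul_add _ _ _))
    (by
      rintro c ⟨a⟩ ⟨b⟩
      exact Quot.sound (.mul_smul' _ _ _))
  mul_map := by
    rintro m m' n n' e f ⟨a⟩ ⟨b⟩
    exact Quot.sound (.mul_map _ _ _ _)
  mul_assoc := by
    rintro l m n ⟨a⟩ ⟨b⟩ ⟨c⟩
    exact Quot.sound (.mul_assoc _ _ _)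
  one_mul := by
    rintro n ⟨a⟩
    exact Quot.sound (.one_mul _)
  mul_one := by
    rintro n ⟨a⟩
    exact Quot.sound (.mul_one _)

/-- The inclusion of the generators. -/
def FreeTw.ι : SMod.Hom M (FreeTw M).toSMod where
  app _ :=
    { toFun := fun x => Quot.mk _ (.of x)
      map_add' := fun _ _ => Quot.sound (.of_add _ _)
      map_smul' := fun _ _ => Quot.sound (.of_smul _ _) }
  app_map _ _ := Quot.sound (.of_map _ _)

variable {M} {A : TwAlg.{u, w} k} (f : SMod.Hom M A.toSMod)

/-- Evaluation of formal expressions in a twisted associative algebra. -/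
def FreePre.eval : ∀ {n : ℕ}, FreePre M n → A.obj n
  | _, .of x => f.app _ x
  | _, .one => A.one
  | _, .zero => 0
  | _, .add a b => a.eval + b.eval
  | _, .smul c a => c • a.eval
  | _, .map e a => A.map e a.eval
  | _, .mul a b => A.mul a.eval b.eval

theorem FreePre.eval_rel {n : ℕ} {a b : FreePre M n} (h : FreeRel M a b) :
    a.eval f = b.eval f := by
  induction h with
  | add_left _ ih | add_right _ ih | smul _ ih | map _ ih | mul_left _ ih | mul_right _ ih =>
    simp only [FreePre.eval, ih]
  | add_comm => exact add_comm _ _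
  | add_assoc => exact add_assoc _ _ _
  | zero_add => exact zero_add _
  | neg_add => simp [FreePre.eval]
  | smul_add => exact smul_add _ _ _
  | add_smul => exact add_smul _ _ _
  | mul_smul => exact mul_smul _ _ _
  | one_smul => exact one_smul _ _
  | map_add => simp [FreePre.eval]
  | map_smul => simp [FreePre.eval]
  | map_refl => exact A.map_refl _
  | map_trans => exact A.map_trans _ _ _
  | add_mul => simp [FreePre.eval]
  | smul_mul => simp [FreePre.eval]
  | mul_add => simp [FreePre.eval]
  | mul_smul' => simp [FreePre.eval]
  | mul_map => exact A.mul_map _ _ _ _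
  | mul_assoc => exact A.mul_assoc _ _ _
  | one_mul => exact A.one_mul _
  | mul_one => exact A.mul_one _
  | of_add => simp [FreePre.eval]
  | of_smul => simp [FreePre.eval]
  | of_map => exact f.app_map _ _

/-- The morphism of twisted algebras `T_𝕊 M → A` extending a morphism `M → A`. -/
def FreeTw.lift : TwAlg.Hom (FreeTw M) A where
  app n :=
    { toFun := Quot.lift (FreePre.eval f) fun _ _ h => FreePre.eval_rel f h
      map_add' := by
        rintro ⟨a⟩ ⟨b⟩
        rfl
      map_smul' := by
        rintro c ⟨a⟩
        rfl }
  app_map := by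
    rintro m n e ⟨a⟩
    rfl
  app_one := rfl
  app_mul := by
    rintro m n ⟨a⟩ ⟨b⟩
    rfl

theorem FreeTw.lift_ι {n : ℕ} (x : M.obj n) :
    (FreeTw.lift f).app n ((FreeTw.ι M).app n x) = f.app n x := rfl

end free

/-! ### Ideals and quotients -/

/-- A twisted (two-sided) ideal: an ideal which is an `𝕊`-submodule. -/
structure TwIdeal (A : TwAlg.{u, v} k) where
  carrier : ∀ n, Submodule k (A.obj n)
  map_mem : ∀ {m n : ℕ} (e : Fin m ≃ Fin n) {x : A.obj m}, x ∈ carrier m → A.map e x ∈ carrier n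
  mul_mem_left : ∀ {m n : ℕ} (x : A.obj m) {y : A.obj n},
    y ∈ carrier n → A.mul x y ∈ carrier (m + n)
  mul_mem_right : ∀ {m n : ℕ} {x : A.obj m} (y : A.obj n),
    x ∈ carrier m → A.mul x y ∈ carrier (m + n)

/-- The twisted ideal generated by a family of homogeneous elements. -/
def TwIdeal.span {A : TwAlg.{u, v} k} (R : ∀ n, Set (A.obj n)) : TwIdeal A where
  carrier n := ⨅ (I : TwIdeal A) (_ : ∀ p, R p ⊆ I.carrier p), I.carrier n
  map_mem := by
    intro m n e x hx
    simp only [Submodule.mem_iInf] at hx ⊢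
    exact fun I hI => I.map_mem e (hx I hI)
  mul_mem_left := by
    intro m n x y hy
    simp only [Submodule.mem_iInf] at hy ⊢
    exact fun I hI => I.mul_mem_left x (hy I hI)
  mul_mem_right := by
    intro m n x y hx
    simp only [Submodule.mem_iInf] at hx ⊢
    exact fun I hI => I.mul_mem_right y (hx I hI)

theorem TwIdeal.subset_span {A : TwAlg.{u, v} k} (R : ∀ n, Set (A.obj n)) (n : ℕ) :
    R n ⊆ (TwIdeal.span R).carrier n := by
  intro x hx
  simp only [TwIdeal.span, SetLike.mem_coe, Submodule.mem_iInf]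
  exact fun I hI => hI n hx

/-- A bilinear map descended to quotients. -/
def bilinQuot {V W X : Type*} [AddCommGroup V] [AddCommGroup W] [AddCommGroup X]
    [Module k V] [Module k W] [Module k X] (P : Submodule k V) (Q : Submodule k W)
    (f : V →ₗ[k] W →ₗ[k] X) (hP : ∀ x ∈ P, ∀ y, f x y = 0) (hQ : ∀ x, ∀ y ∈ Q, f x y = 0) :
    (V ⧸ P) →ₗ[k] (W ⧸ Q) →ₗ[k] X :=
  (Q.liftQ (P.liftQ f fun x hx => LinearMap.ext (hP x hx)).flip fun y hy =>
    LinearMap.ext fun x => by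
      obtain ⟨x, rfl⟩ := P.mkQ_surjective x
      exact hQ x y hy).flip

/-- The quotient of a twisted associative algebra by a twisted ideal. -/
def TwAlg.quot (A : TwAlg.{u, v} k) (I : TwIdeal A) : TwAlg.{u, v} k where
  obj n := A.obj n ⧸ I.carrier n
  map {m n} e := (I.carrier m).mapQ (I.carrier n) (A.map e) fun _ hx => I.map_mem e hx
  map_refl := by
    rintro m ⟨x⟩
    exact congrArg _ (A.map_refl x)
  map_trans := by
    rintro l m n e f ⟨x⟩
    exact congrArg _ (A.map_trans e f x)
  one := (I.carrier 0).mkQ A.one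
  mul {m n} := bilinQuot _ _ (A.mul.compr₂ (I.carrier (m + n)).mkQ)
    (fun x hx y => (Submodule.Quotient.mk_eq_zero _).2 (I.mul_mem_right y hx))
    (fun x y hy => (Submodule.Quotient.mk_eq_zero _).2 (I.mul_mem_left x hy))
  mul_map := by
    rintro m m' n n' e f ⟨x⟩ ⟨y⟩
    exact congrArg _ (A.mul_map e f x y)
  mul_assoc := by
    rintro l m n ⟨x⟩ ⟨y⟩ ⟨z⟩
    exact congrArg _ (A.mul_assoc x y z)
  one_mul := by
    rintro n ⟨x⟩
    exact congrArg _ (A.one_mul x)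
  mul_one := by
    rintro n ⟨x⟩
    exact congrArg _ (A.mul_one x)

/-- The projection to the quotient. -/
def TwAlg.quotMk (A : TwAlg.{u, v} k) (I : TwIdeal A) : TwAlg.Hom A (A.quot I) where
  app n := (I.carrier n).mkQ
  app_map _ _ := rfl
  app_one := rfl
  app_mul _ _ := rfl

/-- The kernel of a morphism of twisted algebras. -/
def TwAlg.Hom.ker {A : TwAlg.{u, v} k} {B : TwAlg.{u, w} k} (f : TwAlg.Hom A B) : TwIdeal A where
  carrier n := LinearMap.ker (f.app n)
  map_mem := by
    intro m n e x hx
    rw [LinearMap.mem_ker] at hx ⊢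
    rw [f.app_map, hx, map_zero]
  mul_mem_left := by
    intro m n x y hy
    rw [LinearMap.mem_ker] at hy ⊢
    rw [f.app_mul, hy, map_zero]
  mul_mem_right := by
    intro m n x y hx
    rw [LinearMap.mem_ker] at hx ⊢
    rw [f.app_mul, hx, map_zero, LinearMap.zero_apply]

/-- The morphism induced on the quotient by the twisted ideal generated by `R`. -/
def TwAlg.quotLift {A : TwAlg.{u, v} k} {B : TwAlg.{u, w} k} (R : ∀ n, Set (A.obj n))
    (f : TwAlg.Hom A B) (hf : ∀ n, ∀ x ∈ R n, f.app n x = 0) :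
    TwAlg.Hom (A.quot (TwIdeal.span R)) B where
  app n := ((TwIdeal.span R).carrier n).liftQ (f.app n) fun x hx => by
    simp only [TwIdeal.span, Submodule.mem_iInf] at hx
    exact hx f.ker fun p y hy => hf p y hy
  app_map := by
    rintro m n e ⟨x⟩
    exact f.app_map e x
  app_one := f.app_one
  app_mul := by
    rintro m n ⟨x⟩ ⟨y⟩
    exact f.app_mul x y

/-! ### Twisted symmetric and enveloping algebras -/

/-- The elements `x y - (12)^{|y|,|x|} y x` of `T_𝕊 M`. -/
inductive SymRel (M : SMod.{u, v} k) : ∀ n, Set ((FreeTw M).obj n)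
  | intro {m n : ℕ} (x : M.obj m) (y : M.obj n) : SymRel M (m + n)
      ((FreeTw M).mul ((FreeTw.ι M).app m x) ((FreeTw.ι M).app n y) -
        (FreeTw M).map (blockSwap n m)
          ((FreeTw M).mul ((FreeTw.ι M).app n y) ((FreeTw.ι M).app m x)))

/-- The twisted symmetric algebra `Sym_𝕊 M`. -/
def SymS (M : SMod.{u, v} k) : TwAlg.{u, max u v} k :=
  (FreeTw M).quot (TwIdeal.span (SymRel M))

/-- The elements `x y - (12)^{|y|,|x|} y x - {x, y}` of `T_𝕊 h`. -/
inductive EnvRel (h : TwLie.{u, v} k) : ∀ n, Set ((FreeTw h.toSMod).obj n)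
  | intro {m n : ℕ} (x : h.obj m) (y : h.obj n) : EnvRel h (m + n)
      ((FreeTw h.toSMod).mul ((FreeTw.ι h.toSMod).app m x) ((FreeTw.ι h.toSMod).app n y) -
        (FreeTw h.toSMod).map (blockSwap n m)
          ((FreeTw h.toSMod).mul ((FreeTw.ι h.toSMod).app n y) ((FreeTw.ι h.toSMod).app m x)) -
        (FreeTw.ι h.toSMod).app (m + n) (h.br x y))

/-- The twisted universal enveloping algebra `U_𝕊 h`. -/
def EnvS (h : TwLie.{u, v} k) : TwAlg.{u, max u v} k :=
  (FreeTw h.toSMod).quot (TwIdeal.span (EnvRel h))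

/-- The generators of the twisted symmetric algebra. -/
def SymS.ι (M : SMod.{u, v} k) : SMod.Hom M (SymS M).toSMod :=
  ((FreeTw M).quotMk _).toHom.comp (FreeTw.ι M)

/-- The canonical map from a twisted Lie algebra to its enveloping algebra. -/
def EnvS.ι (h : TwLie.{u, v} k) : SMod.Hom h.toSMod (EnvS h).toSMod :=
  ((FreeTw h.toSMod).quotMk _).toHom.comp (FreeTw.ι h.toSMod)

/-- In `Sym_𝕊 M` one has `x y = (12)^{|y|,|x|} y x`. -/
theorem SymS.comm (M : SMod.{u, v} k) {m n : ℕ} (x : M.obj m) (y : M.obj n) :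
    (SymS M).mul ((SymS.ι M).app m x) ((SymS.ι M).app n y) -
      (SymS M).map (blockSwap n m) ((SymS M).mul ((SymS.ι M).app n y) ((SymS.ι M).app m x)) = 0 :=
  (Submodule.Quotient.mk_eq_zero _).2 (TwIdeal.subset_span _ _ (.intro x y))

/-- In `U_𝕊 h` one has `x y - (12)^{|y|,|x|} y x = {x, y}`. -/
theorem EnvS.comm (h : TwLie.{u, v} k) {m n : ℕ} (x : h.obj m) (y : h.obj n) :
    (EnvS h).mul ((EnvS.ι h).app m x) ((EnvS.ι h).app n y) -
      (EnvS h).map (blockSwap n m) ((EnvS h).mul ((EnvS.ι h).app n y) ((EnvS.ι h).app m x)) =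
        (EnvS.ι h).app (m + n) (h.br x y) :=
  sub_eq_zero.1 ((Submodule.Quotient.mk_eq_zero _).2 (TwIdeal.subset_span _ _ (.intro x y)))

/-- The universal property of the twisted symmetric algebra. -/
def SymS.lift {M : SMod.{u, v} k} {A : TwAlg.{u, w} k} (f : SMod.Hom M A.toSMod)
    (hf : ∀ {m n : ℕ} (x : M.obj m) (y : M.obj n),
      A.mul (f.app m x) (f.app n y) - A.map (blockSwap n m) (A.mul (f.app n y) (f.app m x)) = 0) :
    TwAlg.Hom (SymS M) A :=
  TwAlg.quotLift _ (FreeTw.lift f) (by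
    rintro _ _ ⟨x, y⟩
    rw [map_sub, (FreeTw.lift f).app_map, (FreeTw.lift f).app_mul, (FreeTw.lift f).app_mul]
    exact hf x y)

/-- The universal property of the twisted enveloping algebra. -/
def EnvS.lift {h : TwLie.{u, v} k} {A : TwAlg.{u, w} k} (f : SMod.Hom h.toSMod A.toSMod)
    (hf : ∀ {m n : ℕ} (x : h.obj m) (y : h.obj n),
      A.mul (f.app m x) (f.app n y) - A.map (blockSwap n m) (A.mul (f.app n y) (f.app m x)) =
        f.app (m + n) (h.br x y)) :
    TwAlg.Hom (EnvS h) A :=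
  TwAlg.quotLift _ (FreeTw.lift f) (by
    rintro _ _ ⟨x, y⟩
    rw [map_sub, map_sub, (FreeTw.lift f).app_map, (FreeTw.lift f).app_mul,
      (FreeTw.lift f).app_mul, sub_eq_zero]
    exact hf x y)

/-! ### Tensor products of `𝕊`-modules -/

section tensor

/-- The sum, over all decompositions `p = m + n` and all `e ∈ S_p`, of the modules
`M_m ⊗ N_n`. (A bijection `Fin (m + n) ≃ Fin p` exists only for `m + n = p`.) -/
abbrev TensPre (M : SMod.{u, v} k) (N : SMod.{u, w} k) (p : ℕ) : Type (max v w) :=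
  ⨁ i : (Σ a : ℕ × ℕ, Fin (a.1 + a.2) ≃ Fin p), M.obj i.1.1 ⊗[k] N.obj i.1.2

/-- The relations `e (s × t) ⊗ (x ⊗ y) = e ⊗ (s x ⊗ t y)` for `(s, t) ∈ S_m × S_n`. -/
def tensRel (M : SMod.{u, v} k) (N : SMod.{u, w} k) (p : ℕ) : Submodule k (TensPre M N p) :=
  Submodule.span k {z | ∃ (m m' n n' : ℕ) (s : Fin m ≃ Fin m') (t : Fin n ≃ Fin n')
    (e : Fin (m' + n') ≃ Fin p) (x : M.obj m) (y : N.obj n),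
    z = DirectSum.of (fun i : (Σ a : ℕ × ℕ, Fin (a.1 + a.2) ≃ Fin p) =>
          M.obj i.1.1 ⊗[k] N.obj i.1.2) ⟨(m, n), (blockSum s t).trans e⟩ (x ⊗ₜ[k] y) -
        DirectSum.of (fun i : (Σ a : ℕ × ℕ, Fin (a.1 + a.2) ≃ Fin p) =>
          M.obj i.1.1 ⊗[k] N.obj i.1.2) ⟨(m', n'), e⟩ (M.map s x ⊗ₜ[k] N.map t y)}

/-- The degree `p` part of `M ⊗_𝕊 N`, that is, the sum over `m + n = p` of the induced modules
`Ind_{S_m × S_n}^{S_p} (M_m ⊗ N_n) = k[S_p] ⊗_{k[S_m × S_n]} (M_m ⊗ N_n)`. -/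
def TensObj (M : SMod.{u, v} k) (N : SMod.{u, w} k) (p : ℕ) : Type (max v w) :=
  TensPre M N p ⧸ tensRel M N p

instance (M : SMod.{u, v} k) (N : SMod.{u, w} k) (p : ℕ) : AddCommGroup (TensObj M N p) :=
  Submodule.Quotient.addCommGroup (tensRel M N p)

instance (M : SMod.{u, v} k) (N : SMod.{u, w} k) (p : ℕ) : Module k (TensObj M N p) :=
  Submodule.Quotient.module (tensRel M N p)

namespace Tens

variable {M : SMod.{u, v} k} {N : SMod.{u, w} k}

/-- The projection onto the tensor product. -/
def proj (p : ℕ) : TensPre M N p →ₗ[k] TensObj M N p := (tensRel M N p).mkQ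

/-- The element `e (x ⊗ y)` of `M ⊗_𝕊 N`. -/
def mk {m n p : ℕ} (e : Fin (m + n) ≃ Fin p) : M.obj m →ₗ[k] N.obj n →ₗ[k] TensObj M N p :=
  (TensorProduct.mk k (M.obj m) (N.obj n)).compr₂
    (proj p ∘ₗ DirectSum.lof k _
      (fun i : (Σ a : ℕ × ℕ, Fin (a.1 + a.2) ≃ Fin p) => M.obj i.1.1 ⊗[k] N.obj i.1.2)
      ⟨(m, n), e⟩)

theorem mk_map {m m' n n' p : ℕ} (s : Fin m ≃ Fin m') (t : Fin n ≃ Fin n')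
    (e : Fin (m' + n') ≃ Fin p) (x : M.obj m) (y : N.obj n) :
    mk e (M.map s x) (N.map t y) = mk ((blockSum s t).trans e) x y := by
  refine Eq.symm ((Submodule.Quotient.eq _).2 (Submodule.subset_span ?_))
  exact ⟨m, m', n, n', s, t, e, x, y, rfl⟩

theorem induction {p : ℕ} {P : TensObj M N p → Prop} (z : TensObj M N p)
    (zero : P 0) (add : ∀ a b, P a → P b → P (a + b))
    (mk : ∀ {m n : ℕ} (e : Fin (m + n) ≃ Fin p) (x : M.obj m) (y : N.obj n), P (mk e x y)) :
    P z := by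
  obtain ⟨z, rfl⟩ : ∃ z', proj p z' = z := (tensRel M N p).mkQ_surjective z
  induction z using DirectSum.induction_on with
  | zero => simpa using zero
  | of i t =>
    induction t using TensorProduct.induction_on with
    | zero => simpa using zero
    | tmul x y => exact mk i.2 x y
    | add a b ha hb => rw [map_add, map_add]; exact add _ _ ha hb
  | add a b ha hb => rw [map_add]; exact add _ _ ha hb

theorem hom_ext {p : ℕ} {X : Type*} [AddCommGroup X] [Module k X] {f g : TensObj M N p →ₗ[k] X}
    (h : ∀ {m n : ℕ} (e : Fin (m + n) ≃ Fin p) (x : M.obj m) (y : N.obj n),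
      f (mk e x y) = g (mk e x y)) : f = g := by
  refine LinearMap.ext fun z => ?_
  induction z using Tens.induction with
  | zero => rw [map_zero, map_zero]
  | add a b ha hb => rw [map_add, map_add, ha, hb]
  | mk e x y => exact h e x y

/-- Linear maps out of the tensor product. -/
def lift {p : ℕ} {X : Type*} [AddCommGroup X] [Module k X]
    (F : ∀ m n : ℕ, (Fin (m + n) ≃ Fin p) → M.obj m →ₗ[k] N.obj n →ₗ[k] X)
    (hF : ∀ (m m' n n' : ℕ) (s : Fin m ≃ Fin m') (t : Fin n ≃ Fin n')
      (e : Fin (m' + n') ≃ Fin p) (x : M.obj m) (y : N.obj n),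
      F m' n' e (M.map s x) (N.map t y) = F m n ((blockSum s t).trans e) x y) :
    TensObj M N p →ₗ[k] X :=
  (tensRel M N p).liftQ (DirectSum.toModule k _ X fun i => TensorProduct.lift (F i.1.1 i.1.2 i.2)) (by
    rw [tensRel, Submodule.span_le]
    rintro _ ⟨m, m', n, n', s, t, e, x, y, rfl⟩
    rw [SetLike.mem_coe, LinearMap.mem_ker, map_sub, ← DirectSum.lof_eq_of k,
      ← DirectSum.lof_eq_of k, DirectSum.toModule_lof, DirectSum.toModule_lof,
      TensorProduct.lift.tmul, TensorProduct.lift.tmul, hF, sub_self])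

theorem lift_mk {p : ℕ} {X : Type*} [AddCommGroup X] [Module k X]
    (F : ∀ m n : ℕ, (Fin (m + n) ≃ Fin p) → M.obj m →ₗ[k] N.obj n →ₗ[k] X)
    (hF : ∀ (m m' n n' : ℕ) (s : Fin m ≃ Fin m') (t : Fin n ≃ Fin n')
      (e : Fin (m' + n') ≃ Fin p) (x : M.obj m) (y : N.obj n),
      F m' n' e (M.map s x) (N.map t y) = F m n ((blockSum s t).trans e) x y)
    {m n : ℕ} (e : Fin (m + n) ≃ Fin p) (x : M.obj m) (y : N.obj n) :
    lift F hF (mk e x y) = F m n e x y := by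
  change DirectSum.toModule k _ X (fun i => TensorProduct.lift (F i.1.1 i.1.2 i.2))
    (DirectSum.lof k _
      (fun i : (Σ a : ℕ × ℕ, Fin (a.1 + a.2) ≃ Fin p) => M.obj i.1.1 ⊗[k] N.obj i.1.2)
      ⟨(m, n), e⟩ (x ⊗ₜ[k] y)) = _
  rw [DirectSum.toModule_lof, TensorProduct.lift.tmul]

/-- The action of a bijection `f` on the tensor product: `f (e (x ⊗ y)) = (f e) (x ⊗ y)`. -/
def map {p q : ℕ} (f : Fin p ≃ Fin q) : TensObj M N p →ₗ[k] TensObj M N q :=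
  lift (fun _ _ e => mk (e.trans f)) fun _ _ _ _ s t e x y => by
    rw [mk_map, Equiv.trans_assoc]

theorem map_mk {m n p q : ℕ} (f : Fin p ≃ Fin q) (e : Fin (m + n) ≃ Fin p) (x : M.obj m)
    (y : N.obj n) : map f (mk e x y) = mk (e.trans f) x y :=
  lift_mk _ _ _ _ _

/-- The linear map `f ⊗ g`. -/
def mapLin {M' : SMod.{u, v'} k} {N' : SMod.{u, w'} k} (f : SMod.Hom M M') (g : SMod.Hom N N')
    (p : ℕ) : TensObj M N p →ₗ[k] TensObj M' N' p :=
  lift (fun m n e => (mk e).compl₁₂ (f.app m) (g.app n)) fun _ _ _ _ s t e x y => by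
    rw [LinearMap.compl₁₂_apply, LinearMap.compl₁₂_apply, f.app_map, g.app_map, mk_map]

theorem mapLin_mk {M' : SMod.{u, v'} k} {N' : SMod.{u, w'} k} (f : SMod.Hom M M')
    (g : SMod.Hom N N') {m n p : ℕ} (e : Fin (m + n) ≃ Fin p) (x : M.obj m) (y : N.obj n) :
    mapLin f g p (mk e x y) = mk e (f.app m x) (g.app n y) := by
  rw [mapLin, lift_mk, LinearMap.compl₁₂_apply]

end Tens

/-- The tensor product `M ⊗_𝕊 N` of `𝕊`-modules. -/
def Tens (M : SMod.{u, v} k) (N : SMod.{u, w} k) : SMod.{u, max v w} k where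
  obj := TensObj M N
  map := Tens.map
  map_refl z := by
    induction z using Tens.induction with
    | zero => rw [map_zero]
    | add a b ha hb => rw [map_add, ha, hb]
    | mk e x y => rw [Tens.map_mk, Equiv.trans_refl]
  map_trans f g z := by
    induction z using Tens.induction with
    | zero => simp only [map_zero]
    | add a b ha hb => simp only [map_add, ha, hb]
    | mk e x y => rw [Tens.map_mk, Tens.map_mk, Tens.map_mk, Equiv.trans_assoc]

/-- The morphism `f ⊗ g`. -/
def Tens.mapHom {M : SMod.{u, v} k} {N : SMod.{u, w} k} {M' : SMod.{u, v'} k}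
    {N' : SMod.{u, w'} k} (f : SMod.Hom M M') (g : SMod.Hom N N') :
    SMod.Hom (Tens M N) (Tens M' N') where
  app := Tens.mapLin f g
  app_map {p q} h z := by
    change Tens.mapLin f g q (Tens.map h z) = Tens.map h (Tens.mapLin f g p z)
    induction z using Tens.induction with
    | zero => simp only [map_zero]
    | add a b ha hb => simp only [map_add, ha, hb]
    | mk e x y => rw [Tens.map_mk, Tens.mapLin_mk, Tens.mapLin_mk, Tens.map_mk]

theorem blockSum_refl (m n : ℕ) :
    blockSum (Equiv.refl (Fin m)) (Equiv.refl (Fin n)) = Equiv.refl (Fin (m + n)) := by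
  simp only [Equiv.ext_iff, forall_fin_add, Equiv.refl_apply, blockSum_left, blockSum_right,
    implies_true, and_self]

theorem blockMid_natural {a b c d a' b' c' d' : ℕ} (e₁ : Fin a ≃ Fin a') (e₂ : Fin b ≃ Fin b')
    (e₃ : Fin c ≃ Fin c') (e₄ : Fin d ≃ Fin d') :
    (blockSum (blockSum e₁ e₂) (blockSum e₃ e₄)).trans (blockMid a' b' c' d') =
      (blockMid a b c d).trans (blockSum (blockSum e₁ e₃) (blockSum e₂ e₄)) := by
  simp only [Equiv.ext_iff, forall_fin_add, Equiv.trans_apply, blockSum_left, blockSum_right,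
    blockMid_ll, blockMid_lr, blockMid_rl, blockMid_rr, implies_true, and_self]

section tensorMul

variable (A : TwAlg.{u, v} k) (B : TwAlg.{u, w} k)

/-- Left multiplication by `e (x ⊗ y)`. -/
def tensMulAux {m n p : ℕ} (q : ℕ) (e : Fin (m + n) ≃ Fin p) (x : A.obj m) (y : B.obj n) :
    TensObj A.toSMod B.toSMod q →ₗ[k] TensObj A.toSMod B.toSMod (p + q) :=
  Tens.lift (fun m' n' e' =>
    (Tens.mk ((blockMid m m' n n').trans (blockSum e e'))).compl₁₂ (A.mul x) (B.mul y)) (by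
    intro a a' b b' s t e' u v
    rw [LinearMap.compl₁₂_apply, LinearMap.compl₁₂_apply]
    have hA := A.mul_map (Equiv.refl _) s x u
    have hB := B.mul_map (Equiv.refl _) t y v
    rw [A.map_refl] at hA
    rw [B.map_refl] at hB
    rw [hA, hB, Tens.mk_map, ← Equiv.trans_assoc, blockMid_natural, Equiv.trans_assoc,
      blockSum_trans, blockSum_refl, Equiv.refl_trans])

theorem tensMulAux_mk {m n p m' n' q : ℕ} (e : Fin (m + n) ≃ Fin p) (x : A.obj m) (y : B.obj n)
    (e' : Fin (m' + n') ≃ Fin q) (x' : A.obj m') (y' : B.obj n') :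
    tensMulAux A B q e x y (Tens.mk e' x' y') =
      Tens.mk ((blockMid m m' n n').trans (blockSum e e')) (A.mul x x') (B.mul y y') := by
  rw [tensMulAux, Tens.lift_mk, LinearMap.compl₁₂_apply]

/-- The product of `A ⊗_𝕊 B`:
`(u ⊗ v) (x ⊗ y) = (23)^{|u|,|x|,|v|,|y|} (u x ⊗ v y)`. -/
def tensMul (p q : ℕ) : TensObj A.toSMod B.toSMod p →ₗ[k] TensObj A.toSMod B.toSMod q →ₗ[k]
    TensObj A.toSMod B.toSMod (p + q) :=
  Tens.lift (fun _ _ e => LinearMap.mk₂ k (tensMulAux A B q e)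
    (fun x x' y => Tens.hom_ext fun e' u v => by
      simp only [LinearMap.add_apply, tensMulAux_mk, map_add])
    (fun c x y => Tens.hom_ext fun e' u v => by
      simp only [LinearMap.smul_apply, tensMulAux_mk, map_smul])
    (fun x y y' => Tens.hom_ext fun e' u v => by
      simp only [LinearMap.add_apply, tensMulAux_mk, map_add])
    (fun c x y => Tens.hom_ext fun e' u v => by
      simp only [LinearMap.smul_apply, tensMulAux_mk, map_smul])) (by
    intro a a' b b' s t e x y
    refine Tens.hom_ext fun e' u v => ?_
    have hA := A.mul_map s (Equiv.refl _) x u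
    have hB := B.mul_map t (Equiv.refl _) y v
    rw [A.map_refl] at hA
    rw [B.map_refl] at hB
    rw [LinearMap.mk₂_apply, LinearMap.mk₂_apply, tensMulAux_mk, tensMulAux_mk, hA, hB,
      Tens.mk_map, ← Equiv.trans_assoc, blockMid_natural, Equiv.trans_assoc,
      blockSum_trans, blockSum_refl, Equiv.refl_trans])

theorem tensMul_mk {m n p m' n' q : ℕ} (e : Fin (m + n) ≃ Fin p) (x : A.obj m) (y : B.obj n)
    (e' : Fin (m' + n') ≃ Fin q) (x' : A.obj m') (y' : B.obj n') :
    tensMul A B p q (Tens.mk e x y) (Tens.mk e' x' y') =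
      Tens.mk ((blockMid m m' n n').trans (blockSum e e')) (A.mul x x') (B.mul y y') := by
  rw [tensMul, Tens.lift_mk, LinearMap.mk₂_apply, tensMulAux_mk]

theorem tensMul_map {p p' q q' : ℕ} (f : Fin p ≃ Fin p') (g : Fin q ≃ Fin q')
    (z : TensObj A.toSMod B.toSMod p) (z' : TensObj A.toSMod B.toSMod q) :
    tensMul A B p' q' (Tens.map f z) (Tens.map g z') =
      Tens.map (blockSum f g) (tensMul A B p q z z') := by
  induction z using Tens.induction with
  | zero => simp only [map_zero, LinearMap.zero_apply]
  | add a b ha hb => simp only [map_add, LinearMap.add_apply, ha, hb]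
  | mk e x y =>
    induction z' using Tens.induction with
    | zero => simp only [map_zero]
    | add a b ha hb => simp only [map_add, ha, hb]
    | mk e' x' y' =>
      rw [Tens.map_mk, Tens.map_mk, tensMul_mk, tensMul_mk, Tens.map_mk, Equiv.trans_assoc,
        blockSum_trans]

theorem tensMul_assoc {p q r : ℕ} (z : TensObj A.toSMod B.toSMod p)
    (z' : TensObj A.toSMod B.toSMod q) (z'' : TensObj A.toSMod B.toSMod r) :
    Tens.map (blockAssoc p q r) (tensMul A B (p + q) r (tensMul A B p q z z') z'') =
      tensMul A B p (q + r) z (tensMul A B q r z' z'') := by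
  induction z using Tens.induction with
  | zero => simp only [map_zero, LinearMap.zero_apply]
  | add a b ha hb => simp only [map_add, LinearMap.add_apply, ha, hb]
  | mk e x y =>
    induction z' using Tens.induction with
    | zero => simp only [map_zero, LinearMap.zero_apply]
    | add a b ha hb => simp only [map_add, LinearMap.add_apply, ha, hb]
    | mk e' x' y' =>
      induction z'' using Tens.induction with
      | zero => simp only [map_zero]
      | add a b ha hb => simp only [map_add, ha, hb]
      | mk e'' x'' y'' =>
        rw [tensMul_mk, tensMul_mk, tensMul_mk, tensMul_mk, Tens.map_mk, ← A.mul_assoc,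
          ← B.mul_assoc, Tens.mk_map]
        congr 3
        simp only [Equiv.ext_iff, forall_fin_add, Equiv.trans_apply, blockSum_left,
          blockSum_right, blockMid_ll, blockMid_lr, blockMid_rl, blockMid_rr, blockAssoc_left,
          blockAssoc_mid, blockAssoc_right, implies_true, and_self]

theorem tensMul_one_left {p : ℕ} (z : TensObj A.toSMod B.toSMod p) :
    Tens.map (blockZeroLeft p) (tensMul A B 0 p (Tens.mk (Equiv.refl (Fin (0 + 0))) A.one B.one) z) = z := by
  induction z using Tens.induction with
  | zero => simp only [map_zero]
  | add a b ha hb => simp only [map_add, ha, hb]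
  | mk e x y =>
    rw [tensMul_mk, Tens.map_mk]
    conv_rhs => rw [← A.one_mul x, ← B.one_mul y, Tens.mk_map]
    congr 3
    simp only [Equiv.ext_iff, forall_fin_add, forall_fin_zero, Equiv.trans_apply, blockSum_left,
      blockSum_right, blockMid_ll, blockMid_lr, blockMid_rl, blockMid_rr, blockZeroLeft_right,
      implies_true, and_self]

theorem tensMul_one_right {p : ℕ} (z : TensObj A.toSMod B.toSMod p) :
    Tens.map (blockZeroRight p)
      (tensMul A B p 0 z (Tens.mk (Equiv.refl (Fin (0 + 0))) A.one B.one)) = z := by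
  induction z using Tens.induction with
  | zero => simp only [map_zero, LinearMap.zero_apply]
  | add a b ha hb => simp only [map_add, LinearMap.add_apply, ha, hb]
  | mk e x y =>
    rw [tensMul_mk, Tens.map_mk]
    conv_rhs => rw [← A.mul_one x, ← B.mul_one y, Tens.mk_map]
    congr 3
    simp only [Equiv.ext_iff, forall_fin_add, forall_fin_zero, Equiv.trans_apply, blockSum_left,
      blockSum_right, blockMid_ll, blockMid_lr, blockMid_rl, blockMid_rr, blockZeroRight_left,
      implies_true, and_self]

/-- The tensor product of two twisted associative algebras. -/
def TwAlg.tens : TwAlg.{u, max v w} k where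
  toSMod := Tens A.toSMod B.toSMod
  one := Tens.mk (Equiv.refl (Fin (0 + 0))) A.one B.one
  mul {p q} := tensMul A B p q
  mul_map := tensMul_map A B
  mul_assoc := tensMul_assoc A B
  one_mul := tensMul_one_left A B
  mul_one := tensMul_one_right A B

end tensorMul
end tensor

/-! ### Coproducts and counits -/

/-- The unit `𝕊`-module, `k` concentrated in degree zero, as a twisted algebra. (A function
`PLift (n = 0) → k` is an element of `k` if `n = 0`, and there is only one if `n ≠ 0`.) -/
def TwAlg.unit (k : Type u) [CommRing k] : TwAlg.{u, u} k where
  obj n := PLift (n = 0) → k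
  map e :=
    { toFun := fun f _ => f ⟨by rename_i h; simpa [h.down] using Fintype.card_congr e⟩
      map_add' := fun _ _ => rfl
      map_smul' := fun _ _ => rfl }
  map_refl _ := rfl
  map_trans _ _ _ := rfl
  one := fun _ => 1
  mul := LinearMap.mk₂ k
    (fun f g h => f ⟨(Nat.add_eq_zero_iff.1 h.down).1⟩ * g ⟨(Nat.add_eq_zero_iff.1 h.down).2⟩)
    (fun _ _ _ => funext fun _ => add_mul _ _ _)
    (fun c f g => funext fun _ => _root_.mul_assoc c _ _)
    (fun _ _ _ => funext fun _ => mul_add _ _ _)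
    (fun _ _ _ => funext fun _ => mul_left_comm _ _ _)
  mul_map _ _ _ _ := rfl
  mul_assoc _ _ _ := funext fun _ => _root_.mul_assoc _ _ _
  one_mul _ := funext fun _ => _root_.one_mul _
  mul_one _ := funext fun _ => _root_.mul_one _

section primitive

theorem blockSum_zero_left {m n : ℕ} (e : Fin m ≃ Fin n) :
    (blockSum (Equiv.refl (Fin 0)) e).trans (blockZeroLeft n) = (blockZeroLeft m).trans e := by
  simp only [Equiv.ext_iff, forall_fin_add, forall_fin_zero, Equiv.trans_apply, blockSum_right,
    blockZeroLeft_right, implies_true, and_self]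

theorem blockSum_zero_right {m n : ℕ} (e : Fin m ≃ Fin n) :
    (blockSum e (Equiv.refl (Fin 0))).trans (blockZeroRight n) = (blockZeroRight m).trans e := by
  simp only [Equiv.ext_iff, forall_fin_add, forall_fin_zero, Equiv.trans_apply, blockSum_left,
    blockZeroRight_left, implies_true, and_self]

theorem prim_block₁ (m n : ℕ) :
    (blockSum (blockZeroRight 0).symm (Equiv.refl (Fin (m + n)))).trans
      ((blockMid 0 0 m n).trans (blockSum (blockZeroLeft m) (blockZeroLeft n))) =
    blockZeroLeft (m + n) := by
  simp only [Equiv.ext_iff, forall_fin_add, forall_fin_zero, Equiv.trans_apply, Equiv.refl_apply,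
    blockSum_left, blockSum_right, blockMid_ll, blockMid_lr, blockMid_rl, blockMid_rr,
    blockZeroLeft_right, blockZeroLeft_symm, blockZeroRight_left, blockZeroRight_symm,
    blockSwap_left, blockSwap_right, implies_true, and_self]

theorem prim_block₂ (m n : ℕ) :
    (blockSum (Equiv.refl (Fin (m + n))) (blockZeroRight 0).symm).trans
      ((blockMid m n 0 0).trans (blockSum (blockZeroRight m) (blockZeroRight n))) =
    blockZeroRight (m + n) := by
  simp only [Equiv.ext_iff, forall_fin_add, forall_fin_zero, Equiv.trans_apply, Equiv.refl_apply,
    blockSum_left, blockSum_right, blockMid_ll, blockMid_lr, blockMid_rl, blockMid_rr,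
    blockZeroLeft_right, blockZeroLeft_symm, blockZeroRight_left, blockZeroRight_symm,
    blockSwap_left, blockSwap_right, implies_true, and_self]

theorem prim_block₃ (m n : ℕ) :
    (blockSum (blockZeroRight m).symm (Equiv.refl (Fin n))).trans
      ((blockSum (Equiv.refl (Fin (m + 0))) (blockZeroLeft n).symm).trans
        ((blockMid m 0 0 n).trans (blockSum (blockZeroRight m) (blockZeroLeft n)))) =
    Equiv.refl (Fin (m + n)) := by
  simp only [Equiv.ext_iff, forall_fin_add, forall_fin_zero, Equiv.trans_apply, Equiv.refl_apply,
    blockSum_left, blockSum_right, blockMid_ll, blockMid_lr, blockMid_rl, blockMid_rr,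
    blockZeroLeft_right, blockZeroLeft_symm, blockZeroRight_left, blockZeroRight_symm,
    blockSwap_left, blockSwap_right, implies_true, and_self]

theorem prim_block₄ (m n : ℕ) :
    (blockSum (blockZeroLeft n).symm (Equiv.refl (Fin m))).trans
      ((blockSum (Equiv.refl (Fin (0 + n))) (blockZeroRight m).symm).trans
        ((blockMid 0 n m 0).trans (blockSum (blockZeroLeft m) (blockZeroRight n)))) =
    blockSwap n m := by
  simp only [Equiv.ext_iff, forall_fin_add, forall_fin_zero, Equiv.trans_apply, Equiv.refl_apply,
    blockSum_left, blockSum_right, blockMid_ll, blockMid_lr, blockMid_rl, blockMid_rr,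
    blockZeroLeft_right, blockZeroLeft_symm, blockZeroRight_left, blockZeroRight_symm,
    blockSwap_left, blockSwap_right, implies_true, and_self]

theorem blockSwap_swap (m n : ℕ) :
    (blockSwap m n).trans (blockSwap n m) = Equiv.refl (Fin (m + n)) := by
  simp only [Equiv.ext_iff, forall_fin_add, Equiv.trans_apply, Equiv.refl_apply,
    blockSwap_left, blockSwap_right, implies_true, and_self]


variable (A : TwAlg.{u, v} k)

theorem TwAlg.one_mul_eq {n : ℕ} (x : A.obj n) :
    A.mul A.one x = A.map (blockZeroLeft n).symm x := by
  conv_rhs => rw [← A.one_mul x, ← A.map_trans, Equiv.self_trans_symm, A.map_refl]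

theorem TwAlg.mul_one_eq {n : ℕ} (x : A.obj n) :
    A.mul x A.one = A.map (blockZeroRight n).symm x := by
  conv_rhs => rw [← A.mul_one x, ← A.map_trans, Equiv.self_trans_symm, A.map_refl]

theorem Tens.mk_map_right {M : SMod.{u, v} k} {N : SMod.{u, w} k} {m n n' p : ℕ}
    (t : Fin n ≃ Fin n') (e : Fin (m + n') ≃ Fin p) (x : M.obj m) (y : N.obj n) :
    (Tens.mk e x (N.map t y) : TensObj M N p) =
      Tens.mk ((blockSum (Equiv.refl _) t).trans e) x y := by
  rw [← Tens.mk_map, M.map_refl]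

theorem Tens.mk_map_left {M : SMod.{u, v} k} {N : SMod.{u, w} k} {m m' n p : ℕ}
    (s : Fin m ≃ Fin m') (e : Fin (m' + n) ≃ Fin p) (x : M.obj m) (y : N.obj n) :
    (Tens.mk e (M.map s x) y : TensObj M N p) =
      Tens.mk ((blockSum s (Equiv.refl _)).trans e) x y := by
  rw [← Tens.mk_map, N.map_refl]

/-- The map `x ↦ 1 ⊗ x + x ⊗ 1`, `A → A ⊗_𝕊 A`. -/
def TwAlg.prim : SMod.Hom A.toSMod (A.tens A).toSMod where
  app n := ((Tens.mk (blockZeroLeft n) A.one + (Tens.mk (blockZeroRight n)).flip A.one :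
    A.obj n →ₗ[k] TensObj A.toSMod A.toSMod n))
  app_map {m n} e x := by
    change (Tens.mk (blockZeroLeft n) A.one (A.map e x) +
        Tens.mk (blockZeroRight n) (A.map e x) A.one : TensObj A.toSMod A.toSMod n) =
      Tens.map e (Tens.mk (blockZeroLeft m) A.one x + Tens.mk (blockZeroRight m) x A.one)
    have h₁ := Tens.mk_map (M := A.toSMod) (N := A.toSMod) (Equiv.refl _) e (blockZeroLeft n) A.one x
    have h₂ := Tens.mk_map (M := A.toSMod) (N := A.toSMod) e (Equiv.refl _)
      (blockZeroRight n) x A.one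
    rw [A.map_refl] at h₁ h₂
    rw [map_add, Tens.map_mk, h₁, h₂, Tens.map_mk]
    rw [blockSum_zero_left, blockSum_zero_right]

theorem TwAlg.prim_apply {n : ℕ} (x : A.obj n) :
    A.prim.app n x = (Tens.mk (blockZeroLeft n) A.one x + Tens.mk (blockZeroRight n) x A.one :
      TensObj A.toSMod A.toSMod n) := rfl

/-- The commutator of two primitive elements is primitive. -/
theorem TwAlg.prim_comm {m n : ℕ} (x : A.obj m) (y : A.obj n) :
    (A.tens A).mul (A.prim.app m x) (A.prim.app n y) -
      (A.tens A).map (blockSwap n m) ((A.tens A).mul (A.prim.app n y) (A.prim.app m x)) =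
    A.prim.app (m + n) (A.mul x y - A.map (blockSwap n m) (A.mul y x)) := by
  rw [map_sub, A.prim.app_map]
  change tensMul A A m n (Tens.mk (blockZeroLeft m) A.one x + Tens.mk (blockZeroRight m) x A.one)
      (Tens.mk (blockZeroLeft n) A.one y + Tens.mk (blockZeroRight n) y A.one) -
      Tens.map (blockSwap n m) (tensMul A A n m
        (Tens.mk (blockZeroLeft n) A.one y + Tens.mk (blockZeroRight n) y A.one)
        (Tens.mk (blockZeroLeft m) A.one x + Tens.mk (blockZeroRight m) x A.one)) =
    (Tens.mk (blockZeroLeft (m + n)) A.one (A.mul x y) +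
        Tens.mk (blockZeroRight (m + n)) (A.mul x y) A.one) -
      Tens.map (blockSwap n m) (Tens.mk (blockZeroLeft (n + m)) A.one (A.mul y x) +
        Tens.mk (blockZeroRight (n + m)) (A.mul y x) A.one)
  simp only [map_add, LinearMap.add_apply, tensMul_mk, A.mul_one_eq, A.one_mul_eq, Tens.map_mk,
    Tens.mk_map_left, Tens.mk_map_right]
  rw [prim_block₁, prim_block₂, prim_block₃, prim_block₄, prim_block₁, prim_block₂, prim_block₃,
    prim_block₄, blockSwap_swap, Equiv.refl_trans]
  abel

end primitive

/-! ### Filtrations and associated graded algebras -/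

/-- An increasing filtration of a twisted associative algebra by
`𝕊`-submodules, compatible with the product. -/
structure TwFilt (A : TwAlg.{u, v} k) where
  F : ℕ → ∀ p, Submodule k (A.obj p)
  mono : ∀ n p, F n p ≤ F (n + 1) p
  one_mem : A.one ∈ F 0 0
  map_mem : ∀ {n p q : ℕ} (e : Fin p ≃ Fin q) {x : A.obj p}, x ∈ F n p → A.map e x ∈ F n q
  mul_mem : ∀ {i j p q : ℕ} {x : A.obj p} {y : A.obj q},
    x ∈ F i p → y ∈ F j q → A.mul x y ∈ F (i + j) (p + q)

namespace TwFilt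

variable {A : TwAlg.{u, v} k} (𝓕 : TwFilt A)

/-- The previous step `F_{n-1}` of the filtration, with `F_{-1} = 0`. -/
def prev : ℕ → ∀ p, Submodule k (A.obj p)
  | 0, _ => ⊥
  | n + 1, p => 𝓕.F n p

/-- The degree `p` part of `gr_n A = F_n A / F_{n-1} A`. -/
def Piece (n p : ℕ) : Type v := 𝓕.F n p ⧸ (𝓕.prev n p).comap (𝓕.F n p).subtype

instance (n p : ℕ) : AddCommGroup (𝓕.Piece n p) := Submodule.Quotient.addCommGroup _

instance (n p : ℕ) : Module k (𝓕.Piece n p) := Submodule.Quotient.module _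

/-- The degree `p` part of `gr A = ⨁_n F_n A / F_{n-1} A`. -/
def GrObj (p : ℕ) : Type v := ⨁ n, 𝓕.Piece n p

instance (p : ℕ) : AddCommGroup (𝓕.GrObj p) :=
  inferInstanceAs (AddCommGroup (⨁ n, 𝓕.Piece n p))

instance (p : ℕ) : Module k (𝓕.GrObj p) := inferInstanceAs (Module k (⨁ n, 𝓕.Piece n p))

/-- The inclusion of `gr_n A` into `gr A`. -/
def incl (n p : ℕ) : 𝓕.Piece n p →ₗ[k] 𝓕.GrObj p :=
  DirectSum.lof k ℕ (fun n => 𝓕.Piece n p) n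

/-- The projection `F_n A → gr_n A`. -/
def pieceMk (n p : ℕ) : 𝓕.F n p →ₗ[k] 𝓕.Piece n p := Submodule.mkQ _

/-- Linear maps out of `gr A`. -/
def grLift {p : ℕ} {X : Type*} [AddCommGroup X] [Module k X] (f : ∀ n, 𝓕.Piece n p →ₗ[k] X) :
    𝓕.GrObj p →ₗ[k] X :=
  DirectSum.toModule k ℕ X f

theorem grLift_incl {p : ℕ} {X : Type*} [AddCommGroup X] [Module k X]
    (f : ∀ n, 𝓕.Piece n p →ₗ[k] X) (n : ℕ) (x : 𝓕.Piece n p) :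
    𝓕.grLift f (𝓕.incl n p x) = f n x :=
  DirectSum.toModule_lof (M := fun n => 𝓕.Piece n p) k (φ := f) n x

/-- The class in `gr_n A` of an element of `F_n A`. -/
def cls (n p : ℕ) : 𝓕.F n p →ₗ[k] 𝓕.GrObj p :=
  𝓕.incl n p ∘ₗ 𝓕.pieceMk n p

theorem cls_eq_zero {n p : ℕ} {x : 𝓕.F n p} (hx : (x : A.obj p) ∈ 𝓕.prev n p) :
    𝓕.cls n p x = 0 := by
  have h : 𝓕.pieceMk n p x = 0 := (Submodule.Quotient.mk_eq_zero _).2 hx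
  rw [cls, LinearMap.comp_apply, h, map_zero]

theorem cls_congr {n n' p : ℕ} {x : 𝓕.F n p} {y : 𝓕.F n' p} (h : n = n')
    (hxy : (x : A.obj p) = y) : 𝓕.cls n p x = 𝓕.cls n' p y := by
  subst h
  exact congrArg _ (Subtype.ext hxy)

theorem gr_induction {p : ℕ} {P : 𝓕.GrObj p → Prop} (z : 𝓕.GrObj p) (zero : P 0)
    (add : ∀ a b, P a → P b → P (a + b)) (cls : ∀ n (x : 𝓕.F n p), P (𝓕.cls n p x)) : P z := by
  induction z using DirectSum.induction_on with
  | zero => exact zero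
  | of n x =>
    obtain ⟨x, rfl⟩ := Submodule.mkQ_surjective _ x
    exact cls n x
  | add a b ha hb => exact add a b ha hb

theorem map_mem_prev {n p q : ℕ} (e : Fin p ≃ Fin q) {x : A.obj p} (hx : x ∈ 𝓕.prev n p) :
    A.map e x ∈ 𝓕.prev n q := by
  cases n with
  | zero =>
    obtain rfl : x = 0 := hx
    rw [map_zero]
    exact zero_mem _
  | succ n => exact 𝓕.map_mem e hx

/-- The action of bijections on `gr_n A`. -/
def pieceMap (n : ℕ) {p q : ℕ} (e : Fin p ≃ Fin q) : 𝓕.Piece n p →ₗ[k] 𝓕.GrObj q :=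
  Submodule.liftQ _ (𝓕.cls n q ∘ₗ (A.map e).restrict fun _ hx => 𝓕.map_mem e hx)
    fun _ hx => 𝓕.cls_eq_zero (𝓕.map_mem_prev e hx)

/-- The action of bijections on `gr A`. -/
def grMap {p q : ℕ} (e : Fin p ≃ Fin q) : 𝓕.GrObj p →ₗ[k] 𝓕.GrObj q :=
  𝓕.grLift fun n => 𝓕.pieceMap n e

theorem grMap_cls {n p q : ℕ} (e : Fin p ≃ Fin q) (x : 𝓕.F n p) :
    𝓕.grMap e (𝓕.cls n p x) = 𝓕.cls n q ⟨A.map e x, 𝓕.map_mem e x.2⟩ := by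
  rw [grMap, cls, LinearMap.comp_apply, grLift_incl]
  rfl

/-- The product of classes. -/
def clsMul (i j p q : ℕ) : 𝓕.F i p →ₗ[k] 𝓕.F j q →ₗ[k] 𝓕.GrObj (p + q) :=
  LinearMap.mk₂ k (fun x y => 𝓕.cls (i + j) (p + q) ⟨A.mul x y, 𝓕.mul_mem x.2 y.2⟩)
    (fun x x' y => by
      rw [← map_add]
      exact 𝓕.cls_congr rfl (by simp))
    (fun c x y => by
      rw [← map_smul]
      exact 𝓕.cls_congr rfl (by simp))
    (fun x y y' => by
      rw [← map_add]
      exact 𝓕.cls_congr rfl (by simp))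
    (fun c x y => by
      rw [← map_smul]
      exact 𝓕.cls_congr rfl (by simp))

theorem mul_mem_prev_left {i j p q : ℕ} {x : A.obj p} {y : A.obj q} (hx : x ∈ 𝓕.prev i p)
    (hy : y ∈ 𝓕.F j q) : A.mul x y ∈ 𝓕.prev (i + j) (p + q) := by
  cases i with
  | zero =>
    obtain rfl : x = 0 := hx
    rw [map_zero, LinearMap.zero_apply]
    exact zero_mem _
  | succ i =>
    rw [Nat.succ_add_eq_add_succ]
    exact 𝓕.mul_mem hx hy

theorem mul_mem_prev_right {i j p q : ℕ} {x : A.obj p} {y : A.obj q} (hx : x ∈ 𝓕.F i p)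
    (hy : y ∈ 𝓕.prev j q) : A.mul x y ∈ 𝓕.prev (i + j) (p + q) := by
  cases j with
  | zero =>
    obtain rfl : y = 0 := hy
    rw [map_zero]
    exact zero_mem _
  | succ j => exact 𝓕.mul_mem hx hy

/-- The product `gr_i A × gr_j A → gr A`. -/
def pieceMul (i j p q : ℕ) : 𝓕.Piece i p →ₗ[k] 𝓕.Piece j q →ₗ[k] 𝓕.GrObj (p + q) :=
  bilinQuot _ _ (𝓕.clsMul i j p q)
    (fun _ hx y => 𝓕.cls_eq_zero (𝓕.mul_mem_prev_left hx y.2))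
    (fun x _ hy => 𝓕.cls_eq_zero (𝓕.mul_mem_prev_right x.2 hy))

/-- The product of `gr A`, induced by that of `A`. -/
def grMul (p q : ℕ) : 𝓕.GrObj p →ₗ[k] 𝓕.GrObj q →ₗ[k] 𝓕.GrObj (p + q) :=
  𝓕.grLift fun i => (𝓕.grLift fun j => (𝓕.pieceMul i j p q).flip).flip

theorem grMul_cls {i j p q : ℕ} (x : 𝓕.F i p) (y : 𝓕.F j q) :
    𝓕.grMul p q (𝓕.cls i p x) (𝓕.cls j q y) =
      𝓕.cls (i + j) (p + q) ⟨A.mul x y, 𝓕.mul_mem x.2 y.2⟩ := by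
  rw [grMul, cls, LinearMap.comp_apply, grLift_incl, LinearMap.flip_apply, cls,
    LinearMap.comp_apply, grLift_incl]
  rfl

/-- The associated graded twisted algebra `gr A`. -/
def gr : TwAlg.{u, v} k where
  obj := 𝓕.GrObj
  map := 𝓕.grMap
  map_refl {p} z := by
    induction z using 𝓕.gr_induction with
    | zero => rw [map_zero]
    | add a b ha hb => rw [map_add, ha, hb]
    | cls n x =>
      rw [grMap_cls]
      exact 𝓕.cls_congr rfl (A.map_refl _)
  map_trans e f z := by
    induction z using 𝓕.gr_induction with
    | zero => simp only [map_zero]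
    | add a b ha hb => simp only [map_add, ha, hb]
    | cls n x =>
      rw [grMap_cls, grMap_cls, grMap_cls]
      exact 𝓕.cls_congr rfl (A.map_trans _ _ _)
  one := 𝓕.cls 0 0 ⟨A.one, 𝓕.one_mem⟩
  mul {p q} := 𝓕.grMul p q
  mul_map e f z z' := by
    induction z using 𝓕.gr_induction with
    | zero => simp only [map_zero, LinearMap.zero_apply]
    | add a b ha hb => simp only [map_add, LinearMap.add_apply, ha, hb]
    | cls i x =>
      induction z' using 𝓕.gr_induction with
      | zero => simp only [map_zero]
      | add a b ha hb => simp only [map_add, ha, hb]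
      | cls j y =>
        rw [grMap_cls, grMap_cls, grMul_cls, grMul_cls, grMap_cls]
        exact 𝓕.cls_congr rfl (A.mul_map _ _ _ _)
  mul_assoc z z' z'' := by
    induction z using 𝓕.gr_induction with
    | zero => simp only [map_zero, LinearMap.zero_apply]
    | add a b ha hb => simp only [map_add, LinearMap.add_apply, ha, hb]
    | cls i x =>
      induction z' using 𝓕.gr_induction with
      | zero => simp only [map_zero, LinearMap.zero_apply]
      | add a b ha hb => simp only [map_add, LinearMap.add_apply, ha, hb]
      | cls j y =>
        induction z'' using 𝓕.gr_induction with
        | zero => simp only [map_zero]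
        | add a b ha hb => simp only [map_add, ha, hb]
        | cls l w =>
          rw [grMul_cls, grMul_cls, grMul_cls, grMul_cls, grMap_cls]
          exact 𝓕.cls_congr (Nat.add_assoc _ _ _) (A.mul_assoc _ _ _)
  one_mul {p} z := by
    induction z using 𝓕.gr_induction with
    | zero => simp only [map_zero]
    | add a b ha hb => simp only [map_add, ha, hb]
    | cls i x =>
      rw [grMul_cls, grMap_cls]
      exact 𝓕.cls_congr (Nat.zero_add _) (A.one_mul _)
  mul_one {p} z := by
    induction z using 𝓕.gr_induction with
    | zero => simp only [map_zero, LinearMap.zero_apply]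
    | add a b ha hb => simp only [map_add, LinearMap.add_apply, ha, hb]
    | cls i x =>
      rw [grMul_cls, grMap_cls]
      exact 𝓕.cls_congr (Nat.add_zero _) (A.mul_one _)

end TwFilt

/-! ### The word-length filtration -/

section words

variable {M : SMod.{u, v} k} {A : TwAlg.{u, w} k} (ι : SMod.Hom M A.toSMod)

/-- `IsWord ι n u` says that `u` is of the form `σ (x_1 x_2 ⋯ x_n)` with `σ` a permutation and
`x_1, …, x_n` (images of) elements of `M`. -/
inductive IsWord : ℕ → ∀ {p : ℕ}, A.obj p → Prop
  | one : IsWord 0 A.one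
  | mul_ι {n p q : ℕ} {u : A.obj p} (x : M.obj q) :
      IsWord n u → IsWord (n + 1) (A.mul u (ι.app q x))
  | map {n p q : ℕ} (e : Fin p ≃ Fin q) {u : A.obj p} : IsWord n u → IsWord n (A.map e u)

/-- The span of the products of exactly `n` elements of `M`. -/
def wordSpan (n p : ℕ) : Submodule k (A.obj p) := Submodule.span k {u | IsWord ι n u}

theorem IsWord.mul {i j p q : ℕ} {u : A.obj p} {v : A.obj q} (hu : IsWord ι i u)
    (hv : IsWord ι j v) : IsWord ι (i + j) (A.mul u v) := by
  induction hv with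
  | one =>
    rw [A.mul_one_eq]
    exact .map _ hu
  | mul_ι x _ ih =>
    rw [← A.mul_assoc]
    exact .map _ (.mul_ι x ih)
  | map e _ ih =>
    have := A.mul_map (Equiv.refl _) e u
    simp only [A.map_refl] at this
    rw [this]
    exact .map _ ih

/-- The filtration with `F_0 = k`, `F_1 = k + M`, and `F_n` spanned by the products of at most `n`
elements of `M`. -/
def wordFilt : TwFilt A where
  F n p := Submodule.span k {u | ∃ j ≤ n, IsWord ι j u}
  mono n p := Submodule.span_mono fun u ⟨j, hj, hu⟩ => ⟨j, hj.trans n.le_succ, hu⟩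
  one_mem := Submodule.subset_span ⟨0, le_rfl, .one⟩
  map_mem := by
    intro n p q e x hx
    induction hx using Submodule.span_induction with
    | mem u hu =>
      obtain ⟨j, hj, hu⟩ := hu
      exact Submodule.subset_span ⟨j, hj, .map e hu⟩
    | zero => rw [map_zero]; exact zero_mem _
    | add a b _ _ ha hb => rw [map_add]; exact add_mem ha hb
    | smul c a _ ha => rw [map_smul]; exact Submodule.smul_mem _ _ ha
  mul_mem := by
    intro i j p q x y hx hy
    induction hx using Submodule.span_induction with
    | mem u hu =>
      induction hy using Submodule.span_induction with
      | mem v hv =>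
        obtain ⟨a, ha, hu⟩ := hu
        obtain ⟨b, hb, hv⟩ := hv
        exact Submodule.subset_span ⟨a + b, add_le_add ha hb, hu.mul ι hv⟩
      | zero => rw [map_zero]; exact zero_mem _
      | add a b _ _ ha hb => rw [map_add]; exact add_mem ha hb
      | smul c a _ ha => rw [map_smul]; exact Submodule.smul_mem _ _ ha
    | zero => rw [map_zero, LinearMap.zero_apply]; exact zero_mem _
    | add a b _ _ ha hb => rw [map_add, LinearMap.add_apply]; exact add_mem ha hb
    | smul c a _ ha => rw [map_smul, LinearMap.smul_apply]; exact Submodule.smul_mem _ _ ha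

theorem ι_mem_wordFilt {p : ℕ} (x : M.obj p) : ι.app p x ∈ (wordFilt ι).F 1 p := by
  refine Submodule.subset_span ⟨1, le_rfl, ?_⟩
  have h := IsWord.map (blockZeroLeft p) (IsWord.mul_ι (ι := ι) x .one)
  rwa [A.one_mul] at h

end words

/-! ### The canonical morphism, and the coalgebra structures -/

/-- The coproduct of `Sym_𝕊 M`: the morphism of twisted algebras
`Sym_𝕊 M → Sym_𝕊 M ⊗_𝕊 Sym_𝕊 M` with `Δ x = 1 ⊗ x + x ⊗ 1` for `x ∈ M`. -/
def SymS.comul (M : SMod.{u, v} k) : TwAlg.Hom (SymS M) ((SymS M).tens (SymS M)) :=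
  SymS.lift ((SymS M).prim.comp (SymS.ι M)) fun x y =>
    ((SymS M).prim_comm _ _).trans ((congrArg _ (SymS.comm M x y)).trans (map_zero _))

/-- The coproduct of `U_𝕊 h`: the morphism of twisted algebras `U_𝕊 h → U_𝕊 h ⊗_𝕊 U_𝕊 h` with
`Δ x = 1 ⊗ x + x ⊗ 1` for `x ∈ h`. -/
def EnvS.comul (h : TwLie.{u, v} k) : TwAlg.Hom (EnvS h) ((EnvS h).tens (EnvS h)) :=
  EnvS.lift ((EnvS h).prim.comp (EnvS.ι h)) fun x y =>
    ((EnvS h).prim_comm _ _).trans (congrArg _ (EnvS.comm h x y))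

/-- The zero morphism. -/
def SMod.Hom.zero (M : SMod.{u, v} k) (N : SMod.{u, w} k) : SMod.Hom M N where
  app _ := 0
  app_map _ _ := (map_zero _).symm

/-- The counit of `Sym_𝕊 M`: the morphism of twisted algebras `Sym_𝕊 M → k` vanishing on `M`. -/
def SymS.counit (M : SMod.{u, v} k) : TwAlg.Hom (SymS M) (TwAlg.unit k) :=
  SymS.lift (SMod.Hom.zero M _) fun _ _ => by simp [SMod.Hom.zero]

/-- The counit of `U_𝕊 h`: the morphism of twisted algebras `U_𝕊 h → k` vanishing on `h`. -/
def EnvS.counit (h : TwLie.{u, v} k) : TwAlg.Hom (EnvS h) (TwAlg.unit k) :=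
  EnvS.lift (SMod.Hom.zero h.toSMod _) fun _ _ => by simp [SMod.Hom.zero]

/-- The filtration of `U_𝕊 h` by the length of products of elements of `h`. -/
def EnvS.filt (h : TwLie.{u, v} k) : TwFilt (EnvS h) := wordFilt (EnvS.ι h)

/-- The map `h → gr_1 U_𝕊 h ⊆ gr U_𝕊 h`. -/
def EnvS.symbol (h : TwLie.{u, v} k) : SMod.Hom h.toSMod (EnvS.filt h).gr.toSMod where
  app p := (EnvS.filt h).cls 1 p ∘ₗ
    ((EnvS.ι h).app p).codRestrict _ (ι_mem_wordFilt (EnvS.ι h))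
  app_map e x := by
    refine Eq.trans ?_ ((EnvS.filt h).grMap_cls e _).symm
    exact (EnvS.filt h).cls_congr rfl ((EnvS.ι h).app_map e x)

/-- The canonical morphism of twisted algebras `Sym_𝕊 h → gr U_𝕊 h`, which sends `x ∈ h` to its
class in `gr_1 U_𝕊 h`. -/
def canonicalMap (h : TwLie.{u, v} k) : TwAlg.Hom (SymS h.toSMod) (EnvS.filt h).gr :=
  SymS.lift (EnvS.symbol h) fun {m n} x y => by
    have h₁ := (EnvS.filt h).grMul_cls ⟨_, ι_mem_wordFilt (EnvS.ι h) x⟩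
      ⟨_, ι_mem_wordFilt (EnvS.ι h) y⟩
    have h₂ := (EnvS.filt h).grMul_cls ⟨_, ι_mem_wordFilt (EnvS.ι h) y⟩
      ⟨_, ι_mem_wordFilt (EnvS.ι h) x⟩
    change (EnvS.filt h).grMul m n ((EnvS.filt h).cls 1 m _) ((EnvS.filt h).cls 1 n _) -
      (EnvS.filt h).grMap (blockSwap n m) ((EnvS.filt h).grMul n m ((EnvS.filt h).cls 1 n _)
        ((EnvS.filt h).cls 1 m _)) = 0
    refine (congrArg₂ _ h₁ (congrArg _ h₂)).trans ?_
    rw [TwFilt.grMap_cls, ← map_sub]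
    refine TwFilt.cls_eq_zero _ ?_
    have h₃ := ι_mem_wordFilt (EnvS.ι h) (h.br x y)
    rw [← EnvS.comm] at h₃
    exact h₃

end TwPBW

/-! The pre-Lie product makes `U g` act on `Sym g` from the right, and the orbit map of `1` inverts
the desired isomorphism.

The maps `z ↦ z ∘ x` on `g` extend to derivations `s ↦ s ∘ x` of `Sym g` (`SymS.deriv`). Their
associator `(s ∘ x) ∘ y - s ∘ (x ∘ y)` is again symmetric in `x` and `y` (`SymS.deriv_preLie`): on a
product it satisfies the Leibniz rule up to mixed terms, which are symmetric themselves. Hence `s ·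
x = s x + s ∘ x` is a right action of the Lie algebra on `Sym g` (`SymS.envAct_isLie`).

The action extends to `U g`, and `ψ u = 1 · u` satisfies `ψ 1 = 1` and `ψ (u x) = ψ u x + ψ u ∘ x`
(`EnvS.toSym_mul_ι`). A derivation does not raise word length, so `ψ` sends a word `x₁ ⋯ xₙ` to the
same word modulo shorter ones. Since `Sym g` is graded by word length, and not merely filtered
(`SymS.eq_zero_of_mem_prev`), a combination of words of length `n` that falls into `F_{n-1} U g`
already vanishes in `Sym g` (`IsSymbolMap.proj_eq_zero`). This yields the injectivity of the
canonical map, whose surjectivity holds for every Lie algebra, and, by induction along the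
filtrations, the bijectivity of `ψ`. Then `Φ = ψ⁻¹` lifts the canonical map. No symmetrization is
involved, so nothing has to be inverted in `k`.

Right multiplication by a primitive element and the derivations above are both compatible with `Δ`,
if `x` acts on the tensor square by `a x ⊗ b + a ⊗ b x` (`RAct.tensMul_prim`, `SymS.comul_deriv`).
So `Δ ψ` and `(ψ ⊗ ψ) Δ` agree at `1` and obey the same recursion on words.

The symmetric groups only add bookkeeping: the verifications end in equalities of block
permutations, which are checked block by block with `block_ext` and `block_apply`. -/

namespace TwPBW

variable {k : Type u} [CommRing k]

/-! ### More block permutations -/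

/-- The permutation `(23)^{p,m,q}`, exchanging the last two of three blocks. -/
def blockRight (p m q : ℕ) : Fin (p + m + q) ≃ Fin (p + q + m) :=
  (blockAssoc p m q).trans
    ((blockSum (Equiv.refl (Fin p)) (blockSwap m q)).trans (blockAssoc p q m).symm)

section blocks

theorem blockRight_left {p m q : ℕ} (i : Fin p) :
    blockRight p m q (Fin.castAdd q (Fin.castAdd m i)) = Fin.castAdd m (Fin.castAdd q i) := by
  simp only [blockRight, Equiv.trans_apply, blockAssoc_left, blockSum_left, Equiv.refl_apply,
    blockAssoc_symm_left]

theorem blockRight_mid {p m q : ℕ} (i : Fin m) :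
    blockRight p m q (Fin.castAdd q (Fin.natAdd p i)) = Fin.natAdd (p + q) i := by
  simp only [blockRight, Equiv.trans_apply, blockAssoc_mid, blockSum_right, blockSwap_left,
    blockAssoc_symm_right]

theorem blockRight_right {p m q : ℕ} (i : Fin q) :
    blockRight p m q (Fin.natAdd (p + m) i) = Fin.castAdd m (Fin.natAdd p i) := by
  simp only [blockRight, Equiv.trans_apply, blockAssoc_right, blockSum_right, blockSwap_right,
    blockAssoc_symm_mid]

/-- The values of the block permutations on the blocks. -/
theorem block_apply :
    (∀ {m m' n n' : ℕ} (e : Fin m ≃ Fin m') (f : Fin n ≃ Fin n') (i : Fin m),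
      blockSum e f (Fin.castAdd n i) = Fin.castAdd n' (e i)) ∧
    (∀ {m m' n n' : ℕ} (e : Fin m ≃ Fin m') (f : Fin n ≃ Fin n') (i : Fin n),
      blockSum e f (Fin.natAdd m i) = Fin.natAdd m' (f i)) ∧
    (∀ {m n : ℕ} (i : Fin m), blockSwap m n (Fin.castAdd n i) = Fin.natAdd n i) ∧
    (∀ {m n : ℕ} (i : Fin n), blockSwap m n (Fin.natAdd m i) = Fin.castAdd m i) ∧
    (∀ {l m n : ℕ} (i : Fin l), blockAssoc l m n (Fin.castAdd n (Fin.castAdd m i)) = Fin.castAdd (m + n) i) ∧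
    (∀ {l m n : ℕ} (i : Fin m),
      blockAssoc l m n (Fin.castAdd n (Fin.natAdd l i)) = Fin.natAdd l (Fin.castAdd n i)) ∧
    (∀ {l m n : ℕ} (i : Fin n), blockAssoc l m n (Fin.natAdd (l + m) i) = Fin.natAdd l (Fin.natAdd m i)) ∧
    (∀ {l m n : ℕ} (i : Fin l),
      (blockAssoc l m n).symm (Fin.castAdd (m + n) i) = Fin.castAdd n (Fin.castAdd m i)) ∧
    (∀ {l m n : ℕ} (i : Fin m), (blockAssoc l m n).symm (Fin.natAdd l (Fin.castAdd n i)) =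
      Fin.castAdd n (Fin.natAdd l i)) ∧
    (∀ {l m n : ℕ} (i : Fin n), (blockAssoc l m n).symm (Fin.natAdd l (Fin.natAdd m i)) =
      Fin.natAdd (l + m) i) ∧
    (∀ {n : ℕ} (i : Fin n), blockZeroLeft n (Fin.natAdd 0 i) = i) ∧
    (∀ {n : ℕ} (i : Fin n), (blockZeroLeft n).symm i = Fin.natAdd 0 i) ∧
    (∀ {n : ℕ} (i : Fin n), blockZeroRight n (Fin.castAdd 0 i) = i) ∧
    (∀ {n : ℕ} (i : Fin n), (blockZeroRight n).symm i = Fin.castAdd 0 i) ∧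
    (∀ {a b c d : ℕ} (i : Fin a), blockMid a b c d (Fin.castAdd _ (Fin.castAdd _ i)) =
      Fin.castAdd _ (Fin.castAdd _ i)) ∧
    (∀ {a b c d : ℕ} (i : Fin b), blockMid a b c d (Fin.castAdd _ (Fin.natAdd _ i)) =
      Fin.natAdd _ (Fin.castAdd _ i)) ∧
    (∀ {a b c d : ℕ} (i : Fin c), blockMid a b c d (Fin.natAdd _ (Fin.castAdd _ i)) =
      Fin.castAdd _ (Fin.natAdd _ i)) ∧
    (∀ {a b c d : ℕ} (i : Fin d), blockMid a b c d (Fin.natAdd _ (Fin.natAdd _ i)) =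
      Fin.natAdd _ (Fin.natAdd _ i)) ∧
    (∀ {a b c : ℕ} (i : Fin a), blockRight a b c (Fin.castAdd _ (Fin.castAdd _ i)) =
      Fin.castAdd _ (Fin.castAdd _ i)) ∧
    (∀ {a b c : ℕ} (i : Fin b), blockRight a b c (Fin.castAdd _ (Fin.natAdd _ i)) = Fin.natAdd _ i) ∧
    (∀ {a b c : ℕ} (i : Fin c), blockRight a b c (Fin.natAdd _ i) = Fin.castAdd _ (Fin.natAdd _ i)) :=
  ⟨blockSum_left, blockSum_right, blockSwap_left, blockSwap_right, blockAssoc_left,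
    blockAssoc_mid, blockAssoc_right, blockAssoc_symm_left, blockAssoc_symm_mid,
    blockAssoc_symm_right, blockZeroLeft_right, blockZeroLeft_symm, blockZeroRight_left,
    blockZeroRight_symm, blockMid_ll, blockMid_lr, blockMid_rl, blockMid_rr, blockRight_left,
    blockRight_mid, blockRight_right⟩

/-- A rewriting system deciding equality of composites of block permutations. -/
theorem block_ext :
    -- Extensionality is limited to domains that are sums, where the split into blocks can follow.
    (∀ {m n : ℕ} {X : Type} {e f : Fin (m + n) ≃ X}, e = f ↔ ∀ i, e i = f i) ∧
    (∀ {m n : ℕ} {P : Fin (m + n) → Prop},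
      (∀ i, P i) ↔ (∀ i, P (Fin.castAdd n i)) ∧ ∀ i, P (Fin.natAdd m i)) ∧
    (∀ {P : Fin 0 → Prop}, (∀ i, P i) ↔ True) ∧
    (∀ {X Y Z : Type} (e : X ≃ Y) (f : Y ≃ Z) (x : X), (e.trans f) x = f (e x)) ∧
    (∀ {X : Type} (x : X), Equiv.refl X x = x) ∧
    (∀ {X Y : Type} (e : X ≃ Y) (x : X), e.symm (e x) = x) ∧
    (∀ {X Y : Type} (e : X ≃ Y) (y : Y), e (e.symm y) = y) :=
  ⟨Equiv.ext_iff, forall_fin_add, forall_fin_zero, fun _ _ _ => rfl, fun _ => rfl,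
    Equiv.symm_apply_apply, Equiv.apply_symm_apply⟩

end blocks

namespace TwAlg

variable (A : TwAlg.{u, v} k)

theorem mul_map_left {m m' n : ℕ} (e : Fin m ≃ Fin m') (x : A.obj m) (y : A.obj n) :
    A.mul (A.map e x) y = A.map (blockSum e (Equiv.refl _)) (A.mul x y) := by
  rw [← A.mul_map, A.map_refl]

theorem mul_map_right {m n n' : ℕ} (f : Fin n ≃ Fin n') (x : A.obj m) (y : A.obj n) :
    A.mul x (A.map f y) = A.map (blockSum (Equiv.refl _) f) (A.mul x y) := by
  rw [← A.mul_map, A.map_refl]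

/-- As a rewriting rule this nests products to the left, with all permutations collected outside. -/
theorem mul_mul_eq {l m n : ℕ} (x : A.obj l) (y : A.obj m) (z : A.obj n) :
    A.mul x (A.mul y z) = A.map (blockAssoc l m n) (A.mul (A.mul x y) z) :=
  (A.mul_assoc x y z).symm

end TwAlg

/-! ### Right actions -/

/-- An equivariant family of bilinear maps `M_p × G_m → M_{p+m}`. -/
structure RAct (M : SMod.{u, v} k) (G : SMod.{u, w} k) where
  op : ∀ {p m : ℕ}, M.obj p →ₗ[k] G.obj m →ₗ[k] M.obj (p + m)
  op_map : ∀ {p p' m m' : ℕ} (e : Fin p ≃ Fin p') (f : Fin m ≃ Fin m') (s : M.obj p)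
    (x : G.obj m), op (M.map e s) (G.map f x) = M.map (blockSum e f) (op s x)

namespace RAct

variable {M : SMod.{u, v} k} {G : SMod.{u, w} k}

theorem op_map_left (ρ : RAct M G) {p p' m : ℕ} (e : Fin p ≃ Fin p') (s : M.obj p)
    (x : G.obj m) : ρ.op (M.map e s) x = M.map (blockSum e (Equiv.refl _)) (ρ.op s x) := by
  rw [← ρ.op_map, G.map_refl]

theorem op_map_right (ρ : RAct M G) {p m m' : ℕ} (f : Fin m ≃ Fin m') (s : M.obj p)
    (x : G.obj m) : ρ.op s (G.map f x) = M.map (blockSum (Equiv.refl _) f) (ρ.op s x) := by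
  rw [← ρ.op_map, M.map_refl]

/-- The sum of two actions. -/
def add (ρ σ : RAct M G) : RAct M G where
  op := ρ.op + σ.op
  op_map e f s x := by
    simp only [LinearMap.add_apply, ρ.op_map, σ.op_map, map_add]

theorem add_op (ρ σ : RAct M G) {p m : ℕ} (s : M.obj p) (x : G.obj m) :
    (ρ.add σ).op s x = ρ.op s x + σ.op s x := rfl

/-- Right multiplication by the elements `f x`. -/
def ofHom {A : TwAlg.{u, v} k} (f : SMod.Hom G A.toSMod) : RAct A.toSMod G where
  op {_ m} := A.mul.compl₂ (f.app m)
  op_map e g s x := by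
    rw [LinearMap.compl₂_apply, LinearMap.compl₂_apply, f.app_map, A.mul_map]

end RAct

/-! ### The twisted algebra of endomorphisms -/

namespace EndS

variable (M : SMod.{u, v} k)

/-- Equivariant families of linear maps `M_p → M_{p+n}`. -/
def sub (n : ℕ) : Submodule k (∀ p, M.obj p →ₗ[k] M.obj (p + n)) where
  carrier := {φ | ∀ (p p' : ℕ) (e : Fin p ≃ Fin p') (s : M.obj p),
    φ p' (M.map e s) = M.map (blockSum e (Equiv.refl _)) (φ p s)}
  zero_mem' _ _ _ _ := by simp
  add_mem' h h' _ _ _ _ := by simp [h _ _ _ _, h' _ _ _ _]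
  smul_mem' c _ h _ _ _ _ := by simp [h _ _ _ _]

variable {M} in
@[ext]
theorem sub_ext {n : ℕ} {φ ψ : sub M n} (h : ∀ p s, φ.1 p s = ψ.1 p s) : φ = ψ :=
  Subtype.ext (funext fun p => LinearMap.ext (h p))

end EndS

/-- The twisted algebra of equivariant families of linear maps `M_p → M_{p+n}`, acting on `M` from
the right. -/
def EndS (M : SMod.{u, v} k) : TwAlg.{u, v} k where
  obj n := EndS.sub M n
  map {m n} f :=
    { toFun φ := ⟨fun p => M.map (blockSum (Equiv.refl _) f) ∘ₗ φ.1 p, fun p p' e s => by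
        rw [LinearMap.comp_apply, LinearMap.comp_apply, φ.2, ← M.map_trans, ← M.map_trans]
        congr 2
        simp only [block_ext, block_apply, implies_true, and_self]⟩
      map_add' φ ψ := by ext p s; simp
      map_smul' c φ := by ext p s; simp }
  map_refl φ := by
    ext p s
    change M.map _ _ = _
    rw [blockSum_refl, M.map_refl]
  map_trans e f φ := by
    ext p s
    change M.map _ _ = M.map _ (M.map _ _)
    rw [← M.map_trans, blockSum_trans, Equiv.refl_trans]
  one := ⟨fun p => M.map (blockZeroRight p).symm, fun p p' e s => by
    rw [← M.map_trans, ← M.map_trans]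
    congr 2
    -- The domain is `Fin p`, which is not a sum, so general extensionality is needed.
    simp only [Equiv.ext_iff, block_ext, block_apply, implies_true, and_self]⟩
  mul {m n} := LinearMap.mk₂ k
    -- The action is from the right: the product `φ ψ` applies `φ` first.
    (fun φ ψ => ⟨fun p => M.map (blockAssoc p m n) ∘ₗ ψ.1 (p + m) ∘ₗ φ.1 p, fun p p' e s => by
      simp only [LinearMap.comp_apply]
      rw [φ.2, ψ.2, ← M.map_trans, ← M.map_trans]
      congr 2
      simp only [block_ext, block_apply, implies_true, and_self]⟩)
    (fun _ _ _ => by ext p s; simp)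
    (fun _ _ _ => by ext p s; simp)
    (fun _ _ _ => by ext p s; simp)
    (fun _ _ _ => by ext p s; simp)
  mul_map e f φ ψ := by
    ext p s
    change M.map _ (M.map _ (ψ.1 _ (M.map _ (φ.1 p s)))) =
      M.map _ (M.map _ (ψ.1 _ (φ.1 p s)))
    rw [ψ.2, ← M.map_trans, ← M.map_trans, ← M.map_trans]
    congr 2
    simp only [block_ext, block_apply, implies_true, and_self]
  mul_assoc φ ψ χ := by
    ext p s
    change M.map _ (M.map _ (χ.1 _ (M.map _ (ψ.1 _ (φ.1 p s))))) =
      M.map _ (M.map _ (χ.1 _ (ψ.1 _ (φ.1 p s))))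
    rw [χ.2, ← M.map_trans, ← M.map_trans, ← M.map_trans]
    congr 2
    simp only [block_ext, block_apply, implies_true, and_self]
  one_mul φ := by
    ext p s
    change M.map _ (M.map _ (φ.1 _ (M.map _ s))) = φ.1 p s
    rw [φ.2, ← M.map_trans, ← M.map_trans]
    refine Eq.trans ?_ (M.map_refl _)
    congr 2
    simp only [block_ext, block_apply, implies_true, and_self]
  mul_one φ := by
    ext p s
    change M.map _ (M.map _ (M.map _ (φ.1 p s))) = φ.1 p s
    rw [← M.map_trans, ← M.map_trans]
    refine Eq.trans ?_ (M.map_refl _)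
    congr 2
    simp only [block_ext, block_apply, implies_true, and_self]

namespace RAct

variable {M : SMod.{u, v} k}

/-- An action as a morphism to the endomorphism algebra. -/
def toEnd {G : SMod.{u, w} k} (ρ : RAct M G) : SMod.Hom G (EndS M).toSMod where
  app _ :=
    { toFun x := ⟨fun _ => ρ.op.flip x, fun _ _ e s => ρ.op_map_left e s x⟩
      map_add' x y := EndS.sub_ext fun _ s => map_add (ρ.op s) x y
      map_smul' c x := EndS.sub_ext fun _ s => map_smul (ρ.op s) c x }
  app_map f x := EndS.sub_ext fun _ s => ρ.op_map_right f s x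

/-- The compatibility of an action with the bracket of a twisted Lie algebra. -/
def IsLie {h : TwLie.{u, w} k} (ρ : RAct M h.toSMod) : Prop :=
  ∀ {p m n : ℕ} (s : M.obj p) (x : h.obj m) (y : h.obj n),
    M.map (blockAssoc p m n) (ρ.op (ρ.op s x) y) -
      M.map (blockSum (Equiv.refl _) (blockSwap n m))
        (M.map (blockAssoc p n m) (ρ.op (ρ.op s y) x)) = ρ.op s (h.br x y)

/-- The action of the enveloping algebra defined by an action of a twisted Lie algebra. -/
def envHom {h : TwLie.{u, w} k} (ρ : RAct M h.toSMod) (hρ : ρ.IsLie) :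
    TwAlg.Hom (EnvS h) (EndS M) :=
  EnvS.lift ρ.toEnd fun x y => EndS.sub_ext fun _ s => hρ s x y

/-- The action of the enveloping algebra on an element of degree zero. -/
def orbit {h : TwLie.{u, w} k} (ρ : RAct M h.toSMod) (hρ : ρ.IsLie) (s : M.obj 0) :
    SMod.Hom (EnvS h).toSMod M where
  -- The result of acting on `s` has degree `0 + p`; `blockZeroLeft` identifies this with `p`.
  app p := M.map (blockZeroLeft p) ∘ₗ LinearMap.applyₗ s ∘ₗ
    LinearMap.proj (R := k) (φ := fun q => M.obj q →ₗ[k] M.obj (q + p)) 0 ∘ₗ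
      (EndS.sub M p).subtype ∘ₗ (ρ.envHom hρ).app p
  app_map {p q} e u := by
    change M.map _ (((ρ.envHom hρ).app q ((EnvS h).map e u)).1 0 s) =
      M.map e (M.map _ (((ρ.envHom hρ).app p u).1 0 s))
    rw [(ρ.envHom hρ).app_map]
    change M.map _ (M.map _ _) = _
    rw [← M.map_trans, ← M.map_trans, blockSum_zero_left]

theorem orbit_one {h : TwLie.{u, w} k} (ρ : RAct M h.toSMod) (hρ : ρ.IsLie) (s : M.obj 0) :
    (ρ.orbit hρ s).app 0 (EnvS h).one = s := by
  change M.map _ (((ρ.envHom hρ).app 0 (EnvS h).one).1 0 s) = s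
  rw [(ρ.envHom hρ).app_one]
  change M.map _ (M.map _ s) = s
  rw [← M.map_trans]
  exact M.map_refl s

/-- `envHom` is multiplicative, and products in `EndS` apply the left factor first. Since `U h` is
spanned by words, this recursion and `orbit_one` determine the orbit map. -/
theorem orbit_mul_ι {h : TwLie.{u, w} k} (ρ : RAct M h.toSMod) (hρ : ρ.IsLie) (s : M.obj 0)
    {p m : ℕ} (u : (EnvS h).obj p) (x : h.obj m) :
    (ρ.orbit hρ s).app (p + m) ((EnvS h).mul u ((EnvS.ι h).app m x)) =
      ρ.op ((ρ.orbit hρ s).app p u) x := by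
  change M.map _ (((ρ.envHom hρ).app _ ((EnvS h).mul u ((EnvS.ι h).app m x))).1 0 s) =
    ρ.op (M.map _ (((ρ.envHom hρ).app p u).1 0 s)) x
  rw [(ρ.envHom hρ).app_mul]
  change M.map _ (M.map _ (ρ.op (((ρ.envHom hρ).app p u).1 0 s) x)) = _
  rw [ρ.op_map_left, ← M.map_trans]
  congr 2
  simp only [block_ext, block_apply, implies_true, and_self]

end RAct

/-! ### Words -/

section words

variable {M : SMod.{u, v} k} {A : TwAlg.{u, w} k} {B : TwAlg.{u, w'} k}

/-- The images of the elements of `M` generate the twisted algebra `A`. -/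
def Generates (ι : SMod.Hom M A.toSMod) : Prop :=
  ∀ (p : ℕ) (a : A.obj p), ∃ n, a ∈ (wordFilt ι).F n p

theorem wordFilt_mono (ι : SMod.Hom M A.toSMod) {n n' : ℕ} (h : n ≤ n') (p : ℕ) :
    (wordFilt ι).F n p ≤ (wordFilt ι).F n' p :=
  Submodule.span_mono fun _ ⟨j, hj, hu⟩ => ⟨j, hj.trans h, hu⟩

theorem wordSpan_le (ι : SMod.Hom M A.toSMod) (n p : ℕ) :
    wordSpan ι n p ≤ (wordFilt ι).F n p :=
  Submodule.span_mono fun _ hu => ⟨n, le_rfl, hu⟩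

/-- A word of length at most `n` has length exactly `n` or is already in the previous step. This
splits off leading terms in all inductions along the filtration. -/
theorem wordFilt_eq_sup (ι : SMod.Hom M A.toSMod) (n p : ℕ) :
    (wordFilt ι).F n p = (wordFilt ι).prev n p ⊔ wordSpan ι n p := by
  refine le_antisymm (Submodule.span_le.2 ?_) (sup_le ?_ (wordSpan_le ι n p))
  · rintro u ⟨j, hj, hu⟩
    obtain rfl | hj := hj.eq_or_lt
    · exact Submodule.mem_sup_right (Submodule.subset_span hu)
    · cases n with
      | zero => exact absurd hj (Nat.not_lt_zero j)
      | succ n => exact Submodule.mem_sup_left (Submodule.subset_span ⟨j, Nat.le_of_lt_succ hj, hu⟩)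
  · cases n with
    | zero => exact bot_le
    | succ n => exact (wordFilt ι).mono n p

theorem TwFilt.prev_le (𝓕 : TwFilt A) (n p : ℕ) : 𝓕.prev n p ≤ 𝓕.F n p := by
  cases n with
  | zero => exact bot_le
  | succ n => exact 𝓕.mono n p

/-- Induction over words. -/
theorem Generates.induction {ι : SMod.Hom M A.toSMod} (hι : Generates ι)
    {P : ∀ p, A.obj p → Prop} (one : P 0 A.one)
    (mul_ι : ∀ {p q : ℕ} (u : A.obj p) (x : M.obj q), P p u → P (p + q) (A.mul u (ι.app q x)))
    (map : ∀ {p q : ℕ} (e : Fin p ≃ Fin q) (u : A.obj p), P p u → P q (A.map e u))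
    (zero : ∀ p, P p 0) (add : ∀ {p : ℕ} (u v : A.obj p), P p u → P p v → P p (u + v))
    (smul : ∀ {p : ℕ} (c : k) (u : A.obj p), P p u → P p (c • u)) {p : ℕ} (u : A.obj p) :
    P p u := by
  have word : ∀ {n p : ℕ} {u : A.obj p}, IsWord ι n u → P p u := by
    intro n p u hu
    induction hu with
    | one => exact one
    | mul_ι x _ ih => exact mul_ι _ x ih
    | map e _ ih => exact map e _ ih
  obtain ⟨n, hu⟩ := hι p u
  induction hu using Submodule.span_induction with
  | mem u hu =>
    obtain ⟨j, -, hu⟩ := hu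
    exact word hu
  | zero => exact zero p
  | add u v _ _ hu hv => exact add u v hu hv
  | smul c u _ hu => exact smul c u hu

/-- A morphism of `𝕊`-modules is determined by its compatibility with right multiplication by
generators. -/
theorem Generates.hom_ext {ι : SMod.Hom M A.toSMod} (hι : Generates ι) {N : SMod.{u, v'} k}
    {f g : SMod.Hom A.toSMod N} (one : f.app 0 A.one = g.app 0 A.one)
    (mul_ι : ∀ {p q : ℕ} (u : A.obj p) (x : M.obj q), f.app p u = g.app p u →
      f.app (p + q) (A.mul u (ι.app q x)) = g.app (p + q) (A.mul u (ι.app q x)))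
    {p : ℕ} (u : A.obj p) : f.app p u = g.app p u := by
  induction u using hι.induction with
  | one => exact one
  | mul_ι u x hu => exact mul_ι u x hu
  | map e u hu => rw [f.app_map, g.app_map, hu]
  | zero p => rw [map_zero, map_zero]
  | add u v hu hv => rw [map_add, map_add, hu, hv]
  | smul c u hu => rw [map_smul, map_smul, hu]

theorem IsWord.image {ι : SMod.Hom M A.toSMod} {κ : SMod.Hom M B.toSMod} (f : TwAlg.Hom A B)
    (hf : ∀ p x, f.app p (ι.app p x) = κ.app p x) {n p : ℕ} {u : A.obj p} (hu : IsWord ι n u) :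
    IsWord κ n (f.app p u) := by
  induction hu with
  | one => rw [f.app_one]; exact .one
  | mul_ι x _ ih => rw [f.app_mul, hf]; exact .mul_ι x ih
  | map e _ ih => rw [f.app_map]; exact .map e ih

/-- Words in `A` and in `B` are built from the same `M` by the same operations, so a word lifts one
operation at a time, with its length. With `A` free, this lets words of `Sym` and of `U` be compared
through a common lift. -/
theorem IsWord.exists_lift {ι : SMod.Hom M A.toSMod} {κ : SMod.Hom M B.toSMod}
    (f : TwAlg.Hom A B) (hf : ∀ p x, f.app p (ι.app p x) = κ.app p x) {n p : ℕ} {u : B.obj p}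
    (hu : IsWord κ n u) : ∃ t, IsWord ι n t ∧ f.app p t = u := by
  induction hu with
  | one => exact ⟨_, .one, f.app_one⟩
  | mul_ι x _ ih =>
    obtain ⟨t, ht, rfl⟩ := ih
    exact ⟨_, .mul_ι x ht, by rw [f.app_mul, hf]⟩
  | map e _ ih =>
    obtain ⟨t, ht, rfl⟩ := ih
    exact ⟨_, .map e ht, f.app_map _ _⟩

theorem wordSpan_map {ι : SMod.Hom M A.toSMod} {κ : SMod.Hom M B.toSMod} (f : TwAlg.Hom A B)
    (hf : ∀ p x, f.app p (ι.app p x) = κ.app p x) (n p : ℕ) :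
    (wordSpan ι n p).map (f.app p) = wordSpan κ n p := by
  rw [wordSpan, Submodule.map_span]
  refine congrArg _ (Set.ext fun u => ⟨?_, fun hu => hu.exists_lift f hf⟩)
  rintro ⟨t, ht, rfl⟩
  exact ht.image f hf

theorem wordFilt_map {ι : SMod.Hom M A.toSMod} {κ : SMod.Hom M B.toSMod} (f : TwAlg.Hom A B)
    (hf : ∀ p x, f.app p (ι.app p x) = κ.app p x) {n p : ℕ} {u : A.obj p}
    (hu : u ∈ (wordFilt ι).F n p) : f.app p u ∈ (wordFilt κ).F n p := by
  have h : (wordFilt ι).F n p ≤ ((wordFilt κ).F n p).comap (f.app p) :=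
    Submodule.span_le.2 fun t ⟨j, hj, ht⟩ => Submodule.subset_span ⟨j, hj, ht.image f hf⟩
  exact h hu

theorem Generates.of_surjective {ι : SMod.Hom M A.toSMod} {κ : SMod.Hom M B.toSMod}
    (hι : Generates ι) (f : TwAlg.Hom A B) (hf : ∀ p x, f.app p (ι.app p x) = κ.app p x)
    (hs : ∀ p, Function.Surjective (f.app p)) : Generates κ := by
  intro p b
  obtain ⟨a, rfl⟩ := hs p b
  obtain ⟨n, hn⟩ := hι p a
  exact ⟨n, wordFilt_map f hf hn⟩

/-- A formal expression carries an evident bound on word length: the maximum for sums, the sum for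
products. -/
theorem FreeTw.generates (M : SMod.{u, v} k) : Generates (FreeTw.ι M) := by
  intro p a
  obtain ⟨a, rfl⟩ := Quot.exists_rep a
  induction a with
  | of x => exact ⟨1, ι_mem_wordFilt _ x⟩
  | one => exact ⟨0, (wordFilt _).one_mem⟩
  | zero => exact ⟨0, zero_mem _⟩
  | add a b ha hb =>
    obtain ⟨i, hi⟩ := ha
    obtain ⟨j, hj⟩ := hb
    exact ⟨max i j, add_mem (wordFilt_mono _ (le_max_left i j) _ hi)
      (wordFilt_mono _ (le_max_right i j) _ hj)⟩
  | smul c a ha =>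
    obtain ⟨i, hi⟩ := ha
    exact ⟨i, Submodule.smul_mem _ c hi⟩
  | map e a ha =>
    obtain ⟨i, hi⟩ := ha
    exact ⟨i, (wordFilt _).map_mem e hi⟩
  | mul a b ha hb =>
    obtain ⟨i, hi⟩ := ha
    obtain ⟨j, hj⟩ := hb
    exact ⟨i + j, (wordFilt _).mul_mem hi hj⟩

theorem SymS.generates (M : SMod.{u, v} k) : Generates (SymS.ι M) :=
  (FreeTw.generates M).of_surjective ((FreeTw M).quotMk _) (fun _ _ => rfl)
    fun _ => Submodule.mkQ_surjective _

theorem EnvS.generates (h : TwLie.{u, v} k) : Generates (EnvS.ι h) :=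
  (FreeTw.generates h.toSMod).of_surjective ((FreeTw h.toSMod).quotMk _) (fun _ _ => rfl)
    fun _ => Submodule.mkQ_surjective _

theorem SymS.mul_ι_comm (M : SMod.{u, v} k) {m n : ℕ} (x : M.obj m) (y : M.obj n) :
    (SymS M).mul ((SymS.ι M).app m x) ((SymS.ι M).app n y) =
      (SymS M).map (blockSwap n m) ((SymS M).mul ((SymS.ι M).app n y) ((SymS.ι M).app m x)) :=
  sub_eq_zero.1 (SymS.comm M x y)

end words

/-! ### Derivations -/

section sqZero

variable (A : TwAlg.{u, v} k) (G : SMod.{u, w} k)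

/-- The square-zero extension of `A` that classifies families of derivations of `A` indexed by
`G`. -/
def SqZero : TwAlg.{u, max v w} k where
  obj p := A.obj p × (∀ m, G.obj m →ₗ[k] A.obj (p + m))
  map {p q} e :=
    { toFun a := (A.map e a.1, fun m => A.map (blockSum e (Equiv.refl (Fin m))) ∘ₗ a.2 m)
      map_add' a b := Prod.ext (map_add _ _ _) (by ext m x; simp)
      map_smul' c a := Prod.ext (map_smul _ _ _) (by ext m x; simp) }
  map_refl a := Prod.ext (A.map_refl _) (by
    ext m x
    change A.map _ _ = _
    rw [blockSum_refl, A.map_refl])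
  map_trans e f a := Prod.ext (A.map_trans _ _ _) (by
    ext m x
    change A.map _ _ = A.map _ (A.map _ _)
    rw [← A.map_trans, blockSum_trans, Equiv.refl_trans])
  one := (A.one, 0)
  mul {p q} := LinearMap.mk₂ k
    -- The second component is the Leibniz rule. In the summand where `x` acts on `a`, its block
    -- stands before that of `b`, and `blockRight` moves it to the end.
    (fun a b => (A.mul a.1 b.1, fun m =>
      A.map (blockAssoc p q m).symm ∘ₗ A.mul a.1 ∘ₗ b.2 m +
        A.map (blockRight p m q) ∘ₗ A.mul.flip b.1 ∘ₗ a.2 m))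
    (fun a a' b => Prod.ext (by simp) (by ext m x; simp; abel))
    (fun c a b => Prod.ext (by simp) (by ext m x; simp))
    (fun a b b' => Prod.ext (by simp) (by ext m x; simp; abel))
    (fun c a b => Prod.ext (by simp) (by ext m x; simp))
  mul_map e f a b := Prod.ext (A.mul_map _ _ _ _) (by
    ext m x
    simp only [LinearMap.mk₂_apply, LinearMap.coe_mk, AddHom.coe_mk, LinearMap.add_apply,
      LinearMap.comp_apply, LinearMap.flip_apply, map_add, A.mul_map, ← A.map_trans]
    congr 3 <;> simp only [block_ext, block_apply, implies_true, and_self])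
  mul_assoc a b c := Prod.ext (A.mul_assoc _ _ _) (by
    ext m x
    simp only [LinearMap.mk₂_apply, LinearMap.coe_mk, AddHom.coe_mk, LinearMap.add_apply,
      LinearMap.comp_apply, LinearMap.flip_apply, map_add, A.mul_map_left, A.mul_map_right,
      A.mul_mul_eq, ← A.map_trans, add_assoc]
    refine congrArg₂ (· + ·) ?_ (congrArg₂ (· + ·) ?_ ?_) <;> congr 2 <;>
      simp only [block_ext, block_apply, implies_true, and_self])
  one_mul a := Prod.ext (A.one_mul _) (by
    ext m x
    simp only [LinearMap.mk₂_apply, LinearMap.coe_mk, AddHom.coe_mk, LinearMap.add_apply,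
      LinearMap.comp_apply, LinearMap.flip_apply, Pi.zero_apply, LinearMap.zero_apply, map_zero,
      add_zero, A.one_mul_eq, ← A.map_trans]
    refine Eq.trans ?_ (A.map_refl _)
    congr 2
    simp only [block_ext, block_apply, implies_true, and_self])
  mul_one a := Prod.ext (A.mul_one _) (by
    ext m x
    simp only [LinearMap.mk₂_apply, LinearMap.coe_mk, AddHom.coe_mk, LinearMap.add_apply,
      LinearMap.comp_apply, LinearMap.flip_apply, Pi.zero_apply, LinearMap.zero_apply, map_zero,
      zero_add, A.mul_one_eq, ← A.map_trans]
    refine Eq.trans ?_ (A.map_refl _)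
    congr 2
    simp only [block_ext, block_apply, implies_true, and_self])

/-- The projection of the square-zero extension. -/
def SqZero.fst : TwAlg.Hom (SqZero A G) A where
  app _ := LinearMap.fst k _ _
  app_map _ _ := rfl
  app_one := rfl
  app_mul _ _ := rfl

end sqZero

/-! ### Extension of an action on generators to derivations of the symmetric algebra -/

namespace SymS

variable {M : SMod.{u, v} k} {G : SMod.{u, w} k} (ρ : RAct M G)

/-- The morphism to the square-zero extension that extends an action on the generators. -/
def derivHom : TwAlg.Hom (SymS M) (SqZero (SymS M) G) :=
  SymS.lift
    { app p :=
        { toFun z := ((SymS.ι M).app p z, fun m => (SymS.ι M).app (p + m) ∘ₗ ρ.op z)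
          map_add' y z := Prod.ext (map_add _ _ _) (by
            ext m x
            exact congrArg ((SymS.ι M).app _) (LinearMap.map_add₂ ρ.op y z x) |>.trans
              (map_add _ _ _))
          map_smul' c z := Prod.ext (map_smul _ _ _) (by
            ext m x
            exact congrArg ((SymS.ι M).app _) (LinearMap.map_smul₂ ρ.op c z x) |>.trans
              (map_smul _ _ _)) }
      app_map e z := Prod.ext ((SymS.ι M).app_map e z) (by
        ext m x
        change (SymS.ι M).app _ (ρ.op (M.map e z) x) =
          (SymS M).map _ ((SymS.ι M).app _ (ρ.op z x))
        rw [ρ.op_map_left, (SymS.ι M).app_map]) }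
    fun {p q} y z => Prod.ext (SymS.comm M y z) (by
      ext m x
      change (SymS M).map (blockAssoc p q m).symm
            ((SymS M).mul ((SymS.ι M).app p y) ((SymS.ι M).app _ (ρ.op z x))) +
          (SymS M).map (blockRight p m q)
            ((SymS M).mul ((SymS.ι M).app _ (ρ.op y x)) ((SymS.ι M).app q z)) -
        (SymS M).map (blockSum (blockSwap q p) (Equiv.refl (Fin m)))
          ((SymS M).map (blockAssoc q p m).symm
            ((SymS M).mul ((SymS.ι M).app q z) ((SymS.ι M).app _ (ρ.op y x))) +
          (SymS M).map (blockRight q m p)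
            ((SymS M).mul ((SymS.ι M).app _ (ρ.op z x)) ((SymS.ι M).app p y))) = 0
      -- Commutativity of `Sym` turns the two Leibniz summands of `y z` into those of `z y`, in the
      -- opposite order.
      rw [SymS.mul_ι_comm M y, SymS.mul_ι_comm M (ρ.op y x), sub_eq_zero]
      refine (add_comm _ _).trans ?_
      simp only [map_add, ← (SymS M).map_trans]
      congr 3 <;> simp only [block_ext, block_apply, implies_true, and_self])

/-- Both sides are compatible with multiplication by generators. So `derivHom` is a section of the
projection, which is what makes its second component a derivation of `Sym` itself. -/
theorem derivHom_fst {p : ℕ} (s : (SymS M).obj p) : ((derivHom ρ).app p s).1 = s := by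
  refine (SymS.generates M).hom_ext (f := (SqZero.fst _ _).toHom.comp (derivHom ρ).toHom)
    (g := ⟨fun _ => LinearMap.id, fun _ _ => rfl⟩) rfl ?_ s
  intro p q s z hs
  change (SqZero.fst (SymS M) G).app (p + q) ((derivHom ρ).app (p + q)
    ((SymS M).mul s ((SymS.ι M).app q z))) = (SymS M).mul s ((SymS.ι M).app q z)
  rw [(derivHom ρ).app_mul, (SqZero.fst (SymS M) G).app_mul]
  exact congrArg (fun t => (SymS M).mul t ((SymS.ι M).app q z)) hs

theorem derivHom_mul_ι {p q m : ℕ} (s : (SymS M).obj p) (z : M.obj q) (x : G.obj m) :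
    ((derivHom ρ).app _ ((SymS M).mul s ((SymS.ι M).app q z))).2 m x =
      (SymS M).map (blockAssoc p q m).symm ((SymS M).mul s ((SymS.ι M).app _ (ρ.op z x))) +
        (SymS M).map (blockRight p m q)
          ((SymS M).mul (((derivHom ρ).app p s).2 m x) ((SymS.ι M).app q z)) := by
  rw [(derivHom ρ).app_mul]
  refine Eq.trans ?_ (congrArg (fun t => (SymS M).map (blockAssoc p q m).symm
    ((SymS M).mul t ((SymS.ι M).app _ (ρ.op z x))) + (SymS M).map (blockRight p m q)
      ((SymS M).mul (((derivHom ρ).app p s).2 m x) ((SymS.ι M).app q z))) (derivHom_fst ρ s))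
  rfl

/-- The second components in `SqZero` are arbitrary linear maps on each `G_m`; their equivariance in
`G` is inherited from `ρ` by induction over words. -/
theorem derivHom_map {p m m' : ℕ} (f : Fin m ≃ Fin m') (s : (SymS M).obj p) (x : G.obj m) :
    ((derivHom ρ).app p s).2 m' (G.map f x) =
    (SymS M).map (blockSum (Equiv.refl _) f) (((derivHom ρ).app p s).2 m x) := by
  induction s using (SymS.generates M).induction with
  | one =>
    rw [(derivHom ρ).app_one]
    exact (map_zero _).symm
  | mul_ι s z hs =>
    rw [derivHom_mul_ι, derivHom_mul_ι, hs, ρ.op_map_right, (SymS.ι M).app_map]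
    simp only [map_add, TwAlg.mul_map_left, TwAlg.mul_map_right, ← (SymS M).map_trans]
    congr 3 <;> simp only [block_ext, block_apply, implies_true, and_self]
  | map e s hs =>
    rw [(derivHom ρ).app_map]
    change (SymS M).map _ (((derivHom ρ).app _ s).2 m' (G.map f x)) =
      (SymS M).map _ ((SymS M).map _ (((derivHom ρ).app _ s).2 m x))
    rw [hs, ← (SymS M).map_trans, ← (SymS M).map_trans, blockSum_trans, blockSum_trans]
    rfl
  | zero p =>
    rw [map_zero]
    exact (map_zero _).symm
  | add s t hs ht =>
    rw [map_add]
    exact (congrArg₂ _ hs ht).trans (map_add _ _ _).symm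
  | smul c s hs =>
    rw [map_smul]
    exact (congrArg (fun t => c • t) hs).trans (map_smul _ c _).symm

/-- The extension of an action on `M` to an action on `Sym_𝕊 M` by derivations. -/
def deriv : RAct (SymS M).toSMod G where
  op {p m} := LinearMap.proj (R := k) (φ := fun m => G.obj m →ₗ[k] (SymS M).obj (p + m)) m ∘ₗ
    LinearMap.snd k _ _ ∘ₗ (derivHom ρ).app p
  op_map {p p' m m'} e f s x := by
    change ((derivHom ρ).app p' ((SymS M).map e s)).2 m' (G.map f x) =
      (SymS M).map _ (((derivHom ρ).app p s).2 m x)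
    rw [(derivHom ρ).app_map]
    change (SymS M).map _ (((derivHom ρ).app p s).2 m' (G.map f x)) = _
    rw [derivHom_map, ← (SymS M).map_trans, blockSum_trans]
    rfl

theorem deriv_one {m : ℕ} (x : G.obj m) : (deriv ρ).op (SymS M).one x = 0 := by
  change ((derivHom ρ).app 0 (SymS M).one).2 m x = 0
  rw [(derivHom ρ).app_one]
  rfl

theorem deriv_mul_ι {p q m : ℕ} (s : (SymS M).obj p) (z : M.obj q) (x : G.obj m) :
    (deriv ρ).op ((SymS M).mul s ((SymS.ι M).app q z)) x =
      (SymS M).map (blockAssoc p q m).symm ((SymS M).mul s ((SymS.ι M).app _ (ρ.op z x))) +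
        (SymS M).map (blockRight p m q)
          ((SymS M).mul ((deriv ρ).op s x) ((SymS.ι M).app q z)) :=
  derivHom_mul_ι ρ s z x

end SymS

/-! ### Actions of pre-Lie algebras -/

/-- The right action of a twisted pre-Lie algebra on itself. -/
def TwPreLie.act (g : TwPreLie.{u, v} k) : RAct g.toSMod g.toSMod := ⟨g.op, g.op_map⟩

section preLie

variable (g : TwPreLie.{u, v} k)

/-- Applying the Leibniz rule twice shows that the associator at `s z` is `s` times the associator
at `z`, plus the associator at `s` times `z`, plus the mixed terms `(s ∘ x) (z ∘ y)` and `(s ∘ y) (z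
∘ x)`. The mixed terms together are symmetric in `x` and `y`. -/
theorem SymS.deriv_deriv_mul_ι {p q m n : ℕ} (s : (SymS g.toSMod).obj p) (z : g.obj q)
    (x : g.obj m) (y : g.obj n) :
    (SymS g.toSMod).map (blockAssoc (p + q) m n) ((SymS.deriv g.act).op ((SymS.deriv g.act).op
        ((SymS g.toSMod).mul s ((SymS.ι g.toSMod).app q z)) x) y) -
      (SymS.deriv g.act).op ((SymS g.toSMod).mul s ((SymS.ι g.toSMod).app q z)) (g.op x y) =
    (SymS g.toSMod).map (blockAssoc p q (m + n)).symm ((SymS g.toSMod).mul s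
        ((SymS.ι g.toSMod).app _
          (g.map (blockAssoc q m n) (g.op (g.op z x) y) - g.op z (g.op x y)))) +
      (SymS g.toSMod).map (blockRight p (m + n) q) ((SymS g.toSMod).mul
        ((SymS g.toSMod).map (blockAssoc p m n)
            ((SymS.deriv g.act).op ((SymS.deriv g.act).op s x) y) -
          (SymS.deriv g.act).op s (g.op x y)) ((SymS.ι g.toSMod).app q z)) +
      ((SymS g.toSMod).map (blockMid p m q n)
          ((SymS g.toSMod).mul ((SymS.deriv g.act).op s x)
            ((SymS.ι g.toSMod).app _ (g.op z y))) +
        (SymS g.toSMod).map (blockSum (Equiv.refl _) (blockSwap n m))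
          ((SymS g.toSMod).map (blockMid p n q m)
            ((SymS g.toSMod).mul ((SymS.deriv g.act).op s y)
              ((SymS.ι g.toSMod).app _ (g.op z x))))) := by
  simp only [SymS.deriv_mul_ι, map_add, LinearMap.add_apply, RAct.op_map_left, map_sub,
    LinearMap.sub_apply, (SymS.ι g.toSMod).app_map, TwAlg.mul_map_left, TwAlg.mul_map_right,
    ← (SymS g.toSMod).map_trans]
  have hop : ∀ {a b : ℕ} (c : g.obj a) (d : g.obj b), g.act.op c d = g.op c d := fun _ _ => rfl
  simp only [hop]
  -- The summands are, in order, `s ((z ∘ x) ∘ y)`, `(s ∘ y) (z ∘ x)`, `(s ∘ x) (z ∘ y)`, `((s ∘ x)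
  -- ∘ y) z`, and then `s (z ∘ (x ∘ y))`, `(s ∘ (x ∘ y)) z` from the subtracted term.
  have key : ∀ {X : Type (max u v)} [AddCommGroup X] {a₁ a₂ a₃ a₄ a₅ a₆ b₁ b₂ b₃ b₄ b₅ b₆ : X},
      a₁ = b₁ → a₂ = b₂ → a₃ = b₃ → a₄ = b₄ → a₅ = b₅ → a₆ = b₆ →
      a₁ + a₂ + (a₃ + a₄) - (a₅ + a₆) = b₁ - b₅ + (b₄ - b₆) + (b₃ + b₂) := by
    rintro X _ _ _ _ _ _ _ _ _ _ _ _ _ rfl rfl rfl rfl rfl rfl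
    abel
  refine key ?_ ?_ ?_ ?_ ?_ ?_
  all_goals
    first
      | rfl
      | congr 2
        simp only [block_ext, block_apply, implies_true, and_self]

/-- The pre-Lie identity passes from `g` to `Sym g` by induction over words. Both associators vanish
at `1`; at `s z`, the identity in `g` handles the term with the associator at `z`, the induction
hypothesis the one with the associator at `s`, and the mixed terms are exchanged. -/
theorem SymS.deriv_preLie {p m n : ℕ} (s : (SymS g.toSMod).obj p) (x : g.obj m) (y : g.obj n) :
    (SymS g.toSMod).map (blockAssoc p m n)
        ((SymS.deriv g.act).op ((SymS.deriv g.act).op s x) y) -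
      (SymS.deriv g.act).op s (g.op x y) =
    (SymS g.toSMod).map (blockSum (Equiv.refl _) (blockSwap n m))
      ((SymS g.toSMod).map (blockAssoc p n m)
          ((SymS.deriv g.act).op ((SymS.deriv g.act).op s y) x) -
        (SymS.deriv g.act).op s (g.op y x)) := by
  induction s using (SymS.generates g.toSMod).induction with
  | one => simp only [SymS.deriv_one, map_zero, LinearMap.zero_apply, sub_zero]
  | mul_ι s z hs =>
    have swap : ∀ {q : ℕ} (t : (SymS g.toSMod).obj (q + (m + n))),
        (SymS g.toSMod).map (blockSum (Equiv.refl (Fin q)) (blockSwap n m))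
          ((SymS g.toSMod).map (blockSum (Equiv.refl (Fin q)) (blockSwap m n)) t) = t := by
      intro q t
      rw [← (SymS g.toSMod).map_trans, blockSum_trans, blockSwap_swap, Equiv.refl_trans,
        blockSum_refl, (SymS g.toSMod).map_refl]
    rw [SymS.deriv_deriv_mul_ι, SymS.deriv_deriv_mul_ι, g.preLie, hs]
    simp only [map_add, swap]
    refine congrArg₂ (· + ·) (congrArg₂ (· + ·) ?_ ?_) (add_comm _ _)
    · rw [(SymS.ι g.toSMod).app_map, TwAlg.mul_map_right, ← (SymS g.toSMod).map_trans,
        ← (SymS g.toSMod).map_trans]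
      congr 2
      simp only [block_ext, block_apply, implies_true, and_self]
    · rw [TwAlg.mul_map_left, ← (SymS g.toSMod).map_trans, ← (SymS g.toSMod).map_trans]
      congr 2
      simp only [block_ext, block_apply, implies_true, and_self]
  | map e s hs =>
    simp only [RAct.op_map_left, ← (SymS g.toSMod).map_trans]
    have h := congrArg ((SymS g.toSMod).map (blockSum e (Equiv.refl (Fin (m + n))))) hs
    simp only [map_sub, ← (SymS g.toSMod).map_trans] at h ⊢
    have key : ∀ {X : Type (max u v)} [AddCommGroup X] {a₁ a₂ a₃ a₄ b₁ b₂ b₃ b₄ : X},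
        a₁ - a₂ = a₃ - a₄ → b₁ = a₁ → b₂ = a₂ → b₃ = a₃ → b₄ = a₄ → b₁ - b₂ = b₃ - b₄ := by
      rintro X _ _ _ _ _ _ _ _ _ h rfl rfl rfl rfl
      exact h
    refine key h ?_ ?_ ?_ ?_
    all_goals
      first
        | rfl
        | congr 2
          simp only [block_ext, block_apply, implies_true, and_self]
  | zero p => simp only [map_zero, LinearMap.zero_apply, sub_zero]
  | add s t hs ht =>
    have h := congrArg₂ (· + ·) hs ht
    simp only [map_add, map_sub, LinearMap.add_apply] at h ⊢
    linear_combination (norm := abel) h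
  | smul c s hs =>
    have h := congrArg (c • ·) hs
    simp only [map_smul, map_sub, LinearMap.smul_apply, smul_sub] at h ⊢
    exact h

/-- The right action `s · x + s ∘ x` of a twisted pre-Lie algebra on its symmetric algebra. -/
def SymS.envAct : RAct (SymS g.toSMod).toSMod g.toSMod :=
  (RAct.ofHom (SymS.ι g.toSMod)).add (SymS.deriv g.act)

theorem SymS.envAct_op {p m : ℕ} (s : (SymS g.toSMod).obj p) (x : g.obj m) :
    (SymS.envAct g).op s x =
      (SymS g.toSMod).mul s ((SymS.ι g.toSMod).app m x) + (SymS.deriv g.act).op s x := rfl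

/-- Expanding `(s · x) · y` gives `s x y + (s ∘ x) y + (s ∘ y) x + s (x ∘ y) + (s ∘ x) ∘ y`. On
antisymmetrizing, the first term drops out by commutativity and the next two because their sum is
symmetric. The fourth leaves `s {x, y}`, and the last leaves `s ∘ {x, y}` by `SymS.deriv_preLie`. -/
theorem SymS.envAct_isLie : RAct.IsLie (h := g.toTwLie) (SymS.envAct g) := by
  have key : ∀ {p m n : ℕ} (s : (SymS g.toSMod).obj p) (x : g.obj m) (y : g.obj n),
      (SymS g.toSMod).map (blockAssoc p m n) ((SymS.envAct g).op ((SymS.envAct g).op s x) y) -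
        (SymS g.toSMod).map (blockSum (Equiv.refl _) (blockSwap n m))
          ((SymS g.toSMod).map (blockAssoc p n m)
            ((SymS.envAct g).op ((SymS.envAct g).op s y) x)) =
        (SymS.envAct g).op s (g.op x y - g.map (blockSwap n m) (g.op y x)) := by
    intro p m n s x y
    have h₁ := SymS.deriv_preLie g s x y
    have h₂ := congrArg ((SymS g.toSMod).mul s) (SymS.mul_ι_comm g.toSMod x y)
    have hop : ∀ {a b : ℕ} (c : g.obj a) (d : g.obj b), g.act.op c d = g.op c d :=
      fun _ _ => rfl
    simp only [SymS.envAct_op, map_add, map_sub, LinearMap.add_apply, SymS.deriv_mul_ι, hop,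
      RAct.op_map_right, (SymS.ι g.toSMod).app_map, TwAlg.mul_map_right, TwAlg.mul_mul_eq,
      ← (SymS g.toSMod).map_trans] at h₁ h₂ ⊢
    -- `e₁` and `e₂` match the permutations in front of the mixed terms `(s ∘ y) x` and `(s ∘ x) y`,
    -- which then cancel.
    have e₁ : (blockRight p n m).trans (blockAssoc p m n) =
        (blockAssoc p n m).trans (blockSum (Equiv.refl (Fin p)) (blockSwap n m)) := by
      simp only [block_ext, block_apply, implies_true, and_self]
    have e₂ : ((blockRight p m n).trans (blockAssoc p n m)).trans
        (blockSum (Equiv.refl (Fin p)) (blockSwap n m)) = blockAssoc p m n := by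
      simp only [block_ext, block_apply, implies_true, and_self]
    rw [e₁, e₂, Equiv.symm_trans_self, Equiv.symm_trans_self, Equiv.refl_trans,
      (SymS g.toSMod).map_refl]
    linear_combination (norm := abel) h₁ + h₂
  intro p m n s x y
  exact key s x y

end preLie

/-! ### Actions on tensor products -/

namespace RAct

variable {M : SMod.{u, v} k} {N : SMod.{u, w} k} {G : SMod.{u, v'} k}

/-- The operation `(a ⊗ b) x = a x ⊗ b + a ⊗ b x` on a tensor product. -/
def tensOp (ρ : RAct M G) (σ : RAct N G) (p m : ℕ) :
    TensObj M N p →ₗ[k] G.obj m →ₗ[k] TensObj M N (p + m) :=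
  Tens.lift (fun a b e => LinearMap.mk₂ k
      (fun s t => (Tens.mk ((blockRight a m b).trans (blockSum e (Equiv.refl _)))).flip t ∘ₗ
          ρ.op s +
        Tens.mk ((blockAssoc a b m).symm.trans (blockSum e (Equiv.refl _))) s ∘ₗ σ.op t)
      (fun s s' t => by ext x; simp; abel)
      (fun c s t => by ext x; simp)
      (fun s t t' => by ext x; simp; abel)
      (fun c s t => by ext x; simp)) (by
    intro a a' b b' e f h s t
    ext x
    simp only [LinearMap.mk₂_apply, LinearMap.add_apply, LinearMap.comp_apply,
      LinearMap.flip_apply, ρ.op_map_left, σ.op_map_left, Tens.mk_map]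
    congr 4 <;> simp only [block_ext, block_apply, implies_true, and_self])

theorem tensOp_mk (ρ : RAct M G) (σ : RAct N G) {a b p m : ℕ} (e : Fin (a + b) ≃ Fin p)
    (s : M.obj a) (t : N.obj b) (x : G.obj m) :
    tensOp ρ σ p m (Tens.mk e s t) x =
      Tens.mk ((blockRight a m b).trans (blockSum e (Equiv.refl _))) (ρ.op s x) t +
        Tens.mk ((blockAssoc a b m).symm.trans (blockSum e (Equiv.refl _))) s (σ.op t x) := by
  rw [tensOp, Tens.lift_mk]
  rfl

theorem tensOp_map_left (ρ : RAct M G) (σ : RAct N G) {p p' m : ℕ} (e : Fin p ≃ Fin p')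
    (z : TensObj M N p) (x : G.obj m) : tensOp ρ σ p' m (Tens.map e z) x =
      Tens.map (blockSum e (Equiv.refl _)) (tensOp ρ σ p m z x) := by
  induction z using Tens.induction with
  | zero => simp only [map_zero, LinearMap.zero_apply]
  | add a b ha hb => simp only [map_add, LinearMap.add_apply, ha, hb]
  | mk h s t =>
    simp only [Tens.map_mk, tensOp_mk, map_add]
    congr 4 <;> simp only [block_ext, block_apply, implies_true, and_self]

theorem tensOp_add (ρ ρ' : RAct M G) (σ σ' : RAct N G) {p m : ℕ} (z : TensObj M N p)
    (x : G.obj m) : tensOp (ρ.add ρ') (σ.add σ') p m z x =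
      tensOp ρ σ p m z x + tensOp ρ' σ' p m z x := by
  induction z using Tens.induction with
  | zero => simp only [map_zero, LinearMap.zero_apply, add_zero]
  | add a b ha hb =>
    simp only [map_add, LinearMap.add_apply, ha, hb]
    abel
  | mk e s t =>
    simp only [tensOp_mk, add_op, map_add, LinearMap.add_apply]
    abel

/-- Morphisms intertwining actions intertwine the actions on tensor products. -/
theorem mapLin_tensOp {M' : SMod.{u, w'} k} {ρ : RAct M G} {ρ' : RAct M' G} (φ : SMod.Hom M M')
    (hφ : ∀ {p m : ℕ} (s : M.obj p) (x : G.obj m),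
      φ.app (p + m) (ρ.op s x) = ρ'.op (φ.app p s) x)
    {p m : ℕ} (z : TensObj M M p) (x : G.obj m) :
    Tens.mapLin φ φ (p + m) (tensOp ρ ρ p m z x) =
      tensOp ρ' ρ' p m (Tens.mapLin φ φ p z) x := by
  induction z using Tens.induction with
  | zero => simp only [map_zero, LinearMap.zero_apply]
  | add a b ha hb => simp only [map_add, LinearMap.add_apply, ha, hb]
  | mk e s t => simp only [tensOp_mk, map_add, Tens.mapLin_mk, hφ]

/-- Right multiplication by `1 ⊗ f x + f x ⊗ 1` in `A ⊗ A`. -/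
theorem tensMul_prim {A : TwAlg.{u, v} k} (f : SMod.Hom G A.toSMod) {p m : ℕ}
    (z : TensObj A.toSMod A.toSMod p) (x : G.obj m) :
    tensMul A A p m z (A.prim.app m (f.app m x)) = tensOp (ofHom f) (ofHom f) p m z x := by
  rw [TwAlg.prim_apply]
  induction z using Tens.induction with
  | zero => simp only [map_zero, LinearMap.zero_apply]
  | add a b ha hb =>
    rw [LinearMap.map_add₂, LinearMap.map_add₂, ha, hb]
  | mk e s t =>
    rw [tensOp_mk, map_add, tensMul_mk, tensMul_mk, A.mul_one_eq, A.mul_one_eq,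
      Tens.mk_map_left, Tens.mk_map_right]
    refine (add_comm _ _).trans ?_
    refine congrArg₂ (· + ·) ?_ ?_ <;> congr 3 <;>
      simp only [block_ext, block_apply, implies_true, and_self]

/-- The commutation rule satisfied by derivations and right multiplications. -/
def IsLeibniz {H : SMod.{u, w'} k} (ρ : RAct M G) (σ : RAct M H) (α : RAct H G) : Prop :=
  ∀ {p q m : ℕ} (s : M.obj p) (z : H.obj q) (x : G.obj m),
    ρ.op (σ.op s z) x = M.map (blockAssoc p q m).symm (σ.op s (α.op z x)) +
      M.map (blockRight p m q) (σ.op (ρ.op s x) z)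

/-- On `s ⊗ t`, the operations of `x` and `y` on the same factor commute up to the `α`-term by
hypothesis, and on different factors they commute exactly. -/
theorem IsLeibniz.tensOp {H : SMod.{u, w'} k} {ρ : RAct M G} {σ : RAct M H} {α : RAct H G}
    (h : ρ.IsLeibniz σ α) {p q m : ℕ} (z : TensObj M M p) (y : H.obj q) (x : G.obj m) :
    RAct.tensOp ρ ρ _ m (RAct.tensOp σ σ p q z y) x =
      Tens.map (blockAssoc p q m).symm (RAct.tensOp σ σ p _ z (α.op y x)) +
        Tens.map (blockRight p m q) (RAct.tensOp σ σ _ q (RAct.tensOp ρ ρ p m z x) y) := by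
  induction z using Tens.induction with
  | zero => simp only [map_zero, LinearMap.zero_apply, add_zero]
  | add a b ha hb =>
    simp only [map_add, LinearMap.add_apply, ha, hb]
    abel
  | mk e s t =>
    simp only [tensOp_mk, map_add, LinearMap.add_apply, h _ _ _, Tens.map_mk, Tens.mk_map_left,
      Tens.mk_map_right]
    -- The third and fourth summands are those where `x` and `y` act on different factors; the other
    -- four come from the hypothesis applied to `s` and to `t`.
    have key : ∀ {X : Type v} [AddCommGroup X] {a₁ a₂ a₃ a₄ a₅ a₆ b₁ b₂ b₃ b₄ b₅ b₆ : X},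
        a₁ = b₁ → a₂ = b₂ → a₃ = b₃ → a₄ = b₄ → a₅ = b₅ → a₆ = b₆ →
        a₁ + a₂ + a₃ + (a₄ + (a₅ + a₆)) = b₁ + b₅ + (b₂ + b₄ + (b₃ + b₆)) := by
      rintro X _ _ _ _ _ _ _ _ _ _ _ _ _ rfl rfl rfl rfl rfl rfl
      abel
    refine key ?_ ?_ ?_ ?_ ?_ ?_ <;> congr 3 <;>
      simp only [block_ext, block_apply, implies_true, and_self]

end RAct

/-! ### Coproducts and counits on products and derivatives -/

section coproduct

/-- The linear maps underlying a morphism to a tensor square. -/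
def TwAlg.Hom.toTens {A : TwAlg.{u, v} k} {B : TwAlg.{u, w} k} (f : TwAlg.Hom A (B.tens B))
    (p : ℕ) : A.obj p →ₗ[k] TensObj B.toSMod B.toSMod p := f.app p

theorem TwAlg.Hom.toTens_map {A : TwAlg.{u, v} k} {B : TwAlg.{u, w} k}
    (f : TwAlg.Hom A (B.tens B)) {p q : ℕ} (e : Fin p ≃ Fin q) (a : A.obj p) :
    f.toTens q (A.map e a) = Tens.map e (f.toTens p a) := f.app_map e a

theorem TwAlg.Hom.toTens_one {A : TwAlg.{u, v} k} {B : TwAlg.{u, w} k}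
    (f : TwAlg.Hom A (B.tens B)) :
    f.toTens 0 A.one = Tens.mk (Equiv.refl (Fin (0 + 0))) B.one B.one := f.app_one

/-- `Δ` is multiplicative and `x` is primitive. In terms of `tensOp`, `Δ` intertwines right
multiplication by generators with the induced operation on the tensor square. -/
theorem SymS.comul_mul_ι {M : SMod.{u, v} k} {p q : ℕ} (s : (SymS M).obj p) (x : M.obj q) :
    (SymS.comul M).toTens (p + q) ((SymS M).mul s ((SymS.ι M).app q x)) =
      RAct.tensOp (RAct.ofHom (SymS.ι M)) (RAct.ofHom (SymS.ι M)) p q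
        ((SymS.comul M).toTens p s) x :=
  ((SymS.comul M).app_mul _ _).trans (RAct.tensMul_prim (SymS.ι M) _ x)

theorem EnvS.comul_mul_ι {h : TwLie.{u, v} k} {p q : ℕ} (s : (EnvS h).obj p) (x : h.obj q) :
    (EnvS.comul h).toTens (p + q) ((EnvS h).mul s ((EnvS.ι h).app q x)) =
      RAct.tensOp (RAct.ofHom (EnvS.ι h)) (RAct.ofHom (EnvS.ι h)) p q
        ((EnvS.comul h).toTens p s) x :=
  ((EnvS.comul h).app_mul _ _).trans (RAct.tensMul_prim (EnvS.ι h) _ x)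

/-- The derivations of `Sym_𝕊 M` that extend an action on `M` are coderivations. -/
theorem SymS.comul_deriv {M : SMod.{u, v} k} {G : SMod.{u, w} k} (ρ : RAct M G) {p m : ℕ}
    (s : (SymS M).obj p) (x : G.obj m) :
    (SymS.comul M).toTens (p + m) ((SymS.deriv ρ).op s x) =
      RAct.tensOp (SymS.deriv ρ) (SymS.deriv ρ) p m ((SymS.comul M).toTens p s) x := by
  -- On the tensor square the Leibniz rule persists by `IsLeibniz.tensOp`, so both sides obey the
  -- same recursion on words.
  have h : (SymS.deriv ρ).IsLeibniz (RAct.ofHom (SymS.ι M)) ρ :=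
    fun s z x => SymS.deriv_mul_ι ρ s z x
  induction s using (SymS.generates M).induction with
  | one =>
    rw [SymS.deriv_one, map_zero, TwAlg.Hom.toTens_one, RAct.tensOp_mk]
    simp only [SymS.deriv_one, map_zero, LinearMap.zero_apply, add_zero]
  | mul_ι s z hs =>
    rw [SymS.deriv_mul_ι, map_add, TwAlg.Hom.toTens_map, TwAlg.Hom.toTens_map,
      SymS.comul_mul_ι, SymS.comul_mul_ι, SymS.comul_mul_ι, hs, h.tensOp]
  | map e s hs =>
    rw [RAct.op_map_left, TwAlg.Hom.toTens_map, hs, TwAlg.Hom.toTens_map, RAct.tensOp_map_left]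
  | zero p => simp only [map_zero, LinearMap.zero_apply]
  | add s t hs ht => simp only [map_add, LinearMap.add_apply, hs, ht]
  | smul c s hs => simp only [map_smul, LinearMap.smul_apply, hs]

theorem SymS.counit_mul_ι {M : SMod.{u, v} k} {p q : ℕ} (s : (SymS M).obj p) (x : M.obj q) :
    (SymS.counit M).app (p + q) ((SymS M).mul s ((SymS.ι M).app q x)) = 0 := by
  rw [(SymS.counit M).app_mul]
  exact map_zero _

theorem EnvS.counit_mul_ι {h : TwLie.{u, v} k} {p q : ℕ} (s : (EnvS h).obj p) (x : h.obj q) :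
    (EnvS.counit h).app (p + q) ((EnvS h).mul s ((EnvS.ι h).app q x)) = 0 := by
  rw [(EnvS.counit h).app_mul]
  exact map_zero _

/-- A derivation kills `1` and sends a product ending in a generator to a sum of permuted products
of the same form, on which the counit vanishes. -/
theorem SymS.counit_deriv {M : SMod.{u, v} k} {G : SMod.{u, w} k} (ρ : RAct M G) {p m : ℕ}
    (s : (SymS M).obj p) (x : G.obj m) :
    (SymS.counit M).app (p + m) ((SymS.deriv ρ).op s x) = 0 := by
  induction s using (SymS.generates M).induction with
  | one => rw [SymS.deriv_one, map_zero]
  | mul_ι s z hs =>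
    rw [SymS.deriv_mul_ι, map_add, (SymS.counit M).app_map, (SymS.counit M).app_map,
      SymS.counit_mul_ι, SymS.counit_mul_ι, map_zero, map_zero, add_zero]
  | map e s hs => rw [RAct.op_map_left, (SymS.counit M).app_map, hs, map_zero]
  | zero p => simp only [map_zero, LinearMap.zero_apply]
  | add s t hs ht => simp only [map_add, LinearMap.add_apply, hs, ht, add_zero]
  | smul c s hs => simp only [map_smul, LinearMap.smul_apply, hs, smul_zero]

end coproduct

/-! ### The comparison map -/

section comparison

variable (g : TwPreLie.{u, v} k)

/-- The comparison map `U_𝕊 g → Sym_𝕊 g`, `u ↦ 1 · u`. -/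
def EnvS.toSym : SMod.Hom (EnvS g.toTwLie).toSMod (SymS g.toSMod).toSMod :=
  RAct.orbit (h := g.toTwLie) (SymS.envAct g) (SymS.envAct_isLie g) (SymS g.toSMod).one

theorem EnvS.toSym_one :
    (EnvS.toSym g).app 0 (EnvS g.toTwLie).one = (SymS g.toSMod).one :=
  RAct.orbit_one (h := g.toTwLie) _ _ _

theorem EnvS.toSym_mul_ι {p m : ℕ} (u : (EnvS g.toTwLie).obj p) (x : g.obj m) :
    (EnvS.toSym g).app (p + m) ((EnvS g.toTwLie).mul u ((EnvS.ι g.toTwLie).app m x)) =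
      (SymS.envAct g).op ((EnvS.toSym g).app p u) x :=
  RAct.orbit_mul_ι (h := g.toTwLie) _ _ _ u x

/-- Both summands of `envAct` are compatible with `Δ`, and `tensOp` is additive in the pair of
actions. -/
theorem SymS.comul_envAct {p m : ℕ} (s : (SymS g.toSMod).obj p) (x : g.obj m) :
    (SymS.comul g.toSMod).toTens (p + m) ((SymS.envAct g).op s x) =
      RAct.tensOp (SymS.envAct g) (SymS.envAct g) p m ((SymS.comul g.toSMod).toTens p s) x := by
  rw [SymS.envAct_op, map_add, SymS.comul_mul_ι, SymS.comul_deriv, ← RAct.tensOp_add]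
  rfl

/-- `toSym` turns right multiplication by `x` into `envAct`, and the coproducts carry each of these
to its `tensOp`. Hence both sides satisfy the same recursion on words, starting from `1 ⊗ 1`. -/
theorem EnvS.comul_toSym {p : ℕ} (u : (EnvS g.toTwLie).obj p) :
    (SymS.comul g.toSMod).toTens p ((EnvS.toSym g).app p u) =
      Tens.mapLin (EnvS.toSym g) (EnvS.toSym g) p ((EnvS.comul g.toTwLie).toTens p u) := by
  induction u using (EnvS.generates g.toTwLie).induction with
  | one =>
    rw [EnvS.toSym_one, TwAlg.Hom.toTens_one, TwAlg.Hom.toTens_one, Tens.mapLin_mk,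
      EnvS.toSym_one]
  | mul_ι u x hu =>
    refine (congrArg _ (EnvS.toSym_mul_ι g u x)).trans ((SymS.comul_envAct g _ x).trans ?_)
    rw [hu]
    rw [EnvS.comul_mul_ι]
    exact (RAct.mapLin_tensOp (ρ := RAct.ofHom (EnvS.ι g.toTwLie)) (ρ' := SymS.envAct g)
      (EnvS.toSym g) (fun u x => EnvS.toSym_mul_ι g u x) _ x).symm
  | map e u hu =>
    rw [(EnvS.toSym g).app_map, TwAlg.Hom.toTens_map, TwAlg.Hom.toTens_map, hu]
    exact ((Tens.mapHom (EnvS.toSym g) (EnvS.toSym g)).app_map e _).symm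
  | zero p => simp only [map_zero]
  | add s t hs ht => simp only [map_add, hs, ht]
  | smul c s hs => simp only [map_smul, hs]

/-- Both sides take `1` to `1` and vanish on every product that ends in a generator. -/
theorem EnvS.counit_toSym {p : ℕ} (u : (EnvS g.toTwLie).obj p) :
    (SymS.counit g.toSMod).app p ((EnvS.toSym g).app p u) =
      (EnvS.counit g.toTwLie).app p u := by
  refine (EnvS.generates g.toTwLie).hom_ext
    (f := (SymS.counit g.toSMod).toHom.comp (EnvS.toSym g))
    (g := (EnvS.counit g.toTwLie).toHom) ?_ ?_ u
  · change (SymS.counit g.toSMod).app 0 ((EnvS.toSym g).app 0 (EnvS g.toTwLie).one) =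
      (EnvS.counit g.toTwLie).app 0 (EnvS g.toTwLie).one
    rw [EnvS.toSym_one, (SymS.counit g.toSMod).app_one, (EnvS.counit g.toTwLie).app_one]
  · intro p q u (x : g.obj q) _
    change (SymS.counit g.toSMod).app (p + q) ((EnvS.toSym g).app (p + q)
        ((EnvS g.toTwLie).mul u ((EnvS.ι g.toTwLie).app q x))) =
      (EnvS.counit g.toTwLie).app (p + q) ((EnvS g.toTwLie).mul u ((EnvS.ι g.toTwLie).app q x))
    rw [EnvS.toSym_mul_ι, SymS.envAct_op, map_add, SymS.counit_mul_ι, SymS.counit_deriv, add_zero]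
    exact (EnvS.counit_mul_ι (h := g.toTwLie) u x).symm

end comparison

/-! ### The grading of the symmetric algebra -/

section grading

/-- The twisted algebra `R ⊗ A` for a commutative `k`-algebra `R`. -/
def TwAlg.extend (R : Type w) [CommRing R] [Algebra k R] (A : TwAlg.{u, v} k) :
    TwAlg.{u, max w v} k where
  obj p := R ⊗[k] A.obj p
  map e := (A.map e).lTensor R
  map_refl z := by
    induction z using TensorProduct.induction_on with
    | zero => rw [map_zero]
    | tmul r a => rw [LinearMap.lTensor_tmul, A.map_refl]
    | add a b ha hb => rw [map_add, ha, hb]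
  map_trans e f z := by
    induction z using TensorProduct.induction_on with
    | zero => simp only [map_zero]
    | tmul r a => simp only [LinearMap.lTensor_tmul, A.map_trans]
    | add a b ha hb => simp only [map_add, ha, hb]
  one := 1 ⊗ₜ A.one
  mul := TensorProduct.map₂ (LinearMap.mul k R) A.mul
  mul_map e f z z' := by
    induction z using TensorProduct.induction_on with
    | zero => simp only [map_zero, LinearMap.zero_apply]
    | add a b ha hb => simp only [map_add, LinearMap.add_apply, ha, hb]
    | tmul r a =>
      induction z' using TensorProduct.induction_on with
      | zero => simp only [map_zero]
      | add a b ha hb => simp only [map_add, ha, hb]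
      | tmul s b => simp only [LinearMap.lTensor_tmul, TensorProduct.map₂_apply_tmul,
        TensorProduct.map_tmul, A.mul_map]
  mul_assoc z z' z'' := by
    induction z using TensorProduct.induction_on with
    | zero => simp only [map_zero, LinearMap.zero_apply]
    | add a b ha hb => simp only [map_add, LinearMap.add_apply, ha, hb]
    | tmul r a =>
      induction z' using TensorProduct.induction_on with
      | zero => simp only [map_zero, LinearMap.zero_apply]
      | add a b ha hb => simp only [map_add, LinearMap.add_apply, ha, hb]
      | tmul s b =>
        induction z'' using TensorProduct.induction_on with
        | zero => simp only [map_zero]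
        | add a b ha hb => simp only [map_add, ha, hb]
        | tmul t c =>
          simp only [LinearMap.lTensor_tmul, TensorProduct.map₂_apply_tmul,
            TensorProduct.map_tmul, A.mul_assoc, LinearMap.mul_apply', _root_.mul_assoc]
  one_mul z := by
    induction z using TensorProduct.induction_on with
    | zero => simp only [map_zero]
    | tmul r a =>
      rw [TensorProduct.map₂_apply_tmul, TensorProduct.map_tmul, LinearMap.lTensor_tmul, A.one_mul,
        LinearMap.mul_apply', _root_.one_mul]
    | add a b ha hb => simp only [map_add, ha, hb]
  mul_one z := by
    induction z using TensorProduct.induction_on with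
    | zero => simp only [map_zero, LinearMap.zero_apply]
    | tmul r a =>
      rw [TensorProduct.map₂_apply_tmul, TensorProduct.map_tmul, LinearMap.lTensor_tmul, A.mul_one,
        LinearMap.mul_apply', _root_.mul_one]
    | add a b ha hb => simp only [map_add, LinearMap.add_apply, ha, hb]

namespace TwAlg

variable {R : Type w} [CommRing R] [Algebra k R] (A : TwAlg.{u, v} k)

/-- The map `a ↦ r ⊗ a`. -/
def extendMk (r : R) (p : ℕ) : A.obj p →ₗ[k] (A.extend R).obj p := TensorProduct.mk k R (A.obj p) r

/-- The map `r ⊗ a ↦ f r • a`. -/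
def extendEval (f : R →ₗ[k] k) (p : ℕ) : (A.extend R).obj p →ₗ[k] A.obj p :=
  TensorProduct.lift (LinearMap.lsmul k (A.obj p) ∘ₗ f)

theorem extendEval_mk (f : R →ₗ[k] k) (r : R) {p : ℕ} (a : A.obj p) :
    A.extendEval f p (A.extendMk r p a) = f r • a :=
  TensorProduct.lift.tmul _ _

theorem extendMk_map (r : R) {p q : ℕ} (e : Fin p ≃ Fin q) (a : A.obj p) :
    (A.extend R).map e (A.extendMk r p a) = A.extendMk r q (A.map e a) :=
  LinearMap.lTensor_tmul _ _ _ _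

theorem extendMk_mul (r r' : R) {p q : ℕ} (a : A.obj p) (b : A.obj q) :
    (A.extend R).mul (A.extendMk r p a) (A.extendMk r' q b) =
      A.extendMk (r * r') (p + q) (A.mul a b) :=
  congrArg (fun f => f (r' ⊗ₜ[k] b)) (TensorProduct.map₂_apply_tmul (LinearMap.mul k R) A.mul r a)

end TwAlg

open Polynomial

variable (M : SMod.{u, v} k)

/-- The morphism `Sym_𝕊 M → k[X] ⊗ Sym_𝕊 M` with `x ↦ X ⊗ x` for `x ∈ M`. -/
noncomputable def SymS.gradHom : TwAlg.Hom (SymS M) ((SymS M).extend k[X]) :=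
  SymS.lift
    { app p := (SymS M).extendMk X p ∘ₗ (SymS.ι M).app p
      app_map e x := by
        rw [LinearMap.comp_apply, LinearMap.comp_apply, TwAlg.extendMk_map, (SymS.ι M).app_map] }
    -- The relations of `Sym` are homogeneous of word length two, so both of their terms acquire the
    -- same factor `X * X`.
    fun {m n} x y => by
      rw [LinearMap.comp_apply, LinearMap.comp_apply, TwAlg.extendMk_mul, TwAlg.extendMk_mul,
        TwAlg.extendMk_map, ← map_sub, SymS.comm, map_zero]

variable {M}

theorem SymS.gradHom_ι {p : ℕ} (x : M.obj p) : (SymS.gradHom M).app p ((SymS.ι M).app p x) =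
    (SymS M).extendMk X p ((SymS.ι M).app p x) := rfl

theorem SymS.gradHom_word {n p : ℕ} {s : (SymS M).obj p} (hs : IsWord (SymS.ι M) n s) :
    (SymS.gradHom M).app p s = (SymS M).extendMk (X ^ n) p s := by
  induction hs with
  | one =>
    rw [(SymS.gradHom M).app_one, pow_zero]
    rfl
  | mul_ι x _ ih =>
    rw [(SymS.gradHom M).app_mul, ih, pow_succ, SymS.gradHom_ι, TwAlg.extendMk_mul]
  | map e _ ih => rw [(SymS.gradHom M).app_map, ih, TwAlg.extendMk_map]

/-- The projection of `Sym_𝕊 M` to the span of the words of length `n`. -/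
noncomputable def SymS.component (n p : ℕ) : (SymS M).obj p →ₗ[k] (SymS M).obj p :=
  (SymS M).extendEval (lcoeff k n) p ∘ₗ (SymS.gradHom M).app p

theorem SymS.component_word {j p : ℕ} {s : (SymS M).obj p} (hs : IsWord (SymS.ι M) j s) (n : ℕ) :
    SymS.component n p s = if n = j then s else 0 := by
  rw [SymS.component, LinearMap.comp_apply, SymS.gradHom_word hs, TwAlg.extendEval_mk,
    lcoeff_apply, coeff_X_pow, ite_smul, one_smul, zero_smul]

/-- The coefficient of `X ^ n` in `gradHom` is the identity on words of length `n` and kills shorter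
words. This grading, absent from `U`, is what turns statements modulo lower terms into exact ones.
-/
theorem SymS.eq_zero_of_mem_prev {n p : ℕ} {s : (SymS M).obj p}
    (hs : s ∈ wordSpan (SymS.ι M) n p) (hs' : s ∈ (wordFilt (SymS.ι M)).prev n p) : s = 0 := by
  have h₁ : wordSpan (SymS.ι M) n p ≤ LinearMap.ker (SymS.component n p - LinearMap.id) :=
    Submodule.span_le.2 fun u hu => by
      simp [SymS.component_word hu]
  have h₂ : (wordFilt (SymS.ι M)).prev n p ≤ LinearMap.ker (SymS.component n p) := by
    cases n with
    | zero => exact bot_le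
    | succ n =>
      refine Submodule.span_le.2 ?_
      rintro u ⟨j, hj, hu⟩
      simp [SymS.component_word hu, show n + 1 ≠ j by omega]
  have h₃ := h₁ hs
  have h₄ := h₂ hs'
  rw [LinearMap.mem_ker] at h₃ h₄
  rw [LinearMap.sub_apply, h₄, zero_sub, neg_eq_zero] at h₃
  exact h₃

end grading

/-! ### Symbols -/

section symbols

variable (h : TwLie.{u, v} k)

/-- The projection `T_𝕊 M → Sym_𝕊 M`. -/
def SymS.proj (M : SMod.{u, v} k) : TwAlg.Hom (FreeTw M) (SymS M) := (FreeTw M).quotMk _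

/-- The projection `T_𝕊 h → U_𝕊 h`. -/
def EnvS.proj : TwAlg.Hom (FreeTw h.toSMod) (EnvS h) := (FreeTw h.toSMod).quotMk _

theorem SymS.proj_ι (M : SMod.{u, v} k) (p : ℕ) (x : M.obj p) :
    (SymS.proj M).app p ((FreeTw.ι M).app p x) = (SymS.ι M).app p x := rfl

theorem EnvS.proj_ι (p : ℕ) (x : h.obj p) :
    (EnvS.proj h).app p ((FreeTw.ι h.toSMod).app p x) = (EnvS.ι h).app p x := rfl

theorem canonicalMap_ι (p : ℕ) (x : h.obj p) :
    (canonicalMap h).app p ((SymS.ι h.toSMod).app p x) =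
      (EnvS.filt h).cls 1 p ⟨(EnvS.ι h).app p x, ι_mem_wordFilt (EnvS.ι h) x⟩ := rfl

variable {h}

/-- A word is taken in the free algebra because an element of `Sym` has no preferred representative
in `U`, while a free word projects to both. -/
theorem canonicalMap_proj_word {n p : ℕ} {t : (FreeTw h.toSMod).obj p}
    (ht : IsWord (FreeTw.ι h.toSMod) n t) : ∃ hm : (EnvS.proj h).app p t ∈ (EnvS.filt h).F n p,
      (canonicalMap h).app p ((SymS.proj h.toSMod).app p t) =
        (EnvS.filt h).cls n p ⟨(EnvS.proj h).app p t, hm⟩ := by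
  induction ht with
  | one => exact ⟨(EnvS.filt h).one_mem, (canonicalMap h).app_one⟩
  | mul_ι x _ ih =>
    obtain ⟨hm, ih⟩ := ih
    refine ⟨(EnvS.filt h).mul_mem hm (ι_mem_wordFilt (EnvS.ι h) x), ?_⟩
    rw [(SymS.proj h.toSMod).app_mul, (canonicalMap h).app_mul, ih, SymS.proj_ι, canonicalMap_ι]
    exact (EnvS.filt h).grMul_cls _ _
  | map e _ ih =>
    obtain ⟨hm, ih⟩ := ih
    refine ⟨(EnvS.filt h).map_mem e hm, ?_⟩
    rw [(SymS.proj h.toSMod).app_map, (canonicalMap h).app_map, ih]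
    exact (EnvS.filt h).grMap_cls _ _

variable (h) in
/-- The linear maps underlying the canonical map. -/
def canonicalLin (p : ℕ) : (SymS h.toSMod).obj p →ₗ[k] (EnvS.filt h).GrObj p :=
  (canonicalMap h).app p

/-- The canonical map sends the image of a word to the class of the word. -/
theorem canonicalLin_proj {n p : ℕ} {t : (FreeTw h.toSMod).obj p}
    (ht : t ∈ wordSpan (FreeTw.ι h.toSMod) n p) :
    ∃ hm : (EnvS.proj h).app p t ∈ (EnvS.filt h).F n p,
      canonicalLin h p ((SymS.proj h.toSMod).app p t) =
        (EnvS.filt h).cls n p ⟨(EnvS.proj h).app p t, hm⟩ := by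
  induction ht using Submodule.span_induction with
  | mem t ht => exact canonicalMap_proj_word ht
  | zero =>
    have h₀ : (EnvS.proj h).app p 0 = 0 := map_zero _
    refine ⟨h₀ ▸ zero_mem _, ?_⟩
    rw [map_zero, map_zero]
    exact ((map_zero ((EnvS.filt h).cls n p)).symm.trans
      ((EnvS.filt h).cls_congr rfl h₀.symm))
  | add a b _ _ ha hb =>
    obtain ⟨ha, ha'⟩ := ha
    obtain ⟨hb, hb'⟩ := hb
    refine ⟨by rw [map_add]; exact add_mem ha hb, ?_⟩
    rw [map_add, map_add, ha', hb']
    exact (map_add ((EnvS.filt h).cls n p) _ _).symm.trans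
      ((EnvS.filt h).cls_congr rfl (map_add _ _ _).symm)
  | smul c a _ ha =>
    obtain ⟨ha, ha'⟩ := ha
    refine ⟨by rw [map_smul]; exact Submodule.smul_mem _ _ ha, ?_⟩
    rw [map_smul, map_smul, ha']
    exact (map_smul ((EnvS.filt h).cls n p) _ _).symm.trans
      ((EnvS.filt h).cls_congr rfl (map_smul _ _ _).symm)

theorem SymS.exists_proj {M : SMod.{u, v} k} {n p : ℕ} {s : (SymS M).obj p}
    (hs : s ∈ wordSpan (SymS.ι M) n p) :
    ∃ t ∈ wordSpan (FreeTw.ι M) n p, (SymS.proj M).app p t = s := by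
  rw [← wordSpan_map (SymS.proj M) (SymS.proj_ι M)] at hs
  exact hs

/-- An element of filtration `n` is a combination of words of length `n` up to filtration
`n - 1`. -/
theorem EnvS.exists_proj {n p : ℕ} {u : (EnvS h).obj p} (hu : u ∈ (EnvS.filt h).F n p) :
    ∃ t ∈ wordSpan (FreeTw.ι h.toSMod) n p, u - (EnvS.proj h).app p t ∈ (EnvS.filt h).prev n p := by
  rw [EnvS.filt, wordFilt_eq_sup, ← wordSpan_map (EnvS.proj h) (EnvS.proj_ι h)] at hu
  obtain ⟨u', hu', _, ⟨t, ht, rfl⟩, rfl⟩ := Submodule.mem_sup.1 hu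
  exact ⟨t, ht, by rwa [add_sub_cancel_right]⟩

theorem SymS.exists_proj_sub {M : SMod.{u, v} k} {n p : ℕ} {s : (SymS M).obj p}
    (hs : s ∈ (wordFilt (SymS.ι M)).F n p) :
    ∃ t ∈ wordSpan (FreeTw.ι M) n p,
      s - (SymS.proj M).app p t ∈ (wordFilt (SymS.ι M)).prev n p := by
  rw [wordFilt_eq_sup, ← wordSpan_map (SymS.proj M) (SymS.proj_ι M)] at hs
  obtain ⟨s', hs', _, ⟨t, ht, rfl⟩, rfl⟩ := Submodule.mem_sup.1 hs
  exact ⟨t, ht, by rwa [add_sub_cancel_right]⟩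

/-- The canonical map is surjective. -/
theorem canonicalLin_surjective (p : ℕ) : Function.Surjective (canonicalLin h p) := by
  intro z
  induction z using (EnvS.filt h).gr_induction with
  | zero => exact ⟨0, map_zero _⟩
  | add a b ha hb =>
    obtain ⟨s, rfl⟩ := ha
    obtain ⟨t, rfl⟩ := hb
    exact ⟨s + t, map_add _ _ _⟩
  | cls n x =>
    obtain ⟨t, ht, hx⟩ := EnvS.exists_proj x.2
    obtain ⟨hm, ht⟩ := canonicalLin_proj ht
    refine ⟨_, ht.trans ?_⟩
    have h₀ := (EnvS.filt h).cls_eq_zero (x := x - ⟨(EnvS.proj h).app p t, hm⟩) hx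
    rw [map_sub, sub_eq_zero] at h₀
    exact h₀.symm

/-- The component of degree `n` of an element of `gr A`. -/
def TwFilt.grComponent {A : TwAlg.{u, v} k} (𝓕 : TwFilt A) (n p : ℕ) :
    𝓕.GrObj p →ₗ[k] 𝓕.Piece n p :=
  DirectSum.component k ℕ (fun n => 𝓕.Piece n p) n

/-- The component of degree `n` of the class is the class of `x` in the quotient `F_n / F_{n-1}`. -/
theorem TwFilt.mem_prev_of_grComponent {A : TwAlg.{u, v} k} (𝓕 : TwFilt A) {n p : ℕ}
    {x : 𝓕.F n p} (hx : 𝓕.grComponent n p (𝓕.cls n p x) = 0) : (x : A.obj p) ∈ 𝓕.prev n p := by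
  have h : 𝓕.grComponent n p (𝓕.cls n p x) = 𝓕.pieceMk n p x :=
    DirectSum.component.lof_self (M := fun n => 𝓕.Piece n p) k n _
  exact (Submodule.Quotient.mk_eq_zero ((𝓕.prev n p).comap (𝓕.F n p).subtype) (x := x)).1
    (h.symm.trans hx)

theorem TwFilt.grComponent_cls_of_ne {A : TwAlg.{u, v} k} (𝓕 : TwFilt A) {j n p : ℕ}
    (hj : j ≠ n) (x : 𝓕.F j p) : 𝓕.grComponent n p (𝓕.cls j p x) = 0 :=
  (DirectSum.component.of (M := fun n => 𝓕.Piece n p) k n j _).trans (dif_neg hj)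

/-- The canonical map takes words of length `j` to `gr_j`, and here only `j < n` occurs. -/
theorem grComponent_canonicalLin {n p : ℕ} {s : (SymS h.toSMod).obj p}
    (hs : s ∈ (wordFilt (SymS.ι h.toSMod)).prev n p) :
    (EnvS.filt h).grComponent n p (canonicalLin h p s) = 0 := by
  cases n with
  | zero =>
    obtain rfl : s = 0 := hs
    rw [map_zero, map_zero]
  | succ n =>
    induction hs using Submodule.span_induction with
    | mem s hs =>
      obtain ⟨j, hj, hs⟩ := hs
      obtain ⟨t, ht, rfl⟩ := hs.exists_lift (SymS.proj h.toSMod) (SymS.proj_ι h.toSMod)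
      obtain ⟨hm, ht⟩ := canonicalLin_proj (Submodule.subset_span ht)
      rw [ht]
      exact (EnvS.filt h).grComponent_cls_of_ne (by omega) _
    | zero => rw [map_zero, map_zero]
    | add a b _ _ ha hb => rw [map_add, map_add, ha, hb, add_zero]
    | smul c a _ ha => rw [map_smul, map_smul, ha, smul_zero]

end symbols

/-! ### The criterion for the Poincaré–Birkhoff–Witt theorem -/

section criterion

variable {h : TwLie.{u, v} k}

/-- `ψ` preserves the unit, and is right `h`-linear up to terms of lower filtration. -/
structure IsSymbolMap (ψ : SMod.Hom (EnvS h).toSMod (SymS h.toSMod).toSMod) : Prop where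
  app_one : ψ.app 0 (EnvS h).one = (SymS h.toSMod).one
  -- Both terms of the difference would a priori lie only in step `n + 1`.
  app_mul_ι : ∀ {n p q : ℕ} (u : (EnvS h).obj p) (x : h.obj q),
    ψ.app p u ∈ (wordFilt (SymS.ι h.toSMod)).F n p →
      ψ.app (p + q) ((EnvS h).mul u ((EnvS.ι h).app q x)) -
        (SymS h.toSMod).mul (ψ.app p u) ((SymS.ι h.toSMod).app q x) ∈
          (wordFilt (SymS.ι h.toSMod)).F n (p + q)

namespace IsSymbolMap

variable {ψ : SMod.Hom (EnvS h).toSMod (SymS h.toSMod).toSMod}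

/-- Induction on the last letter. For a word `u x` with `u` of length `n`, the error splits into `ψ
(u x) - ψ u x`, which is in `F_n` by assumption, and `(ψ u - u) x`, where the first factor is in
`F_{n-1}` by induction. -/
theorem sub_mem_prev_of_isWord (hψ : IsSymbolMap ψ) {n p : ℕ} {t : (FreeTw h.toSMod).obj p}
    (ht : IsWord (FreeTw.ι h.toSMod) n t) :
    ψ.app p ((EnvS.proj h).app p t) - (SymS.proj h.toSMod).app p t ∈
      (wordFilt (SymS.ι h.toSMod)).prev n p := by
  induction ht with
  | one =>
    rw [(EnvS.proj h).app_one, (SymS.proj h.toSMod).app_one, hψ.app_one, sub_self]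
    exact zero_mem _
  | @mul_ι n p q u x ht ih =>
    rw [(EnvS.proj h).app_mul, (SymS.proj h.toSMod).app_mul, EnvS.proj_ι, SymS.proj_ι]
    have hm : (SymS.proj h.toSMod).app p u ∈ (wordFilt (SymS.ι h.toSMod)).F n p :=
      Submodule.subset_span ⟨n, le_rfl, ht.image _ (SymS.proj_ι h.toSMod)⟩
    have hm' := add_mem (TwFilt.prev_le _ n p ih) hm
    rw [sub_add_cancel] at hm'
    have h₁ := hψ.app_mul_ι _ x hm'
    have h₂ := TwFilt.mul_mem_prev_left _ ih (ι_mem_wordFilt (SymS.ι h.toSMod) x)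
    rw [LinearMap.map_sub₂] at h₂
    have h₃ := add_mem h₁ h₂
    rwa [sub_add_sub_cancel] at h₃
  | map e _ ih =>
    rw [(EnvS.proj h).app_map, (SymS.proj h.toSMod).app_map, ψ.app_map, ← map_sub]
    exact TwFilt.map_mem_prev _ e ih

/-- On words of length `n`, the map `ψ` is the identity up to terms of lower filtration. -/
theorem sub_mem_prev (hψ : IsSymbolMap ψ) {n p : ℕ} {t : (FreeTw h.toSMod).obj p}
    (ht : t ∈ wordSpan (FreeTw.ι h.toSMod) n p) :
    ψ.app p ((EnvS.proj h).app p t) - (SymS.proj h.toSMod).app p t ∈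
      (wordFilt (SymS.ι h.toSMod)).prev n p := by
  induction ht using Submodule.span_induction with
  | mem t ht => exact hψ.sub_mem_prev_of_isWord ht
  | zero =>
    rw [map_zero, map_zero, map_zero, sub_zero]
    exact zero_mem _
  | add a b _ _ ha hb =>
    rw [map_add, map_add, map_add, add_sub_add_comm]
    exact add_mem ha hb
  | smul c a _ ha =>
    rw [map_smul, map_smul, map_smul, ← smul_sub]
    exact Submodule.smul_mem _ c ha

theorem map_mem (hψ : IsSymbolMap ψ) {n p : ℕ} {u : (EnvS h).obj p}
    (hu : u ∈ (EnvS.filt h).F n p) : ψ.app p u ∈ (wordFilt (SymS.ι h.toSMod)).F n p := by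
  have key : (EnvS.filt h).F n p ≤ ((wordFilt (SymS.ι h.toSMod)).F n p).comap (ψ.app p) := by
    refine Submodule.span_le.2 ?_
    rintro u ⟨j, hj, hu⟩
    obtain ⟨t, ht, rfl⟩ := hu.exists_lift (EnvS.proj h) (EnvS.proj_ι h)
    have h₁ := TwFilt.prev_le _ _ _ (hψ.sub_mem_prev (Submodule.subset_span ht))
    have h₂ := add_mem h₁ (wordSpan_le (SymS.ι h.toSMod) j p
      (Submodule.subset_span (ht.image _ (SymS.proj_ι h.toSMod))))
    rw [sub_add_cancel] at h₂
    exact wordFilt_mono _ hj p h₂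
  exact key hu

theorem map_mem_prev (hψ : IsSymbolMap ψ) {n p : ℕ} {u : (EnvS h).obj p}
    (hu : u ∈ (EnvS.filt h).prev n p) : ψ.app p u ∈ (wordFilt (SymS.ι h.toSMod)).prev n p := by
  cases n with
  | zero =>
    obtain rfl : u = 0 := hu
    rw [map_zero]
    exact zero_mem _
  | succ n => exact hψ.map_mem hu

/-- A combination of words of length `n` of filtration `n - 1` in `U_𝕊 h` vanishes in
`Sym_𝕊 h`. -/
theorem proj_eq_zero (hψ : IsSymbolMap ψ) {n p : ℕ} {t : (FreeTw h.toSMod).obj p}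
    (ht : t ∈ wordSpan (FreeTw.ι h.toSMod) n p)
    (ht' : ψ.app p ((EnvS.proj h).app p t) ∈ (wordFilt (SymS.ι h.toSMod)).prev n p) :
    (SymS.proj h.toSMod).app p t = 0 := by
  -- The image of `t` is homogeneous of length `n`, and also of filtration `n - 1` as the difference
  -- of `ψ t` and `ψ t - t`.
  refine SymS.eq_zero_of_mem_prev (n := n) ?_ ?_
  · rw [← wordSpan_map (SymS.proj h.toSMod) (SymS.proj_ι h.toSMod)]
    exact Submodule.mem_map_of_mem ht
  · have h₁ := sub_mem ht' (hψ.sub_mem_prev ht)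
    rwa [sub_sub_cancel] at h₁

/-- Descent along the filtration of `Sym`. If `s` in `F_n` has image zero, its leading part `t` has
zero class in `gr_n U`, so `t` lies in `F_{n-1} U`. Then `t` vanishes in `Sym` and `s` is in
`F_{n-1}`. -/
theorem canonicalLin_injective (hψ : IsSymbolMap ψ) (p : ℕ) :
    Function.Injective (canonicalLin h p) := by
  -- Indexing by `prev` starts the induction at the zero submodule; the step `n + 1` concerns `F_n`.
  have key : ∀ (n : ℕ) (s : (SymS h.toSMod).obj p), s ∈ (wordFilt (SymS.ι h.toSMod)).prev n p →
      canonicalLin h p s = 0 → s = 0 := by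
    intro n
    induction n with
    | zero => exact fun s hs _ => hs
    | succ n ih =>
      intro s hs hs'
      obtain ⟨t, ht, hst⟩ := SymS.exists_proj_sub hs
      obtain ⟨hm, hc⟩ := canonicalLin_proj ht
      have h₁ := grComponent_canonicalLin hst
      rw [map_sub, hs', zero_sub, map_neg, neg_eq_zero, hc] at h₁
      have h₂ := hψ.proj_eq_zero ht (hψ.map_mem_prev ((EnvS.filt h).mem_prev_of_grComponent h₁))
      rw [h₂, sub_zero] at hst
      exact ih s hst hs'
  refine (injective_iff_map_eq_zero _).2 fun s hs => ?_
  obtain ⟨n, hn⟩ := SymS.generates h.toSMod p s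
  exact key (n + 1) s hn hs

/-- The same descent, along the filtration of `U`: the leading part of an element of the kernel
vanishes in `Sym`, and the canonical map transfers this to its class in `gr U`. -/
theorem injective (hψ : IsSymbolMap ψ) (p : ℕ) : Function.Injective (ψ.app p) := by
  have key : ∀ (n : ℕ) (u : (EnvS h).obj p), u ∈ (EnvS.filt h).prev n p →
      ψ.app p u = 0 → u = 0 := by
    intro n
    induction n with
    | zero => exact fun u hu _ => hu
    | succ n ih =>
      intro u hu hu'
      obtain ⟨t, ht, hut⟩ := EnvS.exists_proj hu
      obtain ⟨hm, hc⟩ := canonicalLin_proj ht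
      -- As `ψ u = 0`, the image `ψ t` is `-ψ (u - t)`, hence of lower filtration.
      have h₁ := neg_mem (hψ.map_mem_prev hut)
      rw [map_sub, hu', zero_sub, neg_neg] at h₁
      -- The class of `t` in `gr_n U` is the canonical image of its projection to `Sym`, which is
      -- zero.
      rw [hψ.proj_eq_zero ht h₁, map_zero] at hc
      have h₂ := (EnvS.filt h).mem_prev_of_grComponent
        ((congrArg ((EnvS.filt h).grComponent n p) hc.symm).trans (map_zero _))
      have h₃ := add_mem hut h₂
      rw [sub_add_cancel] at h₃
      exact ih u h₃ hu'
  refine (injective_iff_map_eq_zero _).2 fun u hu => ?_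
  obtain ⟨n, hn⟩ := EnvS.generates h p u
  exact key (n + 1) u hn hu

/-- The map `ψ` is strictly compatible with the filtrations. -/
theorem exists_preimage (hψ : IsSymbolMap ψ) (n p : ℕ) :
    ∀ s ∈ (wordFilt (SymS.ι h.toSMod)).prev n p, ∃ u ∈ (EnvS.filt h).prev n p, ψ.app p u = s := by
  induction n with
  | zero =>
    rintro s hs
    obtain rfl : s = 0 := hs
    exact ⟨0, zero_mem _, map_zero _⟩
  | succ n ih =>
    intro s hs
    obtain ⟨t, ht, hst⟩ := SymS.exists_proj_sub hs
    obtain ⟨hm, -⟩ := canonicalLin_proj ht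
    -- The remainder `s - ψ t` equals `(s - t) - (ψ t - t)`, both parts of which are of lower
    -- filtration.
    obtain ⟨u, hu, hu'⟩ := ih _ (sub_mem hst (hψ.sub_mem_prev ht))
    refine ⟨u + (EnvS.proj h).app p t, add_mem (TwFilt.prev_le _ n p hu) hm, ?_⟩
    rw [map_add, hu']
    abel

theorem surjective (hψ : IsSymbolMap ψ) (p : ℕ) : Function.Surjective (ψ.app p) := by
  intro s
  obtain ⟨n, hn⟩ := SymS.generates h.toSMod p s
  obtain ⟨u, -, hu⟩ := hψ.exists_preimage (n + 1) p s hn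
  exact ⟨u, hu⟩

theorem bijective (hψ : IsSymbolMap ψ) (p : ℕ) : Function.Bijective (ψ.app p) :=
  ⟨hψ.injective p, hψ.surjective p⟩

/-- The inverse of `ψ`. -/
noncomputable def inv (hψ : IsSymbolMap ψ) : SMod.Hom (SymS h.toSMod).toSMod (EnvS h).toSMod where
  app p := (LinearEquiv.ofBijective (ψ.app p) (hψ.bijective p)).symm
  app_map {p q} e s := by
    refine hψ.injective q ?_
    rw [ψ.app_map]
    exact (LinearEquiv.apply_symm_apply (LinearEquiv.ofBijective (ψ.app q) (hψ.bijective q)) _).trans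
      (congrArg ((SymS h.toSMod).map e) (LinearEquiv.apply_symm_apply
        (LinearEquiv.ofBijective (ψ.app p) (hψ.bijective p)) s).symm)

theorem app_inv (hψ : IsSymbolMap ψ) {p : ℕ} (s : (SymS h.toSMod).obj p) :
    ψ.app p (hψ.inv.app p s) = s :=
  LinearEquiv.apply_symm_apply (LinearEquiv.ofBijective (ψ.app p) (hψ.bijective p)) s

theorem inv_app (hψ : IsSymbolMap ψ) {p : ℕ} (u : (EnvS h).obj p) :
    hψ.inv.app p (ψ.app p u) = u :=
  hψ.injective p (hψ.app_inv _)

theorem inv_bijective (hψ : IsSymbolMap ψ) (p : ℕ) : Function.Bijective (hψ.inv.app p) :=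
  Function.bijective_iff_has_inverse.2 ⟨ψ.app p, fun s => hψ.app_inv s, fun u => hψ.inv_app u⟩

/-- The inverse of `ψ` lifts the canonical map. -/
theorem cls_inv (hψ : IsSymbolMap ψ) {n p : ℕ} {s : (SymS h.toSMod).obj p}
    (hs : s ∈ wordSpan (SymS.ι h.toSMod) n p) :
    ∃ hm : hψ.inv.app p s ∈ (EnvS.filt h).F n p,
      (EnvS.filt h).cls n p ⟨hψ.inv.app p s, hm⟩ = canonicalLin h p s := by
  obtain ⟨t, ht, rfl⟩ := SymS.exists_proj hs
  obtain ⟨hm, hc⟩ := canonicalLin_proj ht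
  -- The correction `ψ t - t` is lifted to lower filtration in `U`. Thus `ψ⁻¹` sends the image of
  -- `t` in `Sym` to `t - u`, which has the same class as `t` in `gr_n U`.
  obtain ⟨u, hu, hu'⟩ := hψ.exists_preimage n p _ (hψ.sub_mem_prev ht)
  have h₁ : hψ.inv.app p ((SymS.proj h.toSMod).app p t) = (EnvS.proj h).app p t - u := by
    refine hψ.injective p ?_
    rw [hψ.app_inv, map_sub, hu', sub_sub_cancel]
  have hu₀ := TwFilt.prev_le _ n p hu
  refine ⟨h₁ ▸ sub_mem hm hu₀, ?_⟩
  have h₂ := (EnvS.filt h).cls_eq_zero (x := ⟨u, hu₀⟩) hu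
  refine ((EnvS.filt h).cls_congr (y := ⟨_, hm⟩ - ⟨u, hu₀⟩) rfl h₁).trans ?_
  rw [map_sub, h₂, sub_zero, hc]

end IsSymbolMap

end criterion

/-! ### The theorem for twisted pre-Lie algebras -/

section main

/-- A derivation replaces one letter `z` at a time by the single letter `ρ.op z x`, so word length
is kept. -/
theorem SymS.deriv_mem {M : SMod.{u, v} k} {G : SMod.{u, w} k} (ρ : RAct M G) {n p m : ℕ}
    {s : (SymS M).obj p} (hs : s ∈ (wordFilt (SymS.ι M)).F n p) (x : G.obj m) :
    (SymS.deriv ρ).op s x ∈ (wordFilt (SymS.ι M)).F n (p + m) := by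
  have word : ∀ {n p : ℕ} {s : (SymS M).obj p}, IsWord (SymS.ι M) n s →
      (SymS.deriv ρ).op s x ∈ (wordFilt (SymS.ι M)).F n (p + m) := by
    intro n p s hs
    induction hs with
    | one =>
      rw [SymS.deriv_one]
      exact zero_mem _
    | @mul_ι n p q s z hs ih =>
      rw [SymS.deriv_mul_ι]
      exact add_mem (TwFilt.map_mem _ _ (TwFilt.mul_mem _
          (Submodule.subset_span ⟨n, le_rfl, hs⟩) (ι_mem_wordFilt _ _)))
        (TwFilt.map_mem _ _ (TwFilt.mul_mem _ ih (ι_mem_wordFilt _ _)))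
    | map e _ ih =>
      rw [RAct.op_map_left]
      exact TwFilt.map_mem _ _ ih
  have key : (wordFilt (SymS.ι M)).F n p ≤
      ((wordFilt (SymS.ι M)).F n (p + m)).comap ((SymS.deriv ρ).op.flip x) :=
    Submodule.span_le.2 fun s ⟨j, hj, hs⟩ => wordFilt_mono _ hj _ (word hs)
  exact key hs

/-- The difference in `app_mul_ι` is exactly the derivation term `ψ u ∘ x`, which stays in the same
filtration step as `ψ u`. -/
theorem EnvS.toSym_isSymbolMap (g : TwPreLie.{u, v} k) :
    IsSymbolMap (h := g.toTwLie) (EnvS.toSym g) where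
  app_one := EnvS.toSym_one g
  app_mul_ι {n p q} u x hu := by
    have h₁ := SymS.deriv_mem g.act hu x
    have h₂ := (EnvS.toSym_mul_ι g u x).trans (SymS.envAct_op g _ x)
    have h₃ := sub_eq_of_eq_add' h₂
    exact (congrArg (· ∈ (wordFilt (SymS.ι g.toSMod)).F n (p + q)) h₃).mpr h₁

theorem Tens.mapLin_mapLin_of_inverse {M : SMod.{u, v} k} {N : SMod.{u, w} k}
    {f : SMod.Hom M N} {f' : SMod.Hom N M}
    (hf : ∀ (p : ℕ) (x : M.obj p), f'.app p (f.app p x) = x) {p : ℕ} (z : TensObj M M p) :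
    Tens.mapLin f' f' p (Tens.mapLin f f p z) = z := by
  induction z using Tens.induction with
  | zero => simp only [map_zero]
  | add a b ha hb => simp only [map_add, ha, hb]
  | mk e x y => rw [Tens.mapLin_mk, Tens.mapLin_mk, hf, hf]

end main

end TwPBW

theorem corollary4p7 {k : Type u} [CommRing k] (g : TwPBW.TwPreLie.{u, v} k) :
    -- the canonical morphism of twisted algebras `Sym_𝕊 g → gr U_𝕊 g` is an isomorphism
    (∀ p, Function.Bijective ((TwPBW.canonicalMap g.toTwLie).app p)) ∧
    -- it lifts to an isomorphism of twisted coalgebras `Φ : Sym_𝕊 g → U_𝕊 g`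
    ∃ Φ : TwPBW.SMod.Hom (TwPBW.SymS g.toTwLie.toSMod).toSMod (TwPBW.EnvS g.toTwLie).toSMod,
      (∀ p, Function.Bijective (Φ.app p)) ∧
      (∀ p (s : (TwPBW.SymS g.toTwLie.toSMod).obj p),
        (TwPBW.EnvS.comul g.toTwLie).app p (Φ.app p s) =
          (TwPBW.Tens.mapHom Φ Φ).app p ((TwPBW.SymS.comul g.toTwLie.toSMod).app p s)) ∧
      (∀ p (s : (TwPBW.SymS g.toTwLie.toSMod).obj p),
        (TwPBW.EnvS.counit g.toTwLie).app p (Φ.app p s) =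
          (TwPBW.SymS.counit g.toTwLie.toSMod).app p s) ∧
      -- `Φ` maps `Sym^n` to `F_n U`, and the class of `Φ s` in `gr_n U` is the canonical image
      (∀ n p, ∀ s ∈ TwPBW.wordSpan (TwPBW.SymS.ι g.toTwLie.toSMod) n p,
        ∃ h : Φ.app p s ∈ (TwPBW.EnvS.filt g.toTwLie).F n p,
          (TwPBW.EnvS.filt g.toTwLie).cls n p ⟨Φ.app p s, h⟩ =
            (TwPBW.canonicalMap g.toTwLie).app p s) := by
  have hψ := TwPBW.EnvS.toSym_isSymbolMap g
  refine ⟨fun p => ⟨hψ.canonicalLin_injective p, TwPBW.canonicalLin_surjective p⟩,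
    hψ.inv, hψ.inv_bijective, fun p s => ?_, fun p s => ?_, fun n p s hs => hψ.cls_inv hs⟩
  -- With `s = ψ u`, the claim is `EnvS.comul_toSym` after applying `ψ⁻¹ ⊗ ψ⁻¹`.
  · obtain ⟨u, rfl⟩ := hψ.surjective p s
    have h₁ := TwPBW.EnvS.comul_toSym g u
    have h₂ := TwPBW.Tens.mapLin_mapLin_of_inverse (f := TwPBW.EnvS.toSym g) (f' := hψ.inv)
      (fun _ u => hψ.inv_app u) ((TwPBW.EnvS.comul g.toTwLie).toTens p u)
    rw [hψ.inv_app]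
    exact h₂.symm.trans (congrArg (TwPBW.Tens.mapLin hψ.inv hψ.inv p) h₁.symm)
  · obtain ⟨u, rfl⟩ := hψ.surjective p s
    rw [hψ.inv_app]
    exact (TwPBW.EnvS.counit_toSym g u).symm
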